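/- \textbf{Setting.} Let $1\le n\le p$, let $X\in\mathbb{R}^{n\times p}$ be such that every $n$ of its columns are linearly independent, let $\mathcal{G}_1,\dots,\mathcal{G}_J$ be a partition of $\{1,\dots,p\}$, let $w_1,\dots,w_J>0$, $\lambda>0$ and $\beta_0\in\mathbb{R}^p$. For $v\in\mathbb{R}^p$ write $v_B=(v_k)_{k\in B}$ and $v_{(j)}=v_{\mathcal{G}_j}$; $M_B$ denotes the columns of a matrix $M$ indexed by $B$, and $\mathcal{G}_A=\bigcup_{j\in A}\mathcal{G}_j$. Put $\Psi=\frac1n X^{\mathsf T}X$ and let $W$ be the diagonal matrix with $W_{kk}=w_j$ for $k\in\mathcal{G}_j$. The program under consideration is the block Lasso with the block-$(1,\infty)$ norm, $$\min_{\beta\in\mathbb{R}^p}\ \frac{1}{2n}\|y-X\beta\|_2^2+\lambda\sum_{j=1}^J w_j\|\beta_{(j)}\|_\infty ,\qquad(\ast)$$ and it is assumed that $(\ast)$ has a unique solution for Lebesgue-almost every $y\in\mathbb{R}^n$. An augmented solution for $y$ is a pair $(\hat\beta,S)$ such that $\hat\beta$ solves $(\ast)$, $S_{(j)}$ is a subgradient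 of $\|\cdot\|_\infty$ at $\hat\beta_{(j)}$ for each $j$, and $\Psi\hat\beta+\lambda WS=\frac1nX^{\mathsf T}y$. Let $y=X\beta_0+\varepsilon$, where $\varepsilon$ is a random vector such that $\varepsilon/\sqrt n$ has a density $g_n$ on $\mathbb{R}^n$, and let $(\hat\beta,S)$ be an augmented solution for $y$ almost surely. Put $\mathcal{A}=\{j:\hat\beta_{(j)}\ne0\}$, $\mathcal{K}=\{k\in\mathcal{G}_{\mathcal A}:S_k\neq0\}$ and $\hat\gamma_j=\|\hat\beta_{(j)}\|_\infty$. For $A\subset\{1,\dots,J\}$ and $K\subset\mathcal{G}_A$ put $K^c=\mathcal{G}_A\setminus K$, $K_j=K\cap\mathcal{G}_j$, $K_j^c=K^c\cap\mathcal{G}_j$, $I=\{1,\dots,p\}\setminus K^c$. Call $(A,K)$ admissible if $|A|\le n$, $K_j\neq\varnothing$ for all $j\in A$, and $|K^c|\le n-|A|$; then put $q=n-|A|-|K^c|$. With $\mathcal{V}=\mathrm{row}(XW^{-1})$ let $$\mathcal{C}_j=\{(r,v)\in(0,\infty)\times\mathbb{R}^{K_j^c}:\|v\|_\infty\le r\},$$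 $$\mathcal{M}_{A,K}=\{s\in\mathcal{V}:\ \|s_{K_j}\|_1=1,\ s_{K_j^c}=0\ \ \forall j\in A,\ \ \|s_{(j)}\|_1\le1\ \ \forall j\notin A\},\qquad \Omega_{A,K}=\Big(\prod_{j\in A}\mathcal{C}_j\Big)\times\mathcal{M}_{A,K}.$$ A point $s\in\mathcal{M}_{A,K}$ is interior if $s_k\ne0$ for $k\in K$ and $\|s_{(j)}\|_1<1$ for $j\notin A$. For $s\in\mathcal{M}_{A,K}$, the differentials at $s$ are the $ds\in\mathcal{V}$ with $ds_{K^c}=0$ and $\langle\mathrm{sgn}(s_{K_j}),ds_{K_j}\rangle=0$ for $j\in A$. A set $F$ of $q$ indices is a set of free coordinates at $s$ with matrix $T\in\mathbb{R}^{I\times F}$ if $ds_F$ takes every value in $\mathbb{R}^F$ and $ds_I=T\,ds_F$ for all differentials $ds$ at $s$. Given $(r_A,b_{K^c},s)\in\Omega_{A,K}$ let $b\in\mathbb{R}^p$ have the coordinates $b_{K^c}$ on $K^c$, $b_k=r_j\,\mathrm{sgn}(s_k)$ for $k\in K_j$, $j\in A$, and $b_k=0$ for $k\notin\mathcal{G}_A$.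 Put $$\tilde H_{A,K}(r_A,b_{K^c},s)=\sqrt n\,(X^{\mathsf T})^{+}(\Psi b+\lambda Ws-\Psi\beta_0),$$ $$J_{A,K}(s)=\det\Big[\sqrt n\,(X^{\mathsf T})^{+}\big[\{\Psi\circ\mathrm{sgn}(s)\}_A\mid\Psi_{K^c}\mid\lambda W_IT\big]\Big],$$ where $(\cdot)^+$ is the Moore--Penrose inverse and $\Psi\circ\mathrm{sgn}(s)$ has the columns $\Psi_{(j)}\mathrm{sgn}(s_{(j)})$, $j=1,\dots,J$. \textbf{Theorem.} Under these assumptions: (i) For almost every $y$ there is exactly one augmented solution. Almost surely $(\mathcal{A},\mathcal{K})$ is admissible, $(\hat\gamma_{\mathcal A},\hat\beta_{\mathcal{K}^c},S)\in\Omega_{\mathcal{A},\mathcal{K}}$, $S$ is an interior point of $\mathcal{M}_{\mathcal{A},\mathcal{K}}$, and $\hat\beta$ is the vector $b$ obtained from $(\hat\gamma_{\mathcal A},\hat\beta_{\mathcal{K}^c},S)$. (ii) For every admissible $(A,K)$, each $\mathcal{C}_j$ with $j\in A$ is a convex cone and $\mathcal{M}_{A,K}$ is a polyhedral set (a finite union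 of convex polyhedra). At every interior point $s$ of $\mathcal{M}_{A,K}$ there is a set $F$ of $q$ free coordinates with a matrix $T$, and near $s$ the set $\mathcal{M}_{A,K}$ is parameterized by $s_F$: for some open $U\ni s$, the map $x\mapsto x_F$ is a bijection from $\mathcal{M}_{A,K}\cap U$ onto an open subset of $\mathbb{R}^F$, and $x_I-s_I=T(x_F-s_F)$ for all $x\in\mathcal{M}_{A,K}\cap U$. (iii) On $\Omega_{A,K}$ the distribution of the augmented estimator is given by the $n$-form $$d\mu_{A,K}=g_n\big(\tilde H_{A,K}(r_A,b_{K^c},s)\big)\,|J_{A,K}(s)|\,d\theta,\qquad\theta=(r_A,b_{K^c},s_F)\in\mathbb{R}^n .$$ That is, for every admissible $(A,K)$, every set $F$ of $q$ indices, every measurable $\Gamma\subset\prod_{j\in A}\mathcal{C}_j$, every measurable $\Delta\subset\mathbb{R}^F$ and every continuous $\Phi:\Delta\to\mathcal{M}_{A,K}$ with $\Phi(u)_F=u$ such that $F$ is a set of free coordinates at each point of $\Phi(\Delta)$, $$\mathbb{P}\big\{(\hat\gamma_A,\hat\beta_{K^c})\in\Gamma,\ S\in\Phi(\Delta),\ \mathcal{A}=A,\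 \mathcal{K}=K\big\}=\int_{\Gamma\times\Delta}g_n\big(\tilde H_{A,K}(r_A,b_{K^c},\Phi(s_F))\big)\,|J_{A,K}(\Phi(s_F))|\,d\theta .$$ -/

import Mathlib

open MeasureTheory

namespace BlockLasso

noncomputable section

/-! The predictors `Fin p` are partitioned into blocks by a labelling `grp : Fin p → Fin J`;
block `j` consists of all `k` with `grp k = j`. -/

/-- Every `n ∧ p` columns of `X` are linearly independent. -/
def ColumnsIndependent {n p : ℕ} (X : Matrix (Fin n) (Fin p) ℝ) : Prop :=
  ∀ t : Finset (Fin p), t.card = min n p →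
    LinearIndependent ℝ (fun k : t => fun i : Fin n => X i k)

/-- The sup norm of the block `β_(j)` (the norm on a function type is the sup norm). -/
def blockSup {p J : ℕ} (grp : Fin p → Fin J) (β : Fin p → ℝ) (j : Fin J) : ℝ :=
  ‖fun k : {k : Fin p // grp k = j} => β k‖

/-- The `ℓ₁` norm of the block `s_(j)`. -/
def blockL1 {p J : ℕ} (grp : Fin p → Fin J) (s : Fin p → ℝ) (j : Fin J) : ℝ :=
  ∑ k with grp k = j, |s k|

/-- The penalized loss `‖y - Xβ‖² / (2n) + λ ∑ⱼ wⱼ ‖β_(j)‖_∞`, with the Euclidean norm of the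
residual. -/
def loss {n p J : ℕ} (X : Matrix (Fin n) (Fin p) ℝ) (grp : Fin p → Fin J) (w : Fin J → ℝ)
    (lam : ℝ) (y : Fin n → ℝ) (β : Fin p → ℝ) : ℝ :=
  1 / (2 * (n : ℝ)) * ∑ i, (y i - (X.mulVec β) i) ^ 2 + lam * ∑ j, w j * blockSup grp β j

/-- `β` is a block Lasso solution for the block-(1,∞) norm and the response `y`. -/
def IsSolution {n p J : ℕ} (X : Matrix (Fin n) (Fin p) ℝ) (grp : Fin p → Fin J) (w : Fin J → ℝ)
    (lam : ℝ) (y : Fin n → ℝ) (β : Fin p → ℝ) : Prop :=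
  ∀ b : Fin p → ℝ, loss X grp w lam y β ≤ loss X grp w lam y b

/-- `S_(j)` is a subgradient of the sup norm at `β_(j)`. -/
def IsBlockSubgradient {p J : ℕ} (grp : Fin p → Fin J) (β S : Fin p → ℝ) (j : Fin J) : Prop :=
  ∀ b : Fin p → ℝ, blockSup grp β j + ∑ k with grp k = j, S k * (b k - β k) ≤ blockSup grp b j

/-- The Gram matrix `Ψ = XᵀX / n`. -/
def gram {n p : ℕ} (X : Matrix (Fin n) (Fin p) ℝ) : Matrix (Fin p) (Fin p) ℝ :=
  (1 / (n : ℝ)) • (X.transpose * X)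

/-- The diagonal weight matrix `W`. -/
def weight {p J : ℕ} (grp : Fin p → Fin J) (w : Fin J → ℝ) : Matrix (Fin p) (Fin p) ℝ :=
  Matrix.diagonal (fun k => w (grp k))

/-- `(β, S)` is an augmented solution: `β` solves the program, `S` consists of subgradients of the
block norms at `β`, and the KKT equation `Ψ β + λ W S = Xᵀ y / n` holds. -/
structure IsAugmentedSolution {n p J : ℕ} (X : Matrix (Fin n) (Fin p) ℝ) (grp : Fin p → Fin J)
    (w : Fin J → ℝ) (lam : ℝ) (y : Fin n → ℝ) (β S : Fin p → ℝ) : Prop where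
  solution : IsSolution X grp w lam y β
  subgradient : ∀ j, IsBlockSubgradient grp β S j
  kkt : (gram X).mulVec β + lam • (weight grp w).mulVec S
    = (1 / (n : ℝ)) • X.transpose.mulVec y

/-- The active blocks `G(β) = {j : β_(j) ≠ 0}`. -/
def activeBlocks {p J : ℕ} (grp : Fin p → Fin J) (β : Fin p → ℝ) : Finset (Fin J) :=
  Finset.univ.filter (fun j => ∃ k, grp k = j ∧ β k ≠ 0)

open Classical in
/-- The set `𝒦` of the indices `k` in the active blocks of `β` with `S k ≠ 0`. -/
def activeSupport {p J : ℕ} (grp : Fin p → Fin J) (β S : Fin p → ℝ) : Finset (Fin p) :=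
  Finset.univ.filter (fun k => grp k ∈ activeBlocks grp β ∧ S k ≠ 0)

/-- `Kᶜ = 𝒢_A \ K`. -/
def coSupport {p J : ℕ} (grp : Fin p → Fin J) (A : Finset (Fin J)) (K : Finset (Fin p)) :
    Finset (Fin p) :=
  Finset.univ.filter (fun k => grp k ∈ A ∧ k ∉ K)

/-- `I = ℕ_p \ Kᶜ`. -/
def freeIndices {p J : ℕ} (grp : Fin p → Fin J) (A : Finset (Fin J)) (K : Finset (Fin p)) :
    Finset (Fin p) :=
  (coSupport grp A K)ᶜ

/-- The range of `(𝒜, 𝒦)`: `|A| ≤ n`, `K ⊆ 𝒢_A` meets every block in `A`, and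
`|𝒢_A \ K| ≤ n - |A|`. -/
structure Admissible {p J : ℕ} (n : ℕ) (grp : Fin p → Fin J) (A : Finset (Fin J))
    (K : Finset (Fin p)) : Prop where
  card_le : A.card ≤ n
  subset : ∀ k ∈ K, grp k ∈ A
  meets : ∀ j ∈ A, ∃ k ∈ K, grp k = j
  card_coSupport_le : (coSupport grp A K).card ≤ n - A.card

/-- `𝒱 = row(X W⁻¹)`. -/
def rowSpace {n p J : ℕ} (X : Matrix (Fin n) (Fin p) ℝ) (grp : Fin p → Fin J) (w : Fin J → ℝ) :
    Submodule ℝ (Fin p → ℝ) :=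
  Submodule.span ℝ (Set.range (fun i : Fin n => (X * (weight grp w)⁻¹) i))

/-- The space `ℳ_{A,K}` of subgradient vectors. -/
def subgradientSpace {n p J : ℕ} (X : Matrix (Fin n) (Fin p) ℝ) (grp : Fin p → Fin J)
    (w : Fin J → ℝ) (A : Finset (Fin J)) (K : Finset (Fin p)) : Set (Fin p → ℝ) :=
  {s | s ∈ rowSpace X grp w ∧ (∀ j ∈ A, ∑ k ∈ K with grp k = j, |s k| = 1) ∧
    (∀ k ∈ coSupport grp A K, s k = 0) ∧ ∀ j ∉ A, blockL1 grp s j ≤ 1}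

/-- The interior points of `ℳ_{A,K}`: the inequality constraints are strict and no coordinate
in `K` vanishes. -/
def subgradientInterior {n p J : ℕ} (X : Matrix (Fin n) (Fin p) ℝ) (grp : Fin p → Fin J)
    (w : Fin J → ℝ) (A : Finset (Fin J)) (K : Finset (Fin p)) : Set (Fin p → ℝ) :=
  {s | s ∈ subgradientSpace X grp w A K ∧ (∀ k ∈ K, s k ≠ 0) ∧ ∀ j ∉ A, blockL1 grp s j < 1}

/-- The cone `𝒞_j` of pairs `(r, v)` with `r > 0` and `‖v‖_∞ ≤ r`, `v` indexed by `K_jᶜ`. -/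
def blockCone {p J : ℕ} (grp : Fin p → Fin J) (A : Finset (Fin J)) (K : Finset (Fin p))
    (j : Fin J) : Set (ℝ × ({k : coSupport grp A K // grp k = j} → ℝ)) :=
  {q | 0 < q.1 ∧ ‖q.2‖ ≤ q.1}

/-- The product cone `∏_{j ∈ A} 𝒞_j`, the space of `(r_A, b_{Kᶜ})`. -/
def coneProduct {p J : ℕ} (grp : Fin p → Fin J) (A : Finset (Fin J)) (K : Finset (Fin p)) :
    Set ((A → ℝ) × (coSupport grp A K → ℝ)) :=
  {q | ∀ j : A, (q.1 j, fun k : {k : coSupport grp A K // grp k = j} => q.2 k)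
    ∈ blockCone grp A K j}

/-- The piece `Ω_{A,K} = (∏_{j ∈ A} 𝒞_j) × ℳ_{A,K}` of the sample space. -/
def piece {n p J : ℕ} (X : Matrix (Fin n) (Fin p) ℝ) (grp : Fin p → Fin J) (w : Fin J → ℝ)
    (A : Finset (Fin J)) (K : Finset (Fin p)) :
    Set (((A → ℝ) × (coSupport grp A K → ℝ)) × (Fin p → ℝ)) :=
  coneProduct grp A K ×ˢ subgradientSpace X grp w A K

/-- The coordinates `(γ_A, β_{Kᶜ})` of `β`. -/
def coordinates {p J : ℕ} (grp : Fin p → Fin J) (A : Finset (Fin J)) (K : Finset (Fin p))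
    (β : Fin p → ℝ) : (A → ℝ) × (coSupport grp A K → ℝ) :=
  (fun j => blockSup grp β j, fun k => β k)

/-- The coefficient vector `b` represented by `(r_A, b_{Kᶜ}, s, A, K)`: `b_k` is given for
`k ∈ Kᶜ`, `b_k = r_j sgn(s_k)` for the other `k` in a block `j ∈ A`, and `b_k = 0` outside `𝒢_A`. -/
def coefficient {p J : ℕ} (grp : Fin p → Fin J) (A : Finset (Fin J)) (K : Finset (Fin p))
    (q : (A → ℝ) × (coSupport grp A K → ℝ)) (s : Fin p → ℝ) : Fin p → ℝ :=
  fun k => if hk : k ∈ coSupport grp A K then q.2 ⟨k, hk⟩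
    else if hj : grp k ∈ A then q.1 ⟨grp k, hj⟩ * Real.sign (s k) else 0

/-- `(MᵀM)⁻¹Mᵀ`, the Moore-Penrose inverse of a matrix `M` of full column rank. -/
def pinv {m n : ℕ} (M : Matrix (Fin m) (Fin n) ℝ) : Matrix (Fin n) (Fin m) ℝ :=
  (M.transpose * M)⁻¹ * M.transpose

theorem pinv_penrose {m n : ℕ} (M : Matrix (Fin m) (Fin n) ℝ)
    (h : IsUnit (M.transpose * M).det) :
    M * pinv M * M = M ∧ pinv M * M * pinv M = pinv M ∧
      (M * pinv M).transpose = M * pinv M ∧ (pinv M * M).transpose = pinv M * M := by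
  have h1 : pinv M * M = 1 := by
    rw [pinv, Matrix.mul_assoc, Matrix.nonsing_inv_mul _ h]
  refine ⟨?_, ?_, ?_, ?_⟩
  · rw [Matrix.mul_assoc, h1, Matrix.mul_one]
  · rw [h1, Matrix.one_mul]
  · simp [pinv, Matrix.transpose_mul, Matrix.transpose_nonsing_inv, Matrix.mul_assoc]
  · rw [h1, Matrix.transpose_one]

/-- `H̃(b, s) = √n (Xᵀ)⁺ (Ψ b + λ W s - Ψ β₀)`. -/
def scaledMap {n p J : ℕ} (X : Matrix (Fin n) (Fin p) ℝ) (grp : Fin p → Fin J) (w : Fin J → ℝ)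
    (lam : ℝ) (β₀ b s : Fin p → ℝ) : Fin n → ℝ :=
  Real.sqrt n • (pinv X.transpose).mulVec
    ((gram X).mulVec b + lam • (weight grp w).mulVec s - (gram X).mulVec β₀)

/-- The differentials `ds` at a point `s` of `ℳ_{A,K}`: `ds ∈ 𝒱`, `ds_{Kᶜ} = 0`, and
`⟨sgn(s_{K_j}), ds_{K_j}⟩ = 0` for all `j ∈ A`. -/
def tangentSpace {n p J : ℕ} (X : Matrix (Fin n) (Fin p) ℝ) (grp : Fin p → Fin J)
    (w : Fin J → ℝ) (A : Finset (Fin J)) (K : Finset (Fin p)) (s : Fin p → ℝ) :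
    Set (Fin p → ℝ) :=
  {ds | ds ∈ rowSpace X grp w ∧ (∀ k ∈ coSupport grp A K, ds k = 0) ∧
    ∀ j ∈ A, ∑ k ∈ K with grp k = j, Real.sign (s k) * ds k = 0}

/-- The coordinates `ds_F` are free coordinates for the differentials `ds` at `s`, and
`ds_I = T ds_F`. -/
structure IsTangentMatrix {n p J : ℕ} (X : Matrix (Fin n) (Fin p) ℝ) (grp : Fin p → Fin J)
    (w : Fin J → ℝ) (A : Finset (Fin J)) (K : Finset (Fin p)) (s : Fin p → ℝ)
    (F : Finset (Fin p)) (T : Matrix (freeIndices grp A K) F ℝ) : Prop where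
  eq_mulVec : ∀ ds ∈ tangentSpace X grp w A K s,
    (fun k : freeIndices grp A K => ds k) = T.mulVec (fun k : F => ds k)
  free : ∀ t : F → ℝ, ∃ ds ∈ tangentSpace X grp w A K s, (fun k : F => ds k) = t

/-- `Ψ ∘ sgn(s)`, whose `j`-th column is `Ψ_(j) sgn(s_(j))`. -/
def gramSign {n p J : ℕ} (X : Matrix (Fin n) (Fin p) ℝ) (grp : Fin p → Fin J) (s : Fin p → ℝ) :
    Matrix (Fin p) (Fin J) ℝ :=
  Matrix.of (fun i j => ∑ k with grp k = j, gram X i k * Real.sign (s k))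

/-- `M(s, A, K; λ) = [{Ψ ∘ sgn(s)}_A | Ψ_{Kᶜ} | λ W_I T]`, with columns indexed by the coordinates
of `θ = (r_A, b_{Kᶜ}, s_F)`. -/
def tangentMap {n p J : ℕ} (X : Matrix (Fin n) (Fin p) ℝ) (grp : Fin p → Fin J) (w : Fin J → ℝ)
    (lam : ℝ) (A : Finset (Fin J)) (K : Finset (Fin p)) (s : Fin p → ℝ) (F : Finset (Fin p))
    (T : Matrix (freeIndices grp A K) F ℝ) :
    Matrix (Fin p) (A ⊕ (coSupport grp A K ⊕ F)) ℝ :=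
  Matrix.fromCols ((gramSign X grp s).submatrix id (fun j : A => (j : Fin J)))
    (Matrix.fromCols ((gram X).submatrix id (fun k : coSupport grp A K => (k : Fin p)))
      (lam • ((weight grp w).submatrix id (fun k : freeIndices grp A K => (k : Fin p)) * T)))

/-- The Jacobian `J_{A,K}(s; λ) = det[√n (Xᵀ)⁺ M(s, A, K; λ)]`; `e` enumerates the `n` coordinates
of `θ`, and its choice only affects the sign. -/
def jacobian {n p J : ℕ} (X : Matrix (Fin n) (Fin p) ℝ) (grp : Fin p → Fin J) (w : Fin J → ℝ)
    (lam : ℝ) (A : Finset (Fin J)) (K : Finset (Fin p)) (s : Fin p → ℝ) (F : Finset (Fin p))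
    (T : Matrix (freeIndices grp A K) F ℝ) (e : A ⊕ (coSupport grp A K ⊕ F) ≃ Fin n) : ℝ :=
  ((Real.sqrt n • (pinv X.transpose * tangentMap X grp w lam A K s F T)).submatrix id e.symm).det

/-- The density `f_{A,K} = g_n(H̃_{A,K}(r_A, b_{Kᶜ}, s; β₀, λ)) |J_{A,K}(s; λ)|`. -/
def density {n p J : ℕ} (X : Matrix (Fin n) (Fin p) ℝ) (grp : Fin p → Fin J) (w : Fin J → ℝ)
    (lam : ℝ) (β₀ : Fin p → ℝ) (g : (Fin n → ℝ) → ENNReal) (A : Finset (Fin J))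
    (K : Finset (Fin p)) (F : Finset (Fin p)) (T : Matrix (freeIndices grp A K) F ℝ)
    (e : A ⊕ (coSupport grp A K ⊕ F) ≃ Fin n) (q : (A → ℝ) × (coSupport grp A K → ℝ))
    (s : Fin p → ℝ) : ENNReal :=
  g (scaledMap X grp w lam β₀ (coefficient grp A K q s) s) *
    ENNReal.ofReal |jacobian X grp w lam A K s F T e|

/-- A convex polyhedron: a finite intersection of closed half-spaces. -/
def IsPolyhedron {p : ℕ} (P : Set (Fin p → ℝ)) : Prop :=
  ∃ t : Finset ((Fin p → ℝ) × ℝ), P = {x | ∀ c ∈ t, ∑ k, c.1 k * x k ≤ c.2}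

/-- A polyhedral set: a finite union of convex polyhedra. -/
def IsPolyhedral {p : ℕ} (P : Set (Fin p → ℝ)) : Prop :=
  ∃ C : Set (Set (Fin p → ℝ)), C.Finite ∧ (∀ Q ∈ C, IsPolyhedron Q) ∧ P = ⋃₀ C

end

end BlockLasso

open BlockLasso

namespace BlockLasso

/-! The argument rests on the KKT equation in dual form, `S = dual X grp w ((nλ)⁻¹ • (y - Xβ))` with
`dual z = W⁻¹Xᵀz`. A subgradient of the sup norm is an equality case of Hölder's inequality. So an
augmented solution is a pair satisfying this equation with `‖S_(j)‖₁ ≤ 1` and `β` aligned with `S`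
(`IsAligned`): `|β_k| ≤ r_j`, with `β_k = r_j sgn(S_k)` where `S_k ≠ 0`, and `r_j = 0` unless block
`j` is saturated, i.e. `‖S_(j)‖₁ = 1`. Once the signs of `S` and the saturated blocks are fixed, all
these conditions are convex.

Two consequences of almost everywhere uniqueness drive the proof. The first is strict
complementarity (`ae_strict_complementarity`): the responses with a fixed pattern form a convex set,
whose frontier is null. From an interior response one can remove a small fit that is positive on all
saturated blocks and restore it in the coefficients, so saturated blocks are active. The second is
injectivity of the design on the vectors compatible with a feasible `s`
(`expand_eq_zero_of_mulVec_eq_zero`): a kernel direction would give two solutions for an open set of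
responses. This bounds `|A| + |Kᶜ|` by `n`. Since the differentials at `s` are the dual image of the
orthogonal complement of the fits of the piece, it also gives them dimension `q`.

For the density, `(Xᵀ)⁺` inverts `Xᵀ`, so the KKT equation says that `ε/√n` equals `H̃` at the
parameters (`eq_dual_iff_scaledMap`). By uniqueness the event is that the scaled noise lies in an
image under `H̃` (`mem_event_iff`). On one sign pattern `H̃` is affine in `θ`, with the matrix of
the Jacobian (`scaledMap_affine`), and the change of variables applies. The finitely many patterns
are then summed. The integral also runs over parameters of non-interior points, which are negligible
by injectivity (`volume_not_interior`). -/

/-! ### Block norms, subgradients of the sup norm, and alignment. -/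

theorem abs_le_blockSup {p J : ℕ} (grp : Fin p → Fin J) (β : Fin p → ℝ) (k : Fin p) :
    |β k| ≤ blockSup grp β (grp k) :=
  norm_le_pi_norm (fun l : {l : Fin p // grp l = grp k} => β l) ⟨k, rfl⟩

theorem abs_le_blockSup_of_eq {p J : ℕ} (grp : Fin p → Fin J) (β : Fin p → ℝ) {k : Fin p}
    {j : Fin J} (h : grp k = j) : |β k| ≤ blockSup grp β j :=
  h ▸ abs_le_blockSup grp β k

theorem blockSup_nonneg {p J : ℕ} (grp : Fin p → Fin J) (β : Fin p → ℝ) (j : Fin J) :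
    0 ≤ blockSup grp β j :=
  norm_nonneg _

theorem blockSup_le {p J : ℕ} {grp : Fin p → Fin J} {β : Fin p → ℝ} {j : Fin J} {r : ℝ}
    (hr : 0 ≤ r) (h : ∀ k, grp k = j → |β k| ≤ r) : blockSup grp β j ≤ r :=
  (pi_norm_le_iff_of_nonneg hr).2 fun k => h k k.2

theorem blockSup_eq_zero_iff {p J : ℕ} {grp : Fin p → Fin J} {β : Fin p → ℝ} {j : Fin J} :
    blockSup grp β j = 0 ↔ ∀ k, grp k = j → β k = 0 := by
  constructor
  · intro h k hk
    have := abs_le_blockSup_of_eq grp β hk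
    rw [h] at this
    exact abs_nonpos_iff.1 this
  · intro h
    exact le_antisymm (blockSup_le le_rfl fun k hk => by simp [h k hk]) (blockSup_nonneg _ _ _)

theorem mem_activeBlocks_iff {p J : ℕ} {grp : Fin p → Fin J} {β : Fin p → ℝ} {j : Fin J} :
    j ∈ activeBlocks grp β ↔ blockSup grp β j ≠ 0 := by
  rw [Ne, blockSup_eq_zero_iff]
  simp [activeBlocks]

theorem blockSup_convex {p J : ℕ} (grp : Fin p → Fin J) (β b : Fin p → ℝ) (j : Fin J) {t : ℝ}
    (h0 : 0 ≤ t) (h1 : t ≤ 1) :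
    blockSup grp (fun k => (1 - t) * β k + t * b k) j
      ≤ (1 - t) * blockSup grp β j + t * blockSup grp b j := by
  have h1' : 0 ≤ 1 - t := by linarith
  refine blockSup_le (add_nonneg (mul_nonneg h1' (blockSup_nonneg _ _ _))
    (mul_nonneg h0 (blockSup_nonneg _ _ _))) fun k hk => ?_
  refine (abs_add_le _ _).trans ?_
  rw [abs_mul, abs_mul, abs_of_nonneg h1', abs_of_nonneg h0]
  gcongr <;> exact abs_le_blockSup_of_eq _ _ hk

theorem sign_mul_self_eq_abs (x : ℝ) : Real.sign x * x = |x| := by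
  rcases lt_trichotomy x 0 with h | h | h
  · rw [Real.sign_of_neg h, abs_of_neg h]; ring
  · simp [h]
  · rw [Real.sign_of_pos h, abs_of_pos h]; ring

theorem abs_sign_le_one (x : ℝ) : |Real.sign x| ≤ 1 := by
  rcases Real.sign_apply_eq x with h | h | h <;> simp [h]

theorem abs_sign_of_ne_zero {x : ℝ} (h : x ≠ 0) : |Real.sign x| = 1 := by
  rcases Real.sign_apply_eq_of_ne_zero x h with h | h <;> simp [h]

theorem sum_mul_le_blockL1_mul_blockSup {p J : ℕ} (grp : Fin p → Fin J) (S b : Fin p → ℝ)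
    (j : Fin J) :
    ∑ k with grp k = j, S k * b k ≤ blockL1 grp S j * blockSup grp b j := by
  rw [blockL1, Finset.sum_mul]
  refine Finset.sum_le_sum fun k hk => ?_
  refine (le_abs_self _).trans ?_
  rw [abs_mul]
  gcongr
  exact abs_le_blockSup_of_eq _ _ (by simpa using hk)

/-- Testing the subgradient inequality at `0` and `2β` gives the pairing identity, and testing it at
the sign vector of `S` gives the `ℓ₁` bound. The converse is Hölder's inequality. -/
theorem isBlockSubgradient_iff {p J : ℕ} {grp : Fin p → Fin J} {β S : Fin p → ℝ} {j : Fin J} :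
    IsBlockSubgradient grp β S j ↔
      blockL1 grp S j ≤ 1 ∧ ∑ k with grp k = j, S k * β k = blockSup grp β j := by
  constructor
  · intro h
    have hz := h 0
    have ht := h (fun k => 2 * β k)
    have e0 : blockSup grp (0 : Fin p → ℝ) j = 0 := blockSup_eq_zero_iff.2 fun _ _ => rfl
    have e2 : blockSup grp (fun k => 2 * β k) j ≤ 2 * blockSup grp β j :=
      blockSup_le (by have := blockSup_nonneg grp β j; linarith) fun k hk => by
        rw [abs_mul, abs_two]
        have := abs_le_blockSup_of_eq grp β hk
        linarith
    have s0 : ∑ k with grp k = j, S k * ((0 : Fin p → ℝ) k - β k)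
        = -∑ k with grp k = j, S k * β k := by
      rw [← Finset.sum_neg_distrib]
      exact Finset.sum_congr rfl fun k _ => by simp
    have s2 : ∑ k with grp k = j, S k * (2 * β k - β k) = ∑ k with grp k = j, S k * β k :=
      Finset.sum_congr rfl fun k _ => by ring
    rw [e0, s0] at hz
    rw [s2] at ht
    have heq : ∑ k with grp k = j, S k * β k = blockSup grp β j := by linarith
    refine ⟨?_, heq⟩
    have hs := h (fun k => Real.sign (S k))
    have e1 : blockSup grp (fun k => Real.sign (S k)) j ≤ 1 :=
      blockSup_le zero_le_one fun k _ => abs_sign_le_one _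
    have s1 : ∑ k with grp k = j, S k * (Real.sign (S k) - β k)
        = blockL1 grp S j - ∑ k with grp k = j, S k * β k := by
      rw [blockL1, ← Finset.sum_sub_distrib]
      exact Finset.sum_congr rfl fun k _ => by rw [← sign_mul_self_eq_abs]; ring
    rw [s1] at hs
    linarith
  · rintro ⟨h1, h2⟩ b
    have := sum_mul_le_blockL1_mul_blockSup grp S b j
    have h3 : blockL1 grp S j * blockSup grp b j ≤ 1 * blockSup grp b j :=
      mul_le_mul_of_nonneg_right h1 (blockSup_nonneg _ _ _)
    have s1 : ∑ k with grp k = j, S k * (b k - β k)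
        = ∑ k with grp k = j, S k * b k - ∑ k with grp k = j, S k * β k := by
      rw [← Finset.sum_sub_distrib]
      exact Finset.sum_congr rfl fun k _ => by ring
    rw [s1]
    linarith

/-- `b` attains the radius `r j` with the signs of `S` on each block, and vanishes on the blocks
where `S` has `ℓ₁` norm different from one. -/
structure IsAligned {p J : ℕ} (grp : Fin p → Fin J) (r : Fin J → ℝ) (b S : Fin p → ℝ) : Prop where
  nonneg : ∀ j, 0 ≤ r j
  abs_le : ∀ k, |b k| ≤ r (grp k)
  eq_sign : ∀ k, S k ≠ 0 → b k = r (grp k) * Real.sign (S k)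
  eq_zero : ∀ j, blockL1 grp S j ≠ 1 → r j = 0

theorem exists_ne_zero_of_blockL1 {p J : ℕ} {grp : Fin p → Fin J} {S : Fin p → ℝ} {j : Fin J}
    (h : blockL1 grp S j = 1) : ∃ k, grp k = j ∧ S k ≠ 0 := by
  by_contra hc
  push Not at hc
  have : blockL1 grp S j = 0 := Finset.sum_eq_zero fun k hk => by
    simp [hc k (by simpa using hk)]
  linarith

theorem IsAligned.blockSup_eq {p J : ℕ} {grp : Fin p → Fin J} {r : Fin J → ℝ} {b S : Fin p → ℝ}
    (h : IsAligned grp r b S) (j : Fin J) : blockSup grp b j = r j := by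
  refine le_antisymm (blockSup_le (h.nonneg j) fun k hk => hk ▸ h.abs_le k) ?_
  by_cases h1 : blockL1 grp S j = 1
  · obtain ⟨k, rfl, hk⟩ := exists_ne_zero_of_blockL1 h1
    have := abs_le_blockSup grp b k
    rwa [h.eq_sign k hk, abs_mul, abs_sign_of_ne_zero hk, mul_one,
      abs_of_nonneg (h.nonneg _)] at this
  · rw [h.eq_zero j h1]
    exact blockSup_nonneg _ _ _

theorem IsAligned.isBlockSubgradient {p J : ℕ} {grp : Fin p → Fin J} {r : Fin J → ℝ}
    {b S : Fin p → ℝ} (h : IsAligned grp r b S) {j : Fin J} (h1 : blockL1 grp S j ≤ 1) :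
    IsBlockSubgradient grp b S j := by
  rw [isBlockSubgradient_iff, h.blockSup_eq]
  refine ⟨h1, ?_⟩
  have : ∑ k with grp k = j, S k * b k = blockL1 grp S j * r j := by
    rw [blockL1, Finset.sum_mul]
    refine Finset.sum_congr rfl fun k hk => ?_
    have hk : grp k = j := by simpa using hk
    by_cases h0 : S k = 0
    · simp [h0]
    · rw [h.eq_sign k h0, hk, ← sign_mul_self_eq_abs]; ring
  rw [this]
  by_cases h2 : blockL1 grp S j = 1
  · rw [h2, one_mul]
  · rw [h.eq_zero j h2, mul_zero]

/-- Equality case of Hölder: the terms `|S_k| r_j - S_k b_k` are nonnegative with sum at most zero,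
so each vanishes. If `‖S_(j)‖₁ < 1`, equality forces the radius to be zero. -/
theorem isAligned_of_subgradient {p J : ℕ} {grp : Fin p → Fin J} {b S : Fin p → ℝ}
    (h : ∀ j, IsBlockSubgradient grp b S j) : IsAligned grp (blockSup grp b) b S := by
  refine ⟨blockSup_nonneg _ _, abs_le_blockSup _ _, fun k hk => ?_, fun j hj => ?_⟩
  · obtain ⟨h1, h2⟩ := isBlockSubgradient_iff.1 (h (grp k))
    have hnn : ∀ l ∈ Finset.univ.filter (fun l => grp l = grp k),
        0 ≤ |S l| * blockSup grp b (grp k) - S l * b l := by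
      intro l hl
      have h3 := abs_le_blockSup_of_eq grp b (k := l) (j := grp k) (by simpa using hl)
      have h4 : S l * b l ≤ |S l| * |b l| := by rw [← abs_mul]; exact le_abs_self _
      have h5 := mul_le_mul_of_nonneg_left h3 (abs_nonneg (S l))
      linarith
    have hs : ∑ l with grp l = grp k, (|S l| * blockSup grp b (grp k) - S l * b l) ≤ 0 := by
      rw [Finset.sum_sub_distrib, ← Finset.sum_mul, h2]
      have := mul_le_mul_of_nonneg_right h1 (blockSup_nonneg grp b (grp k))
      rw [blockL1] at this
      linarith
    have hz := (Finset.sum_eq_zero_iff_of_nonneg hnn).1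
      (le_antisymm hs (Finset.sum_nonneg hnn)) k (by simp)
    rw [← sign_mul_self_eq_abs] at hz
    have h7 : S k * (Real.sign (S k) * blockSup grp b (grp k) - b k) = 0 := by linarith
    rcases mul_eq_zero.1 h7 with h8 | h8
    · exact absurd h8 hk
    · linarith
  · obtain ⟨h1, h2⟩ := isBlockSubgradient_iff.1 (h j)
    have h3 := sum_mul_le_blockL1_mul_blockSup grp S b j
    have h4 : blockL1 grp S j < 1 := lt_of_le_of_ne h1 hj
    have := blockSup_nonneg grp b j
    nlinarith

/-! ### The KKT equation and first-order optimality. -/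

/-- The vector `W⁻¹ Xᵀ z`. -/
noncomputable def dual {n p J : ℕ} (X : Matrix (Fin n) (Fin p) ℝ) (grp : Fin p → Fin J)
    (w : Fin J → ℝ) : (Fin n → ℝ) →ₗ[ℝ] (Fin p → ℝ) where
  toFun z := fun k => X.transpose.mulVec z k / w (grp k)
  map_add' a b := by ext k; simp [Matrix.mulVec_add, add_div]
  map_smul' c a := by ext k; simp [Matrix.mulVec_smul, mul_div_assoc]

theorem dual_apply {n p J : ℕ} (X : Matrix (Fin n) (Fin p) ℝ) (grp : Fin p → Fin J)
    (w : Fin J → ℝ) (z : Fin n → ℝ) (k : Fin p) :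
    dual X grp w z k = X.transpose.mulVec z k / w (grp k) := rfl

/-- Points of `𝒱` are traded for vectors of `ℝⁿ`, where orthogonality to fitted values can be used.
-/
theorem mem_rowSpace_iff {n p J : ℕ} {X : Matrix (Fin n) (Fin p) ℝ} {grp : Fin p → Fin J}
    {w : Fin J → ℝ} (hw : ∀ j, 0 < w j) {s : Fin p → ℝ} :
    s ∈ rowSpace X grp w ↔ ∃ z, dual X grp w z = s := by
  have hinv : (weight grp w)⁻¹ = Matrix.diagonal (fun k => (w (grp k))⁻¹) := by
    refine Matrix.inv_eq_right_inv ?_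
    rw [weight, Matrix.diagonal_mul_diagonal, ← Matrix.diagonal_one]
    congr 1
    funext k
    exact mul_inv_cancel₀ (hw _).ne'
  have hrow : ∀ i, (X * (weight grp w)⁻¹) i = fun k => X i k / w (grp k) := by
    intro i
    ext k
    rw [hinv, Matrix.mul_diagonal, div_eq_mul_inv]
  rw [rowSpace, Submodule.mem_span_range_iff_exists_fun]
  refine exists_congr fun z => ?_
  have : ∑ i, z i • (X * (weight grp w)⁻¹) i = dual X grp w z := by
    ext k
    rw [Finset.sum_apply, dual_apply, Matrix.mulVec, dotProduct, Finset.sum_div]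
    refine Finset.sum_congr rfl fun i _ => ?_
    rw [hrow]
    simp only [Pi.smul_apply, smul_eq_mul, Matrix.transpose_apply]
    ring
  rw [this]

theorem gram_mulVec {n p : ℕ} (X : Matrix (Fin n) (Fin p) ℝ) (β : Fin p → ℝ) :
    (gram X).mulVec β = (1 / (n : ℝ)) • X.transpose.mulVec (X.mulVec β) := by
  rw [gram, Matrix.smul_mulVec, Matrix.mulVec_mulVec]

theorem weight_mulVec {p J : ℕ} (grp : Fin p → Fin J) (w : Fin J → ℝ) (S : Fin p → ℝ)
    (k : Fin p) : (weight grp w).mulVec S k = w (grp k) * S k := by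
  rw [weight, Matrix.mulVec_diagonal]

theorem weight_mulVec_dual {n p J : ℕ} (X : Matrix (Fin n) (Fin p) ℝ) (grp : Fin p → Fin J)
    {w : Fin J → ℝ} (hw : ∀ j, 0 < w j) (z : Fin n → ℝ) :
    (weight grp w).mulVec (dual X grp w z) = X.transpose.mulVec z := by
  ext k
  rw [weight_mulVec, dual_apply, mul_div_cancel₀ _ (hw _).ne']

/-- As `W` is invertible, `β` determines `S`; uniqueness of the solution therefore passes to the
pair. -/
theorem kkt_iff {n p J : ℕ} (hn : 0 < n) {X : Matrix (Fin n) (Fin p) ℝ} {grp : Fin p → Fin J}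
    {w : Fin J → ℝ} (hw : ∀ j, 0 < w j) {lam : ℝ} (hlam : 0 < lam) {y : Fin n → ℝ}
    {β S : Fin p → ℝ} :
    (gram X).mulVec β + lam • (weight grp w).mulVec S = (1 / (n : ℝ)) • X.transpose.mulVec y ↔
      S = dual X grp w (((n : ℝ) * lam)⁻¹ • (y - X.mulVec β)) := by
  have hn' : (0 : ℝ) < n := by exact_mod_cast hn
  rw [funext_iff, funext_iff]
  refine forall_congr' fun k => ?_
  have := hw (grp k)
  rw [gram_mulVec, dual_apply, Matrix.mulVec_smul, Matrix.mulVec_sub]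
  simp only [Pi.add_apply, Pi.smul_apply, smul_eq_mul, weight_mulVec, Pi.sub_apply]
  field_simp
  constructor <;> intro h <;> linarith

theorem sum_sq_sub_mulVec {n p : ℕ} (X : Matrix (Fin n) (Fin p) ℝ) (y : Fin n → ℝ)
    (β d : Fin p → ℝ) :
    ∑ i, (y i - X.mulVec (β + d) i) ^ 2 = ∑ i, (y i - X.mulVec β i) ^ 2
      - 2 * ∑ k, X.transpose.mulVec (y - X.mulVec β) k * d k + ∑ i, (X.mulVec d i) ^ 2 := by
  have h1 : ∑ k, X.transpose.mulVec (y - X.mulVec β) k * d k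
      = ∑ i, (y i - X.mulVec β i) * X.mulVec d i := by
    change X.transpose.mulVec (y - X.mulVec β) ⬝ᵥ d = (y - X.mulVec β) ⬝ᵥ X.mulVec d
    rw [Matrix.mulVec_transpose, Matrix.dotProduct_mulVec]
  rw [h1, Finset.mul_sum, ← Finset.sum_sub_distrib, ← Finset.sum_add_distrib]
  refine Finset.sum_congr rfl fun i _ => ?_
  rw [Matrix.mulVec_add, Pi.add_apply]
  ring

theorem sum_blocks {p J : ℕ} (grp : Fin p → Fin J) (w : Fin J → ℝ) (f : Fin p → ℝ) :
    ∑ j, w j * ∑ k with grp k = j, f k = ∑ k, w (grp k) * f k := by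
  rw [← Finset.sum_fiberwise (s := Finset.univ) (g := grp)]
  refine Finset.sum_congr rfl fun j _ => ?_
  rw [Finset.mul_sum]
  exact Finset.sum_congr rfl fun k hk => by rw [(Finset.mem_filter.1 hk).2]

/-- Sufficiency by convexity: the subgradient inequalities, summed with the weights, cancel the
linear term of the expanded quadratic and leave `‖X(b - β)‖² / (2n) ≥ 0`. -/
theorem isAugmentedSolution_of_dual {n p J : ℕ} (hn : 0 < n) {X : Matrix (Fin n) (Fin p) ℝ}
    {grp : Fin p → Fin J} {w : Fin J → ℝ} (hw : ∀ j, 0 < w j) {lam : ℝ} (hlam : 0 < lam)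
    {y : Fin n → ℝ} {β S : Fin p → ℝ} (hsub : ∀ j, IsBlockSubgradient grp β S j)
    (hS : S = dual X grp w (((n : ℝ) * lam)⁻¹ • (y - X.mulVec β))) :
    IsAugmentedSolution X grp w lam y β S := by
  refine ⟨fun b => ?_, hsub, (kkt_iff hn hw hlam).2 hS⟩
  have hn' : (0 : ℝ) < n := by exact_mod_cast hn
  have hb : b = β + (b - β) := by abel
  have h1 : ∑ j, w j * blockSup grp β j + ∑ k, w (grp k) * (S k * (b k - β k))
      ≤ ∑ j, w j * blockSup grp b j := by
    rw [← sum_blocks grp w fun k => S k * (b k - β k), ← Finset.sum_add_distrib]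
    refine Finset.sum_le_sum fun j _ => ?_
    rw [← mul_add]
    exact mul_le_mul_of_nonneg_left (hsub j b) (hw j).le
  have h2 : ∑ k, w (grp k) * (S k * (b k - β k))
      = ((n : ℝ) * lam)⁻¹ * ∑ k, X.transpose.mulVec (y - X.mulVec β) k * (b - β) k := by
    rw [Finset.mul_sum]
    refine Finset.sum_congr rfl fun k _ => ?_
    have := (hw (grp k)).ne'
    rw [hS, dual_apply, Matrix.mulVec_smul]
    simp only [Pi.smul_apply, smul_eq_mul, Pi.sub_apply]
    field_simp
  have h3 : 0 ≤ ∑ i, (X.mulVec (b - β) i) ^ 2 := Finset.sum_nonneg fun i _ => sq_nonneg _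
  have h4 := sum_sq_sub_mulVec X y β (b - β)
  rw [← hb] at h4
  rw [h2] at h1
  rw [loss, loss, h4]
  set Q := ∑ i, (X.mulVec (b - β) i) ^ 2
  set R := ∑ k, X.transpose.mulVec (y - X.mulVec β) k * (b - β) k
  have h5 := mul_le_mul_of_nonneg_left h1 hlam.le
  have h6 : lam * (((n : ℝ) * lam)⁻¹ * R) = 1 / (2 * (n : ℝ)) * (2 * R) := by field_simp
  have h7 : 0 ≤ 1 / (2 * (n : ℝ)) * Q := by positivity
  rw [mul_add, h6] at h5
  rw [mul_add, mul_sub]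
  linarith

/-- First-order optimality: a solution together with its dual vector is an augmented solution. -/
theorem IsSolution.isAugmentedSolution {n p J : ℕ} (hn : 0 < n) {X : Matrix (Fin n) (Fin p) ℝ}
    {grp : Fin p → Fin J} {w : Fin J → ℝ} (hw : ∀ j, 0 < w j) {lam : ℝ} (hlam : 0 < lam)
    {y : Fin n → ℝ} {β : Fin p → ℝ} (h : IsSolution X grp w lam y β) :
    IsAugmentedSolution X grp w lam y β
      (dual X grp w (((n : ℝ) * lam)⁻¹ • (y - X.mulVec β))) := by
  have hn' : (0 : ℝ) < n := by exact_mod_cast hn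
  refine isAugmentedSolution_of_dual hn hw hlam (fun j b => ?_) rfl
  set S := dual X grp w (((n : ℝ) * lam)⁻¹ • (y - X.mulVec β)) with hS
  -- Only block `j` moves, so the subgradient inequality is obtained block by block.
  set d : Fin p → ℝ := fun k => if grp k = j then b k - β k else 0 with hd
  set Q := ∑ i, (X.mulVec d i) ^ 2 with hQ
  set R := ∑ k with grp k = j, S k * (b k - β k) with hR
  have hQ0 : 0 ≤ Q := Finset.sum_nonneg fun i _ => sq_nonneg _
  have hwj := hw j
  have hRd : ∑ k, X.transpose.mulVec (y - X.mulVec β) k * d k = n * lam * w j * R := by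
    rw [hR, Finset.mul_sum, Finset.sum_filter]
    refine Finset.sum_congr rfl fun k _ => ?_
    by_cases hk : grp k = j
    · simp only [hd, hk, if_true]
      rw [hS, dual_apply, Matrix.mulVec_smul, hk]
      simp only [Pi.smul_apply, smul_eq_mul]
      field_simp
    · simp [hd, hk]
  -- Along `β + t d` convexity bounds the penalty linearly in `t`, and the quadratic remainder has
  -- order `t²`. After division by `t` the remainder disappears as `t → 0`.
  have key : ∀ t : ℝ, 0 < t → t ≤ 1 →
      0 ≤ lam * w j * (blockSup grp b j - blockSup grp β j - R) + t * (1 / (2 * n) * Q) := by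
    intro t ht ht1
    have hl := h (β + t • d)
    rw [loss, loss, sum_sq_sub_mulVec] at hl
    have e1 : ∑ k, X.transpose.mulVec (y - X.mulVec β) k * (t • d) k = t * (n * lam * w j * R) := by
      rw [← hRd, Finset.mul_sum]
      exact Finset.sum_congr rfl fun k _ => by simp; ring
    have e2 : ∑ i, (X.mulVec (t • d) i) ^ 2 = t ^ 2 * Q := by
      rw [hQ, Finset.mul_sum]
      exact Finset.sum_congr rfl fun k _ => by rw [Matrix.mulVec_smul]; simp; ring
    have e3 : ∑ i, w i * blockSup grp (β + t • d) i
        ≤ ∑ i, w i * blockSup grp β i + w j * (t * (blockSup grp b j - blockSup grp β j)) := by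
      rw [← Finset.add_sum_erase _ _ (Finset.mem_univ j),
        ← Finset.add_sum_erase _ (fun i => w i * blockSup grp β i) (Finset.mem_univ j)]
      have e4 : ∀ i ∈ Finset.univ.erase j,
          w i * blockSup grp (β + t • d) i = w i * blockSup grp β i := by
        intro i hi
        have : blockSup grp (β + t • d) i = blockSup grp β i := by
          rw [blockSup, blockSup]
          congr 1
          funext k
          have : grp k ≠ j := by rw [k.2]; exact (Finset.mem_erase.1 hi).1
          simp [hd, this]
        rw [this]
      rw [Finset.sum_congr rfl e4]
      have e5 : blockSup grp (β + t • d) j = blockSup grp (fun k => (1 - t) * β k + t * b k) j := by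
        rw [blockSup, blockSup]
        congr 1
        funext k
        simp only [hd, Pi.add_apply, Pi.smul_apply, smul_eq_mul, k.2, if_true]
        ring
      have e6 := blockSup_convex grp β b j ht.le ht1
      rw [← e5] at e6
      have := mul_le_mul_of_nonneg_left e6 hwj.le
      linarith
    rw [e1, e2] at hl
    have e7 := mul_le_mul_of_nonneg_left e3 hlam.le
    have e8 : 1 / (2 * (n : ℝ)) * (∑ i, (y i - X.mulVec β i) ^ 2
        - 2 * (t * (n * lam * w j * R)) + t ^ 2 * Q)
        = 1 / (2 * (n : ℝ)) * ∑ i, (y i - X.mulVec β i) ^ 2 - t * (lam * w j * R)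
          + t * (t * (1 / (2 * n) * Q)) := by
      field_simp
    rw [e8] at hl
    have e9 : 0 ≤ t * (lam * w j * (blockSup grp b j - blockSup grp β j - R)
        + t * (1 / (2 * n) * Q)) := by linarith
    exact (mul_nonneg_iff_of_pos_left ht).1 e9
  have hge : 0 ≤ lam * w j * (blockSup grp b j - blockSup grp β j - R) := by
    refine ge_of_tendsto (x := nhdsWithin (0 : ℝ) (Set.Ioi 0))
      (f := fun t : ℝ => lam * w j * (blockSup grp b j - blockSup grp β j - R)
        + t * (1 / (2 * n) * Q)) ?_ ?_
    · have : ContinuousAt (fun t : ℝ => lam * w j * (blockSup grp b j - blockSup grp β j - R)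
        + t * (1 / (2 * n) * Q)) 0 := by fun_prop
      simpa using this.tendsto.mono_left (nhdsWithin_le_nhds (s := Set.Ioi 0))
    · filter_upwards [Ioo_mem_nhdsGT (zero_lt_one' ℝ)] with t ht
      exact key t ht.1 ht.2.le
  have := (mul_nonneg_iff_of_pos_left (mul_pos hlam hwj)).1 hge
  linarith

theorem IsAugmentedSolution.eq_dual {n p J : ℕ} (hn : 0 < n) {X : Matrix (Fin n) (Fin p) ℝ}
    {grp : Fin p → Fin J} {w : Fin J → ℝ} (hw : ∀ j, 0 < w j) {lam : ℝ} (hlam : 0 < lam)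
    {y : Fin n → ℝ} {β S : Fin p → ℝ} (h : IsAugmentedSolution X grp w lam y β S) :
    S = dual X grp w (((n : ℝ) * lam)⁻¹ • (y - X.mulVec β)) :=
  (kkt_iff hn hw hlam).1 h.kkt

theorem IsAugmentedSolution.blockL1_le {n p J : ℕ} {X : Matrix (Fin n) (Fin p) ℝ}
    {grp : Fin p → Fin J} {w : Fin J → ℝ} {lam : ℝ}
    {y : Fin n → ℝ} {β S : Fin p → ℝ} (h : IsAugmentedSolution X grp w lam y β S) (j : Fin J) :
    blockL1 grp S j ≤ 1 :=
  (isBlockSubgradient_iff.1 (h.subgradient j)).1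

theorem IsAugmentedSolution.isAligned {n p J : ℕ} {X : Matrix (Fin n) (Fin p) ℝ}
    {grp : Fin p → Fin J} {w : Fin J → ℝ} {lam : ℝ}
    {y : Fin n → ℝ} {β S : Fin p → ℝ} (h : IsAugmentedSolution X grp w lam y β S) :
    IsAligned grp (blockSup grp β) β S :=
  isAligned_of_subgradient h.subgradient

theorem existsUnique_isAugmentedSolution {n p J : ℕ} (hn : 0 < n) {X : Matrix (Fin n) (Fin p) ℝ}
    {grp : Fin p → Fin J} {w : Fin J → ℝ} (hw : ∀ j, 0 < w j) {lam : ℝ} (hlam : 0 < lam)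
    {y : Fin n → ℝ} (h : ∃! β : Fin p → ℝ, IsSolution X grp w lam y β) :
    ∃! bs : (Fin p → ℝ) × (Fin p → ℝ), IsAugmentedSolution X grp w lam y bs.1 bs.2 := by
  obtain ⟨β, hβ, hu⟩ := h
  refine ⟨(β, _), hβ.isAugmentedSolution hn hw hlam, ?_⟩
  rintro ⟨b, s⟩ hbs
  have hb : b = β := hu b hbs.solution
  have hs := hbs.eq_dual hn hw hlam
  simp only at hs
  rw [hs, hb]

/-! ### Sign patterns and strict complementarity. -/

theorem real_sign_eq_signType (x : ℝ) : Real.sign x = ((SignType.sign x : SignType) : ℝ) := by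
  rcases lt_trichotomy x 0 with h | h | h
  · rw [Real.sign_of_neg h, sign_neg h]; rfl
  · simp [h]
  · rw [Real.sign_of_pos h, sign_pos h]; rfl

theorem sign_eq_of_signType_eq {x y : ℝ} (h : SignType.sign x = SignType.sign y) :
    Real.sign x = Real.sign y := by
  rw [real_sign_eq_signType, real_sign_eq_signType, h]

/-- The reals with a given sign form a convex set on which the absolute value is linear. Hence block
`ℓ₁` norms are affine along segments of a fixed pattern. -/
theorem sign_combo {x y a b : ℝ} (ha : 0 ≤ a) (hb : 0 ≤ b) (hab : a + b = 1)
    (h : SignType.sign x = SignType.sign y) :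
    SignType.sign (a * x + b * y) = SignType.sign x ∧ |a * x + b * y| = a * |x| + b * |y| := by
  have hpos : ∀ {u v : ℝ}, 0 < u → 0 < v → 0 < a * u + b * v := by
    intro u v hu hv
    rcases ha.eq_or_lt with rfl | ha'
    · have : b = 1 := by linarith
      simpa [this] using hv
    · exact add_pos_of_pos_of_nonneg (mul_pos ha' hu) (mul_nonneg hb hv.le)
  rcases lt_trichotomy x 0 with hx | hx | hx
  · have hy : y < 0 := by rw [sign_neg hx] at h; exact sign_eq_neg_one_iff.1 h.symm
    have := hpos (neg_pos.2 hx) (neg_pos.2 hy)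
    have h1 : a * x + b * y < 0 := by linarith
    rw [sign_neg h1, sign_neg hx, abs_of_neg h1, abs_of_neg hx, abs_of_neg hy]
    exact ⟨rfl, by ring⟩
  · have hy : y = 0 := by rw [hx, sign_zero] at h; exact sign_eq_zero_iff.1 h.symm
    simp [hx, hy]
  · have hy : 0 < y := by rw [sign_pos hx] at h; exact sign_eq_one_iff.1 h.symm
    have h1 := hpos hx hy
    rw [sign_pos h1, sign_pos hx, abs_of_pos h1, abs_of_pos hx, abs_of_pos hy]
    exact ⟨rfl, by ring⟩

/-- The responses with an augmented solution `(β, S)` such that `S` has the sign pattern `σ` and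
`E` is the set of the blocks where `S` has `ℓ₁` norm one. -/
def patternResponses {n p J : ℕ} (X : Matrix (Fin n) (Fin p) ℝ) (grp : Fin p → Fin J)
    (w : Fin J → ℝ) (lam : ℝ) (σ : Fin p → SignType) (E : Finset (Fin J)) : Set (Fin n → ℝ) :=
  {y | ∃ β S, IsAugmentedSolution X grp w lam y β S ∧ (∀ k, SignType.sign (S k) = σ k) ∧
    ∀ j, blockL1 grp S j = 1 ↔ j ∈ E}

/-- With the pattern fixed, the `ℓ₁` norms are linear in `S`, alignment is a convex condition on `β`
and the radii, and the KKT equation is linear in `(y, β, S)`. Convex combinations of augmented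
solutions thus remain augmented solutions. -/
theorem convex_patternResponses {n p J : ℕ} (hn : 0 < n) {X : Matrix (Fin n) (Fin p) ℝ}
    {grp : Fin p → Fin J} {w : Fin J → ℝ} (hw : ∀ j, 0 < w j) {lam : ℝ} (hlam : 0 < lam)
    (σ : Fin p → SignType) (E : Finset (Fin J)) :
    Convex ℝ (patternResponses X grp w lam σ E) := by
  rintro y₁ ⟨β₁, S₁, h₁, hσ₁, hE₁⟩ y₂ ⟨β₂, S₂, h₂, hσ₂, hE₂⟩ a b ha hb hab
  have hsign : ∀ k, SignType.sign (S₁ k) = SignType.sign (S₂ k) := fun k => by rw [hσ₁, hσ₂]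
  have hcombo := fun k => sign_combo ha hb hab (hsign k)
  have hL1 : ∀ j, blockL1 grp (a • S₁ + b • S₂) j = a * blockL1 grp S₁ j + b * blockL1 grp S₂ j := by
    intro j
    rw [blockL1, blockL1, blockL1, Finset.mul_sum, Finset.mul_sum, ← Finset.sum_add_distrib]
    exact Finset.sum_congr rfl fun k _ => (hcombo k).2
  have hE : ∀ j, blockL1 grp (a • S₁ + b • S₂) j = 1 ↔ j ∈ E := by
    intro j
    by_cases hj : j ∈ E
    · simp [hL1, (hE₁ j).2 hj, (hE₂ j).2 hj, hj, hab]
    · have l₁ : blockL1 grp S₁ j < 1 := lt_of_le_of_ne (h₁.blockL1_le j) fun h => hj ((hE₁ j).1 h)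
      have l₂ : blockL1 grp S₂ j < 1 := lt_of_le_of_ne (h₂.blockL1_le j) fun h => hj ((hE₂ j).1 h)
      have : a * blockL1 grp S₁ j + b * blockL1 grp S₂ j < 1 :=
        convex_Iio (𝕜 := ℝ) (1 : ℝ) l₁ l₂ ha hb hab
      simp [hL1, this.ne, hj]
  have hle : ∀ j, blockL1 grp (a • S₁ + b • S₂) j ≤ 1 := by
    intro j
    rw [hL1]
    exact convex_Iic (𝕜 := ℝ) (1 : ℝ) (h₁.blockL1_le j) (h₂.blockL1_le j) ha hb hab
  have a₁ := h₁.isAligned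
  have a₂ := h₂.isAligned
  have hal : IsAligned grp (fun j => a * blockSup grp β₁ j + b * blockSup grp β₂ j)
      (a • β₁ + b • β₂) (a • S₁ + b • S₂) := by
    refine ⟨fun j => add_nonneg (mul_nonneg ha (a₁.nonneg j)) (mul_nonneg hb (a₂.nonneg j)),
      fun k => ?_, fun k hk => ?_, fun j hj => ?_⟩
    · refine (abs_add_le _ _).trans ?_
      simp only [Pi.smul_apply, smul_eq_mul, abs_mul, abs_of_nonneg ha, abs_of_nonneg hb]
      gcongr
      · exact a₁.abs_le k
      · exact a₂.abs_le k
    · have hs := (hcombo k).1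
      have hk' : SignType.sign (a * S₁ k + b * S₂ k) ≠ 0 := sign_ne_zero.2 hk
      have k₁ : S₁ k ≠ 0 := by rw [hs] at hk'; exact sign_ne_zero.1 hk'
      have k₂ : S₂ k ≠ 0 := by rw [hs, hsign] at hk'; exact sign_ne_zero.1 hk'
      have e₁ : Real.sign ((a • S₁ + b • S₂) k) = Real.sign (S₁ k) := sign_eq_of_signType_eq hs
      have e₂ : Real.sign (S₂ k) = Real.sign (S₁ k) := sign_eq_of_signType_eq (hsign k).symm
      rw [e₁]
      simp only [Pi.add_apply, Pi.smul_apply, smul_eq_mul]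
      rw [a₁.eq_sign k k₁, a₂.eq_sign k k₂, e₂]
      ring
    · rw [Ne, hE, ← hE₁] at hj
      have hj' := hj
      rw [hE₁, ← hE₂] at hj'
      simp only [a₁.eq_zero j hj, a₂.eq_zero j hj', mul_zero, add_zero]
  refine ⟨a • β₁ + b • β₂, a • S₁ + b • S₂,
    isAugmentedSolution_of_dual hn hw hlam (fun j => hal.isBlockSubgradient (hle j)) ?_,
    fun k => ((hcombo k).1).trans (hσ₁ k), hE⟩
  conv_lhs => rw [h₁.eq_dual hn hw hlam, h₂.eq_dual hn hw hlam]
  rw [← map_smul, ← map_smul, ← map_add]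
  congr 1
  rw [Matrix.mulVec_add, Matrix.mulVec_smul, Matrix.mulVec_smul]
  module

/-- For almost every response, the estimator is strictly complementary: a block is active when its
subgradient has `ℓ₁` norm one, and coordinates with a zero subgradient are smaller than the norm
of their block. -/
theorem ae_strict_complementarity {n p J : ℕ} (hn : 0 < n) {X : Matrix (Fin n) (Fin p) ℝ}
    {grp : Fin p → Fin J} {w : Fin J → ℝ} (hw : ∀ j, 0 < w j) {lam : ℝ} (hlam : 0 < lam)
    (huniq : ∀ᵐ y : Fin n → ℝ, ∃! bs : (Fin p → ℝ) × (Fin p → ℝ),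
      IsAugmentedSolution X grp w lam y bs.1 bs.2) :
    ∀ᵐ y : Fin n → ℝ, ∀ β S, IsAugmentedSolution X grp w lam y β S →
      ∀ j, blockL1 grp S j = 1 → 0 < blockSup grp β j := by
  -- There are finitely many patterns, and the frontier of a convex set is Lebesgue null.
  have hfr : ∀ᵐ y : Fin n → ℝ, ∀ (σ : Fin p → SignType) (E : Finset (Fin J)),
      y ∉ frontier (patternResponses X grp w lam σ E) := by
    rw [ae_all_iff]
    intro σ
    rw [ae_all_iff]
    intro E
    exact measure_eq_zero_iff_ae_notMem.1
      ((convex_patternResponses hn hw hlam σ E).addHaar_frontier volume)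
  filter_upwards [hfr, huniq] with y hy hu β S h j hj
  set E : Finset (Fin J) := Finset.univ.filter fun j => blockL1 grp S j = 1 with hE
  set σ : Fin p → SignType := fun k => SignType.sign (S k) with hσ
  have hmem : y ∈ patternResponses X grp w lam σ E :=
    ⟨β, S, h, fun _ => rfl, fun j => by simp [hE]⟩
  have hint : y ∈ interior (patternResponses X grp w lam σ E) := by
    by_contra hc
    exact hy σ E ⟨subset_closure hmem, hc⟩
  -- Unit radius on every saturated block, with the signs of `S`: adding a positive multiple
  -- preserves alignment and makes all saturated radii positive.
  set b₀ : Fin p → ℝ := fun k => if grp k ∈ E then Real.sign (S k) else 0 with hb₀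
  obtain ⟨t, ht, htpos⟩ : ∃ t : ℝ, y - t • X.mulVec b₀ ∈ patternResponses X grp w lam σ E ∧
      0 < t := by
    have hc : Filter.Tendsto (fun t : ℝ => y - t • X.mulVec b₀) (nhdsWithin 0 (Set.Ioi 0))
        (nhds y) := by
      have : ContinuousAt (fun t : ℝ => y - t • X.mulVec b₀) 0 := by fun_prop
      have h2 := this.tendsto
      simp only [zero_smul, sub_zero] at h2
      exact h2.mono_left nhdsWithin_le_nhds
    have h1 := hc.eventually (mem_interior_iff_mem_nhds.1 hint)
    exact (h1.and self_mem_nhdsWithin).exists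
  obtain ⟨β₁, S₁, h₁, hσ₁, hE₁⟩ := ht
  have a₁ := h₁.isAligned
  have hal : IsAligned grp (fun j => blockSup grp β₁ j + if j ∈ E then t else 0)
      (β₁ + t • b₀) S₁ := by
    refine ⟨fun j => add_nonneg (a₁.nonneg j) (by split_ifs <;> simp [htpos.le]), fun k => ?_,
      fun k hk => ?_, fun j hj => ?_⟩
    · refine (abs_add_le _ _).trans (add_le_add (a₁.abs_le k) ?_)
      by_cases hk : grp k ∈ E
      · have := abs_sign_le_one (S k)
        simp only [hb₀, Pi.smul_apply, smul_eq_mul, hk, if_true, abs_mul, abs_of_pos htpos]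
        nlinarith
      · simp [hb₀, hk]
    · simp only [Pi.add_apply, Pi.smul_apply, smul_eq_mul]
      rw [a₁.eq_sign k hk]
      by_cases hkE : grp k ∈ E
      · simp only [hb₀, hkE, if_true]
        rw [sign_eq_of_signType_eq (hσ₁ k : SignType.sign (S₁ k) = SignType.sign (S k))]
        ring
      · simp [hb₀, hkE]
    · have hj' := hj
      rw [Ne, hE₁] at hj'
      simp [a₁.eq_zero j hj, hj']
  -- The fit removed from the response is restored in the coefficients, so the residual, and with it
  -- the subgradient, is unchanged.
  have h₂ : IsAugmentedSolution X grp w lam y (β₁ + t • b₀) S₁ := by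
    refine isAugmentedSolution_of_dual hn hw hlam
      (fun j => hal.isBlockSubgradient (h₁.blockL1_le j)) ?_
    conv_lhs => rw [h₁.eq_dual hn hw hlam]
    congr 1
    rw [Matrix.mulVec_add, Matrix.mulVec_smul]
    module
  have heq : (β, S) = (β₁ + t • b₀, S₁) := hu.unique h h₂
  have hβ : β = β₁ + t • b₀ := congrArg Prod.fst heq
  have hjE : j ∈ E := by simp [hE, hj]
  rw [hβ, hal.blockSup_eq]
  simp only [hjE, if_true]
  have := a₁.nonneg j
  linarith

/-! ### Orthogonal complements and injectivity of the design on compatible coefficients. -/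

/-- The vectors orthogonal to a subspace of `ℝⁿ`. -/
def orthogonalSpace {n : ℕ} (L : Submodule ℝ (Fin n → ℝ)) : Submodule ℝ (Fin n → ℝ) where
  carrier := {z | ∀ c ∈ L, c ⬝ᵥ z = 0}
  add_mem' {a b} ha hb c hc := by rw [dotProduct_add, ha c hc, hb c hc, add_zero]
  zero_mem' c _ := dotProduct_zero c
  smul_mem' t a ha c hc := by rw [dotProduct_smul, ha c hc, smul_zero]

theorem mem_orthogonalSpace {n : ℕ} {L : Submodule ℝ (Fin n → ℝ)} {z : Fin n → ℝ} :
    z ∈ orthogonalSpace L ↔ ∀ c ∈ L, c ⬝ᵥ z = 0 := Iff.rfl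

/-- The type `Fin n → ℝ` carries the sup norm, so the decomposition is transported from
`EuclideanSpace`. -/
theorem exists_add_mem_orthogonalSpace {n : ℕ} (L : Submodule ℝ (Fin n → ℝ)) (v : Fin n → ℝ) :
    ∃ a ∈ L, ∃ z ∈ orthogonalSpace L, v = a + z := by
  set M : Submodule ℝ (EuclideanSpace ℝ (Fin n)) :=
    L.comap (WithLp.linearEquiv 2 ℝ (Fin n → ℝ)).toLinearMap with hM
  obtain ⟨a, ha, z, hz, h⟩ := M.exists_add_mem_mem_orthogonal (WithLp.toLp 2 v)
  refine ⟨a.ofLp, ha, z.ofLp, fun c hc => ?_, by rw [← WithLp.ofLp_add, ← h]⟩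
  have := (Submodule.mem_orthogonal M z).1 hz (WithLp.toLp 2 c) hc
  rw [EuclideanSpace.inner_eq_star_dotProduct] at this
  simpa [dotProduct_comm] using this

theorem eq_zero_of_mem_orthogonalSpace {n : ℕ} {L : Submodule ℝ (Fin n → ℝ)} {v : Fin n → ℝ}
    (h : v ∈ L) (h' : v ∈ orthogonalSpace L) : v = 0 :=
  dotProduct_self_eq_zero.1 (h' v h)

theorem orthogonalSpace_orthogonalSpace {n : ℕ} {L : Submodule ℝ (Fin n → ℝ)} {v : Fin n → ℝ}
    (h : ∀ z ∈ orthogonalSpace L, v ⬝ᵥ z = 0) : v ∈ L := by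
  obtain ⟨a, ha, z, hz, rfl⟩ := exists_add_mem_orthogonalSpace L v
  have h1 := h z hz
  rw [add_dotProduct, hz a ha, zero_add] at h1
  rw [dotProduct_self_eq_zero.1 h1, add_zero]
  exact ha

open Classical in
/-- The coefficient vectors compatible with the subgradient `s`: on the blocks where `s` has `ℓ₁`
norm one they are `ρ_j sgn(s_k)` where `s_k ≠ 0`, and free elsewhere. -/
noncomputable def expand {p J : ℕ} (grp : Fin p → Fin J) (s : Fin p → ℝ) :
    ((Fin J → ℝ) × (Fin p → ℝ)) →ₗ[ℝ] (Fin p → ℝ) where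
  toFun q := fun k => if blockL1 grp s (grp k) = 1 then
    (if s k = 0 then q.2 k else q.1 (grp k) * Real.sign (s k)) else 0
  map_add' a b := by
    ext k
    simp only [Prod.fst_add, Prod.snd_add, Pi.add_apply]
    split_ifs <;> ring
  map_smul' c a := by
    ext k
    simp only [Prod.smul_fst, Prod.smul_snd, Pi.smul_apply, smul_eq_mul, RingHom.id_apply]
    split_ifs <;> ring

open Classical in
theorem expand_apply {p J : ℕ} (grp : Fin p → Fin J) (s : Fin p → ℝ)
    (q : (Fin J → ℝ) × (Fin p → ℝ)) (k : Fin p) :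
    expand grp s q k = if blockL1 grp s (grp k) = 1 then
      (if s k = 0 then q.2 k else q.1 (grp k) * Real.sign (s k)) else 0 := by
  simp only [expand, LinearMap.coe_mk, AddHom.coe_mk]

open Classical in
-- The perturbed `s'` need only keep the signs and norms of `s` on the saturated blocks, as the
-- coefficient vector vanishes on the others.
theorem isAligned_expand {p J : ℕ} {grp : Fin p → Fin J} {s s' : Fin p → ℝ}
    (hsign : ∀ k, blockL1 grp s (grp k) = 1 → Real.sign (s' k) = Real.sign (s k))
    (hL1 : ∀ j, blockL1 grp s j = 1 → blockL1 grp s' j = 1) {q : (Fin J → ℝ) × (Fin p → ℝ)}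
    (hpos : ∀ j, 0 < q.1 j) (hlt : ∀ k, |q.2 k| < q.1 (grp k)) :
    IsAligned grp (fun j => if blockL1 grp s j = 1 then q.1 j else 0) (expand grp s q) s' := by
  refine ⟨fun j => by split_ifs <;> simp [(hpos j).le], fun k => ?_, fun k hk => ?_,
    fun j hj => ?_⟩
  · rw [expand_apply]
    split_ifs
    · exact (hlt k).le
    · rw [abs_mul, abs_of_pos (hpos _)]
      exact mul_le_of_le_one_right (hpos _).le (abs_sign_le_one _)
    · simp
  · rw [expand_apply]
    by_cases h : blockL1 grp s (grp k) = 1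
    · have h0 : s k ≠ 0 := by
        intro h0
        have := hsign k h
        rw [h0, Real.sign_zero, Real.sign_eq_zero_iff] at this
        exact hk this
      simp [h, h0, hsign k h]
    · simp [h]
  · have : ¬ blockL1 grp s j = 1 := fun h => hj (hL1 j h)
    simp [this]

/-- Turns orthogonality of `z` to fits into linear conditions on the subgradient direction `dual z`.
-/
theorem mulVec_dotProduct_eq_dual {n p J : ℕ} {X : Matrix (Fin n) (Fin p) ℝ} {grp : Fin p → Fin J}
    {w : Fin J → ℝ} (hw : ∀ j, 0 < w j) (d : Fin p → ℝ) (z : Fin n → ℝ) :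
    X.mulVec d ⬝ᵥ z = ∑ k, w (grp k) * (d k * dual X grp w z k) := by
  rw [dotProduct_comm, Matrix.dotProduct_mulVec, ← Matrix.mulVec_transpose, dotProduct]
  refine Finset.sum_congr rfl fun k _ => ?_
  have := (hw (grp k)).ne'
  rw [dual_apply]
  field_simp

theorem blockL1_eq_sum_sign {p J : ℕ} {grp : Fin p → Fin J} {s s' : Fin p → ℝ} {j : Fin J}
    (h : ∀ k, grp k = j → Real.sign (s' k) = Real.sign (s k)) :
    blockL1 grp s' j = ∑ k with grp k = j, Real.sign (s k) * s' k := by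
  refine Finset.sum_congr rfl fun k hk => ?_
  rw [← h k (by simpa using hk), sign_mul_self_eq_abs]

theorem continuous_blockL1 {p J : ℕ} (grp : Fin p → Fin J) (j : Fin J) :
    Continuous fun s => blockL1 grp s j := by
  unfold blockL1
  fun_prop

theorem eventually_sign_eq {x : ℝ} (h : x ≠ 0) :
    ∀ᶠ y in nhds x, Real.sign y = Real.sign x := by
  rcases lt_or_gt_of_ne h with h | h
  · filter_upwards [eventually_lt_nhds h] with y hy
    rw [Real.sign_of_neg h, Real.sign_of_neg hy]
  · filter_upwards [eventually_gt_nhds h] with y hy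
    rw [Real.sign_of_pos h, Real.sign_of_pos hy]

/-- Almost everywhere uniqueness makes the design injective on the coefficient vectors compatible
with any feasible subgradient. -/
theorem expand_eq_zero_of_mulVec_eq_zero {n p J : ℕ} (hn : 0 < n) {X : Matrix (Fin n) (Fin p) ℝ}
    {grp : Fin p → Fin J} {w : Fin J → ℝ} (hw : ∀ j, 0 < w j) {lam : ℝ} (hlam : 0 < lam)
    (huniq : ∀ᵐ y : Fin n → ℝ, ∃! bs : (Fin p → ℝ) × (Fin p → ℝ),
      IsAugmentedSolution X grp w lam y bs.1 bs.2)
    {s : Fin p → ℝ} (hs : s ∈ rowSpace X grp w) (hle : ∀ j, blockL1 grp s j ≤ 1)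
    (qs : (Fin J → ℝ) × (Fin p → ℝ)) (hqs : X.mulVec (expand grp s qs) = 0) :
    expand grp s qs = 0 := by
  obtain ⟨z₀, rfl⟩ := (mem_rowSpace_iff hw).1 hs
  set s := dual X grp w z₀ with hsdef
  -- `D` consists of the fits of the vectors compatible with `s`. Moving the dual vector
  -- orthogonally to `D` preserves the equality constraints on saturated blocks, so fits and dual
  -- moves together sweep out `ℝⁿ`.
  set D : Submodule ℝ (Fin n → ℝ) := LinearMap.range (X.mulVecLin ∘ₗ expand grp s) with hD
  have hn' : (0 : ℝ) < n := by exact_mod_cast hn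
  set c : ℝ := n * lam with hc
  have hc0 : c ≠ 0 := (mul_pos hn' hlam).ne'
  set f : (((Fin J → ℝ) × (Fin p → ℝ)) × orthogonalSpace D) →ₗ[ℝ] (Fin n → ℝ) :=
    (X.mulVecLin ∘ₗ expand grp s).coprod (c • (orthogonalSpace D).subtype) with hf
  have hfapply : ∀ q z, f (q, z) = X.mulVec (expand grp s q) + c • (z : Fin n → ℝ) := by
    intro q z
    simp [hf]
  have hfsurj : Function.Surjective f := by
    intro v
    obtain ⟨a, ⟨q, hq⟩, z, hz, rfl⟩ := exists_add_mem_orthogonalSpace D v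
    refine ⟨(q, ⟨c⁻¹ • z, Submodule.smul_mem _ _ hz⟩), ?_⟩
    rw [hfapply, ← hq]
    simp [smul_smul, hc0]
  have hopen : IsOpenMap f := f.isOpenMap_of_finiteDimensional hfsurj
  have hgoodq : ∀ᶠ q in nhds (((fun _ => 1), 0) : (Fin J → ℝ) × (Fin p → ℝ)),
      (∀ j, 0 < q.1 j) ∧ ∀ k, |q.2 k| < q.1 (grp k) := by
    rw [Filter.eventually_and, Filter.eventually_all, Filter.eventually_all]
    refine ⟨fun j => ?_, fun k => ?_⟩
    · refine (IsOpen.eventually_mem (isOpen_lt (by fun_prop) (by fun_prop) :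
        IsOpen {q : (Fin J → ℝ) × (Fin p → ℝ) | 0 < q.1 j}) ?_)
      exact zero_lt_one' ℝ
    · refine (IsOpen.eventually_mem (isOpen_lt (by fun_prop) (by fun_prop) :
        IsOpen {q : (Fin J → ℝ) × (Fin p → ℝ) | |q.2 k| < q.1 (grp k)}) ?_)
      change |(0 : ℝ)| < 1
      simp
  have hcont : Continuous fun z : orthogonalSpace D => dual X grp w (z₀ + z) :=
    (LinearMap.continuous_of_finiteDimensional (dual X grp w)).comp
      (continuous_const.add continuous_subtype_val)
  have htend : Filter.Tendsto (fun z : orthogonalSpace D => dual X grp w (z₀ + z)) (nhds 0)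
      (nhds s) := by
    have := hcont.tendsto 0
    simpa using this
  have hgoodz : ∀ᶠ z : orthogonalSpace D in nhds 0,
      (∀ k, s k ≠ 0 → Real.sign (dual X grp w (z₀ + (z : Fin n → ℝ)) k) = Real.sign (s k)) ∧
      ∀ j, blockL1 grp s j < 1 → blockL1 grp (dual X grp w (z₀ + (z : Fin n → ℝ))) j < 1 := by
    rw [Filter.eventually_and, Filter.eventually_all, Filter.eventually_all]
    refine ⟨fun k => ?_, fun j => ?_⟩
    · by_cases hk : s k = 0
      · simp [hk]
      · filter_upwards [(((continuous_apply k).tendsto s).comp htend).eventually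
          (eventually_sign_eq hk)] with z hz _
        exact hz
    · by_cases hj : blockL1 grp s j < 1
      · filter_upwards [(((continuous_blockL1 grp j).tendsto s).comp htend).eventually
          (eventually_lt_nhds hj)] with z hz _
        exact hz
      · simp [hj]
  have hnb := hopen.image_mem_nhds (hgoodq.prodMk_nhds hgoodz)
  set y₀ := f (((fun _ => 1), 0), 0) with hy₀
  have hnb' : (fun v => v - c • z₀) ⁻¹' (f '' {x | ((∀ j, 0 < x.1.1 j) ∧
      ∀ k, |x.1.2 k| < x.1.1 (grp k)) ∧
      (∀ k, s k ≠ 0 → Real.sign (dual X grp w (z₀ + x.2) k) = Real.sign (s k)) ∧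
      ∀ j, blockL1 grp s j < 1 → blockL1 grp (dual X grp w (z₀ + x.2)) j < 1})
        ∈ nhds (y₀ + c • z₀) := by
    have : ContinuousAt (fun v : Fin n → ℝ => v - c • z₀) (y₀ + c • z₀) := by fun_prop
    refine this.preimage_mem_nhds ?_
    simpa using hnb
  -- A set of full measure is dense, so some response in this neighbourhood has a unique augmented
  -- solution.
  obtain ⟨y, hy, hyU⟩ := (Measure.dense_of_ae huniq).inter_nhds_nonempty hnb'
  obtain ⟨⟨q, z⟩, ⟨⟨hq1, hq2⟩, hz1, hz2⟩, hfy⟩ := hyU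
  simp only at hq1 hq2 hz1 hz2 hfy
  have hy' : y = X.mulVec (expand grp s q) + c • (z₀ + z) := by
    rw [hfapply] at hfy
    rw [smul_add, add_comm (c • z₀), ← add_assoc, hfy, sub_add_cancel]
  set s' := dual X grp w (z₀ + z) with hs'
  have horth : ∀ q', ∑ k, w (grp k) * (expand grp s q' k * dual X grp w z k) = 0 := by
    intro q'
    rw [← mulVec_dotProduct_eq_dual hw]
    exact z.2 _ ⟨q', rfl⟩
  -- Orthogonality tested at a unit vector keeps this coordinate zero; tested at the sign vector of
  -- a block, below, it keeps the `ℓ₁` norm of that block.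
  have hzero : ∀ k, blockL1 grp s (grp k) = 1 → s k = 0 → s' k = 0 := by
    intro k hk hk0
    have := horth (0, Pi.single k 1)
    rw [Finset.sum_eq_single k] at this
    · rw [expand_apply, if_pos hk, if_pos hk0] at this
      simp only [Pi.single_eq_same, one_mul, mul_eq_zero, (hw _).ne', false_or] at this
      rw [hs', map_add, Pi.add_apply, this, ← hsdef, hk0, add_zero]
    · intro l _ hl
      rw [expand_apply]
      by_cases h0 : s l = 0 <;> simp [h0, hl]
    · simp
  have hsign : ∀ k, blockL1 grp s (grp k) = 1 → Real.sign (s' k) = Real.sign (s k) := by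
    intro k hk
    by_cases h0 : s k = 0
    · rw [hzero k hk h0, h0]
    · exact hz1 k h0
  have hL1 : ∀ j, blockL1 grp s j = 1 → blockL1 grp s' j = 1 := by
    intro j hj
    have e1 : blockL1 grp s' j = ∑ k with grp k = j, Real.sign (s k) * s' k :=
      blockL1_eq_sum_sign fun k hk => hsign k (hk ▸ hj)
    have e2 : blockL1 grp s j = ∑ k with grp k = j, Real.sign (s k) * s k :=
      blockL1_eq_sum_sign fun k _ => rfl
    have e3 : ∑ k with grp k = j, Real.sign (s k) * dual X grp w z k = 0 := by
      have := horth (Pi.single j 1, 0)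
      have e4 : ∑ k, w (grp k) * (expand grp s (Pi.single j 1, 0) k * dual X grp w z k)
          = w j * ∑ k with grp k = j, Real.sign (s k) * dual X grp w z k := by
        rw [Finset.mul_sum, Finset.sum_filter]
        refine Finset.sum_congr rfl fun k _ => ?_
        rw [expand_apply]
        by_cases hk : grp k = j
        · by_cases h0 : s k = 0 <;> simp [hk, hj, h0]
        · by_cases h0 : s k = 0 <;> simp [hk, h0]
      rw [e4] at this
      exact (mul_eq_zero.1 this).resolve_left (hw j).ne'
    rw [e1]
    rw [e2] at hj
    have e5 : ∀ k, Real.sign (s k) * s' k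
        = Real.sign (s k) * s k + Real.sign (s k) * dual X grp w z k := by
      intro k
      rw [hs', map_add, Pi.add_apply, mul_add]
    rw [Finset.sum_congr rfl fun k _ => e5 k, Finset.sum_add_distrib, hj, e3, add_zero]
  have hle' : ∀ j, blockL1 grp s' j ≤ 1 := by
    intro j
    rcases (hle j).lt_or_eq with h | h
    · exact (hz2 j h).le
    · exact (hL1 j h).le
  have haug : ∀ q' : (Fin J → ℝ) × (Fin p → ℝ), (∀ j, 0 < q'.1 j) →
      (∀ k, |q'.2 k| < q'.1 (grp k)) → X.mulVec (expand grp s q') = X.mulVec (expand grp s q) →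
      IsAugmentedSolution X grp w lam y (expand grp s q') s' := by
    intro q' h1 h2 h3
    refine isAugmentedSolution_of_dual hn hw hlam (fun j =>
      (isAligned_expand hsign hL1 h1 h2).isBlockSubgradient (hle' j)) ?_
    rw [h3, hy', add_sub_cancel_left, smul_smul, inv_mul_cancel₀ hc0, one_smul]
  -- The strict constraints on `q` survive a small step along `qs`, which does not change the fit.
  obtain ⟨t, ⟨ht1, ht2⟩, ht⟩ : ∃ t : ℝ, ((∀ j, 0 < (q + t • qs).1 j) ∧
      ∀ k, |(q + t • qs).2 k| < (q + t • qs).1 (grp k)) ∧ 0 < t := by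
    have h1 : ∀ᶠ t : ℝ in nhds 0, ((∀ j, 0 < (q + t • qs).1 j) ∧
        ∀ k, |(q + t • qs).2 k| < (q + t • qs).1 (grp k)) := by
      rw [Filter.eventually_and, Filter.eventually_all, Filter.eventually_all]
      refine ⟨fun j => ?_, fun k => ?_⟩
      · refine (IsOpen.eventually_mem (isOpen_lt (by fun_prop) (by fun_prop) :
          IsOpen {t : ℝ | 0 < (q + t • qs).1 j}) ?_)
        change 0 < (q + (0 : ℝ) • qs).1 j
        simpa using hq1 j
      · refine (IsOpen.eventually_mem (isOpen_lt (by fun_prop) (by fun_prop) :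
          IsOpen {t : ℝ | |(q + t • qs).2 k| < (q + t • qs).1 (grp k)}) ?_)
        change |(q + (0 : ℝ) • qs).2 k| < (q + (0 : ℝ) • qs).1 (grp k)
        simpa using hq2 k
    exact ((h1.filter_mono nhdsWithin_le_nhds).and
      (self_mem_nhdsWithin (s := Set.Ioi (0 : ℝ)))).exists
  have g1 := haug q hq1 hq2 rfl
  have g2 := haug (q + t • qs) ht1 ht2 (by
    rw [map_add, map_smul, Matrix.mulVec_add, Matrix.mulVec_smul, hqs, smul_zero, add_zero])
  have heq := congrArg Prod.fst (hy.unique (y₁ := (_, _)) (y₂ := (_, _)) g1 g2)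
  simp only [map_add, map_smul] at heq
  have h0 : t • expand grp s qs = 0 := by
    have := heq.symm
    rwa [add_eq_left] at this
  exact (smul_eq_zero.1 h0).resolve_left ht.ne'

/-! ### Full rank of the design and the pseudo-inverse. -/

/-- As `n ≤ p`, some `n` columns of `X` span `ℝⁿ`, and only zero is orthogonal to a spanning set. -/
theorem transpose_mulVec_injective {n p : ℕ} (hnp : n ≤ p) {X : Matrix (Fin n) (Fin p) ℝ}
    (hX : ColumnsIndependent X) : Function.Injective X.transpose.mulVec := by
  obtain ⟨t, -, ht⟩ := Finset.exists_subset_card_eq (s := (Finset.univ : Finset (Fin p))) (n := n)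
    (by simpa using hnp)
  have hli := hX t (by rw [ht, min_eq_left hnp])
  have hspan := hli.span_eq_top_of_card_eq_finrank' (by simp [ht])
  have hz : ∀ z, X.transpose.mulVec z = 0 → z = 0 := by
    intro z hz
    have hle : (⊤ : Submodule ℝ (Fin n → ℝ)) ≤ orthogonalSpace (Submodule.span ℝ {z}) := by
      rw [← hspan, Submodule.span_le]
      rintro _ ⟨k, rfl⟩ c hc
      obtain ⟨a, rfl⟩ := Submodule.mem_span_singleton.1 hc
      have hk : (fun i => X i k) ⬝ᵥ z = 0 := congrFun hz k
      rw [smul_dotProduct, dotProduct_comm, hk, smul_zero]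
    exact eq_zero_of_mem_orthogonalSpace (Submodule.mem_span_singleton_self z)
      (hle Submodule.mem_top)
  intro a b hab
  refine sub_eq_zero.1 (hz _ ?_)
  rw [Matrix.mulVec_sub, sub_eq_zero]
  exact hab

theorem pinv_mul_self {m n : ℕ} {M : Matrix (Fin m) (Fin n) ℝ}
    (h : Function.Injective M.mulVec) : pinv M * M = 1 := by
  have hu : IsUnit (M.transpose * M) := by
    rw [← Matrix.mulVec_injective_iff_isUnit]
    intro a b hab
    have h0 : (M.transpose * M).mulVec (a - b) = 0 := by
      rw [Matrix.mulVec_sub, sub_eq_zero]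
      exact hab
    have h1 : M.mulVec (a - b) ⬝ᵥ M.mulVec (a - b) = 0 := by
      rw [Matrix.dotProduct_mulVec, ← Matrix.mulVec_transpose, Matrix.mulVec_mulVec, h0,
        zero_dotProduct]
    have h2 : M.mulVec (a - b) = M.mulVec 0 := by
      rw [dotProduct_self_eq_zero.1 h1, Matrix.mulVec_zero]
    exact sub_eq_zero.1 (h h2)
  rw [pinv, Matrix.mul_assoc, Matrix.nonsing_inv_mul _ ((Matrix.isUnit_iff_isUnit_det _).1 hu)]

/-! ### Coefficient vectors of a piece and representation of the estimator. -/

theorem mem_coSupport {p J : ℕ} {grp : Fin p → Fin J} {A : Finset (Fin J)} {K : Finset (Fin p)}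
    {k : Fin p} : k ∈ coSupport grp A K ↔ grp k ∈ A ∧ k ∉ K := by
  simp [coSupport]

theorem mem_freeIndices {p J : ℕ} {grp : Fin p → Fin J} {A : Finset (Fin J)} {K : Finset (Fin p)}
    {k : Fin p} : k ∈ freeIndices grp A K ↔ k ∉ coSupport grp A K := by
  simp [freeIndices]

theorem blockL1_eq_sum_support {p J : ℕ} {grp : Fin p → Fin J} {A : Finset (Fin J)}
    {K : Finset (Fin p)} {s : Fin p → ℝ} (hs : ∀ k ∈ coSupport grp A K, s k = 0) {j : Fin J}
    (hj : j ∈ A) : blockL1 grp s j = ∑ k ∈ K with grp k = j, |s k| := by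
  symm
  refine Finset.sum_subset (Finset.filter_subset_filter _ (Finset.subset_univ K))
    fun k hk hk' => ?_
  have hkj : grp k = j := by simpa using hk
  rw [hs k (mem_coSupport.2 ⟨hkj ▸ hj, fun h => hk' (Finset.mem_filter.2 ⟨h, hkj⟩)⟩), abs_zero]

theorem blockL1_eq_one_of_mem {n p J : ℕ} {X : Matrix (Fin n) (Fin p) ℝ} {grp : Fin p → Fin J}
    {w : Fin J → ℝ} {A : Finset (Fin J)} {K : Finset (Fin p)} {s : Fin p → ℝ}
    (hs : s ∈ subgradientSpace X grp w A K) {j : Fin J} (hj : j ∈ A) : blockL1 grp s j = 1 := by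
  rw [blockL1_eq_sum_support hs.2.2.1 hj, hs.2.1 j hj]

theorem blockL1_le_one_of_mem {n p J : ℕ} {X : Matrix (Fin n) (Fin p) ℝ} {grp : Fin p → Fin J}
    {w : Fin J → ℝ} {A : Finset (Fin J)} {K : Finset (Fin p)} {s : Fin p → ℝ}
    (hs : s ∈ subgradientSpace X grp w A K) (j : Fin J) : blockL1 grp s j ≤ 1 := by
  by_cases hj : j ∈ A
  · exact (blockL1_eq_one_of_mem hs hj).le
  · exact hs.2.2.2 j hj

/-- The coefficient vector as a linear function of `(r_A, b_{Kᶜ})`. -/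
noncomputable def coefficientMap {p J : ℕ} (grp : Fin p → Fin J) (A : Finset (Fin J))
    (K : Finset (Fin p)) (s : Fin p → ℝ) :
    ((A → ℝ) × (coSupport grp A K → ℝ)) →ₗ[ℝ] (Fin p → ℝ) where
  toFun q := coefficient grp A K q s
  map_add' a b := by
    ext k
    simp only [coefficient, Prod.fst_add, Prod.snd_add, Pi.add_apply]
    split_ifs <;> ring
  map_smul' c a := by
    ext k
    simp only [coefficient, Prod.smul_fst, Prod.smul_snd, Pi.smul_apply, smul_eq_mul,
      RingHom.id_apply]
    split_ifs <;> ring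

open Classical in
-- Every block of `A` is saturated on `ℳ_{A,K}`, so the coefficient vectors of the piece are among
-- those on which the design is known to be injective.
theorem coefficient_eq_expand {n p J : ℕ} {X : Matrix (Fin n) (Fin p) ℝ} {grp : Fin p → Fin J}
    {w : Fin J → ℝ} {A : Finset (Fin J)} {K : Finset (Fin p)} {s : Fin p → ℝ}
    (hs : s ∈ subgradientSpace X grp w A K) (q : (A → ℝ) × (coSupport grp A K → ℝ)) :
    coefficient grp A K q s = expand grp s (fun j => if hj : j ∈ A then q.1 ⟨j, hj⟩ else 0,
      fun k => if hk : k ∈ coSupport grp A K then q.2 ⟨k, hk⟩ else 0) := by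
  ext k
  rw [expand_apply, coefficient]
  by_cases hk : k ∈ coSupport grp A K
  · have hkA := (mem_coSupport.1 hk).1
    simp [hk, blockL1_eq_one_of_mem hs hkA, hs.2.2.1 k hk]
  · by_cases hkA : grp k ∈ A
    · by_cases h0 : s k = 0
      · simp [hk, hkA, h0]
      · simp [hk, hkA, h0, blockL1_eq_one_of_mem hs hkA]
    · simp [hk, hkA]

/-- Each block of `A` has a coordinate with `s k ≠ 0`, necessarily outside `Kᶜ`, which reveals its
radius; the parameters are thus determined by the fit. -/
theorem eq_zero_of_mulVec_coefficient {n p J : ℕ} (hn : 0 < n) {X : Matrix (Fin n) (Fin p) ℝ}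
    {grp : Fin p → Fin J} {w : Fin J → ℝ} (hw : ∀ j, 0 < w j) {lam : ℝ} (hlam : 0 < lam)
    (huniq : ∀ᵐ y : Fin n → ℝ, ∃! bs : (Fin p → ℝ) × (Fin p → ℝ),
      IsAugmentedSolution X grp w lam y bs.1 bs.2)
    {A : Finset (Fin J)} {K : Finset (Fin p)} {s : Fin p → ℝ}
    (hs : s ∈ subgradientSpace X grp w A K) {q : (A → ℝ) × (coSupport grp A K → ℝ)}
    (hq : X.mulVec (coefficient grp A K q s) = 0) : q = 0 := by
  have h0 : coefficient grp A K q s = 0 := by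
    rw [coefficient_eq_expand hs] at hq ⊢
    exact expand_eq_zero_of_mulVec_eq_zero hn hw hlam huniq hs.1 (blockL1_le_one_of_mem hs) _ hq
  refine Prod.ext (funext fun j => ?_) (funext fun k => ?_)
  · obtain ⟨k, hk, hk0⟩ := exists_ne_zero_of_blockL1 (blockL1_eq_one_of_mem hs j.2)
    have h1 := congrFun h0 k
    have h2 : k ∉ coSupport grp A K := fun h => hk0 (hs.2.2.1 k h)
    have h3 : grp k ∈ A := hk ▸ j.2
    simp only [coefficient, h2, h3, dif_neg, not_false_eq_true, dif_pos, Pi.zero_apply,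
      mul_eq_zero, Real.sign_eq_zero_iff, hk0, or_false] at h1
    have h4 : j = ⟨grp k, h3⟩ := Subtype.ext hk.symm
    rw [h4, h1]
    rfl
  · have h1 := congrFun h0 k
    simpa [coefficient, k.2] using h1

theorem IsAugmentedSolution.mem_rowSpace {n p J : ℕ} (hn : 0 < n) {X : Matrix (Fin n) (Fin p) ℝ}
    {grp : Fin p → Fin J} {w : Fin J → ℝ} (hw : ∀ j, 0 < w j) {lam : ℝ} (hlam : 0 < lam)
    {y : Fin n → ℝ} {β S : Fin p → ℝ} (h : IsAugmentedSolution X grp w lam y β S) :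
    S ∈ rowSpace X grp w :=
  (mem_rowSpace_iff hw).2 ⟨_, (h.eq_dual hn hw hlam).symm⟩

theorem mem_activeSupport {p J : ℕ} {grp : Fin p → Fin J} {β S : Fin p → ℝ} {k : Fin p} :
    k ∈ activeSupport grp β S ↔ grp k ∈ activeBlocks grp β ∧ S k ≠ 0 := by
  simp [activeSupport]

/-- A strictly complementary augmented solution is represented by an interior point of the piece
it belongs to. -/
theorem IsAugmentedSolution.representation {n p J : ℕ} (hn : 0 < n)
    {X : Matrix (Fin n) (Fin p) ℝ}
    {grp : Fin p → Fin J} {w : Fin J → ℝ} (hw : ∀ j, 0 < w j) {lam : ℝ} (hlam : 0 < lam)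
    (huniq : ∀ᵐ y : Fin n → ℝ, ∃! bs : (Fin p → ℝ) × (Fin p → ℝ),
      IsAugmentedSolution X grp w lam y bs.1 bs.2)
    {y : Fin n → ℝ} {β S : Fin p → ℝ} (h : IsAugmentedSolution X grp w lam y β S)
    (hstrict : ∀ j, blockL1 grp S j = 1 → 0 < blockSup grp β j)
    {A : Finset (Fin J)} {K : Finset (Fin p)} (hA : activeBlocks grp β = A)
    (hK : activeSupport grp β S = K) :
    Admissible n grp A K ∧ (coordinates grp A K β, S) ∈ piece X grp w A K ∧
      S ∈ subgradientInterior X grp w A K ∧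
      β = coefficient grp A K (coordinates grp A K β) S := by
  have al := h.isAligned
  have hAmem : ∀ j, j ∈ A ↔ blockSup grp β j ≠ 0 := fun j => by rw [← hA, mem_activeBlocks_iff]
  have hKmem : ∀ k, k ∈ K ↔ grp k ∈ A ∧ S k ≠ 0 := fun k => by
    rw [← hK, mem_activeSupport, hA]
  have hL1 : ∀ j ∈ A, blockL1 grp S j = 1 := fun j hj => by
    by_contra hc
    exact (hAmem j).1 hj (al.eq_zero j hc)
  have hco : ∀ k ∈ coSupport grp A K, S k = 0 := fun k hk => by
    obtain ⟨h1, h2⟩ := mem_coSupport.1 hk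
    by_contra hc
    exact h2 ((hKmem k).2 ⟨h1, hc⟩)
  have hS : S ∈ subgradientSpace X grp w A K :=
    ⟨h.mem_rowSpace hn hw hlam, fun j hj => by rw [← blockL1_eq_sum_support hco hj, hL1 j hj],
      hco, fun j _ => h.blockL1_le j⟩
  -- The `|A| + |Kᶜ|` parameters embed linearly into `ℝⁿ`.
  have hcard : A.card + (coSupport grp A K).card ≤ n := by
    have hinj : Function.Injective (X.mulVecLin ∘ₗ coefficientMap grp A K S) := by
      rw [← LinearMap.ker_eq_bot, LinearMap.ker_eq_bot']
      exact fun q hq => eq_zero_of_mulVec_coefficient hn hw hlam huniq hS hq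
    have := LinearMap.finrank_le_finrank_of_injective hinj
    simpa using this
  refine ⟨⟨by omega, fun k hk => ((hKmem k).1 hk).1, fun j hj => ?_, by omega⟩,
    ⟨fun j => ⟨?_, ?_⟩, hS⟩, ⟨hS, fun k hk => ((hKmem k).1 hk).2, fun j hj => ?_⟩, ?_⟩
  · obtain ⟨k, hk, hk0⟩ := exists_ne_zero_of_blockL1 (hL1 j hj)
    exact ⟨k, (hKmem k).2 ⟨hk ▸ hj, hk0⟩, hk⟩
  · exact lt_of_le_of_ne (blockSup_nonneg _ _ _) ((hAmem j).1 j.2).symm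
  · exact (pi_norm_le_iff_of_nonneg (blockSup_nonneg _ _ _)).2 fun k =>
      abs_le_blockSup_of_eq grp β k.2
  -- Strict complementarity rules out saturated inactive blocks.
  · refine lt_of_le_of_ne (h.blockL1_le j) fun hc => hj ((hAmem j).2 (hstrict j hc).ne')
  · ext k
    rw [coefficient]
    split_ifs with h1 h2
    · rfl
    · have : k ∈ K := by
        by_contra hc
        exact h1 (mem_coSupport.2 ⟨h2, hc⟩)
      exact al.eq_sign k ((hKmem k).1 this).2
    · rw [hAmem, not_not, blockSup_eq_zero_iff] at h2
      exact h2 k rfl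

/-! ### Differentials, free coordinates and local parameterization. -/

theorem coefficient_eq_sum {p J : ℕ} {grp : Fin p → Fin J} {A : Finset (Fin J)}
    {K : Finset (Fin p)} (s : Fin p → ℝ)
    (q : (A → ℝ) × (coSupport grp A K → ℝ)) (k : Fin p) :
    coefficient grp A K q s k
      = ∑ j : A, (if k ∈ K ∧ grp k = j then q.1 j * Real.sign (s k) else 0)
        + ∑ l : coSupport grp A K, (if k = l then q.2 l else 0) := by
  rw [coefficient]
  split_ifs with h1 h2
  · have hk : k ∉ K := (mem_coSupport.1 h1).2
    rw [Finset.sum_eq_single (⟨k, h1⟩ : coSupport grp A K)]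
    · simp [hk]
    · intro l _ hl
      exact if_neg fun h => hl (Subtype.ext h.symm)
    · simp
  · have hk : k ∈ K := by
      by_contra hc
      exact h1 (mem_coSupport.2 ⟨h2, hc⟩)
    rw [Finset.sum_eq_single (⟨grp k, h2⟩ : A)]
    · rw [Finset.sum_eq_zero]
      · simp [hk]
      · intro l _
        exact if_neg fun h : k = l => h1 (h ▸ l.2)
    · intro l _ hl
      exact if_neg fun h => hl (Subtype.ext h.2.symm)
    · simp
  · rw [Finset.sum_eq_zero, Finset.sum_eq_zero, add_zero]
    · intro l _
      exact if_neg fun h : k = l => h1 (h ▸ l.2)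
    · intro l _
      exact if_neg fun h : k ∈ K ∧ grp k = l => h2 (h.2 ▸ l.2)

/-- The right side combines the constraints defining the differentials at `s`, with one multiplier
for each. -/
theorem sum_coefficient_mul {p J : ℕ} {grp : Fin p → Fin J} {A : Finset (Fin J)}
    {K : Finset (Fin p)} (w : Fin J → ℝ) (s v : Fin p → ℝ)
    (q : (A → ℝ) × (coSupport grp A K → ℝ)) :
    ∑ k, w (grp k) * (coefficient grp A K q s k * v k)
      = ∑ j : A, w j * q.1 j * (∑ k ∈ K with grp k = j, Real.sign (s k) * v k)
        + ∑ l : coSupport grp A K, w (grp l) * q.2 l * v l := by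
  have h1 : ∀ k, w (grp k) * (coefficient grp A K q s k * v k)
      = ∑ j : A, (if k ∈ K ∧ grp k = j then w j * q.1 j * (Real.sign (s k) * v k) else 0)
        + ∑ l : coSupport grp A K, (if k = l then w (grp l) * q.2 l * v l else 0) := by
    intro k
    rw [coefficient_eq_sum, add_mul, mul_add, Finset.sum_mul, Finset.sum_mul, Finset.mul_sum,
      Finset.mul_sum]
    congr 1
    · refine Finset.sum_congr rfl fun j _ => ?_
      split_ifs with h
      · rw [h.2]; ring
      · ring
    · refine Finset.sum_congr rfl fun l _ => ?_
      split_ifs with h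
      · rw [h]; ring
      · ring
  rw [Finset.sum_congr rfl fun k _ => h1 k, Finset.sum_add_distrib, Finset.sum_comm]
  congr 1
  · refine Finset.sum_congr rfl fun j _ => ?_
    rw [Finset.mul_sum, ← Finset.sum_filter]
    refine Finset.sum_congr ?_ fun _ _ => rfl
    ext k
    simp
  · rw [Finset.sum_comm]
    refine Finset.sum_congr rfl fun l _ => ?_
    simp

/-- The directions orthogonal to the fitted values of the coefficient vectors at `s`. -/
noncomputable def normalSpace {n p J : ℕ} (X : Matrix (Fin n) (Fin p) ℝ) (grp : Fin p → Fin J)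
    (A : Finset (Fin J)) (K : Finset (Fin p)) (s : Fin p → ℝ) : Submodule ℝ (Fin n → ℝ) :=
  orthogonalSpace (LinearMap.range (X.mulVecLin ∘ₗ coefficientMap grp A K s))

/-- The weights are positive and `(r_A, b_{Kᶜ})` ranges over the whole linear space, so the
multipliers are arbitrary: `z` is orthogonal to all fits exactly when `dual z` satisfies each
constraint. -/
theorem mem_tangentSpace_iff {n p J : ℕ} {X : Matrix (Fin n) (Fin p) ℝ} {grp : Fin p → Fin J}
    {w : Fin J → ℝ} (hw : ∀ j, 0 < w j) {A : Finset (Fin J)} {K : Finset (Fin p)}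
    {s v : Fin p → ℝ} :
    v ∈ tangentSpace X grp w A K s ↔ v ∈ (normalSpace X grp A K s).map (dual X grp w) := by
  have horth : ∀ z, z ∈ normalSpace X grp A K s ↔ ∀ q : (A → ℝ) × (coSupport grp A K → ℝ),
      ∑ j : A, w j * q.1 j * (∑ k ∈ K with grp k = j, Real.sign (s k) * dual X grp w z k)
        + ∑ l : coSupport grp A K, w (grp l) * q.2 l * dual X grp w z l = 0 := by
    intro z
    rw [normalSpace, mem_orthogonalSpace]
    constructor
    · intro h q
      rw [← sum_coefficient_mul w s (dual X grp w z) q, ← mulVec_dotProduct_eq_dual hw]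
      exact h _ ⟨q, rfl⟩
    · rintro h _ ⟨q, rfl⟩
      have := h q
      rw [← sum_coefficient_mul w s (dual X grp w z) q, ← mulVec_dotProduct_eq_dual hw] at this
      exact this
  rw [Submodule.mem_map]
  constructor
  · rintro ⟨h1, h2, h3⟩
    obtain ⟨z, rfl⟩ := (mem_rowSpace_iff hw).1 h1
    refine ⟨z, (horth z).2 fun q => ?_, rfl⟩
    rw [Finset.sum_eq_zero, Finset.sum_eq_zero, add_zero]
    · intro l _
      rw [h2 l l.2, mul_zero]
    · intro j _
      rw [h3 j j.2, mul_zero]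
  · rintro ⟨z, hz, rfl⟩
    rw [horth] at hz
    refine ⟨(mem_rowSpace_iff hw).2 ⟨z, rfl⟩, fun k hk => ?_, fun j hj => ?_⟩
    · have := hz (0, Pi.single ⟨k, hk⟩ 1)
      simp only [Pi.zero_apply, mul_zero, zero_mul, Finset.sum_const_zero, zero_add] at this
      rw [Finset.sum_eq_single (⟨k, hk⟩ : coSupport grp A K)] at this
      · simpa [(hw _).ne'] using this
      · intro l _ hl
        simp [hl]
      · simp
    · have := hz (Pi.single ⟨j, hj⟩ 1, 0)
      simp only [Pi.zero_apply, mul_zero, zero_mul, Finset.sum_const_zero, add_zero] at this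
      rw [Finset.sum_eq_single (⟨j, hj⟩ : A)] at this
      · simpa [(hw _).ne'] using this
      · intro l _ hl
        simp [hl]
      · simp

/-- Dimension count in `ℝⁿ`, the direct sum of the fits and the normal space; injectivity gives the
fits dimension `|A| + |Kᶜ|`. -/
theorem finrank_normalSpace {n p J : ℕ} (hn : 0 < n) {X : Matrix (Fin n) (Fin p) ℝ}
    {grp : Fin p → Fin J} {w : Fin J → ℝ} (hw : ∀ j, 0 < w j) {lam : ℝ} (hlam : 0 < lam)
    (huniq : ∀ᵐ y : Fin n → ℝ, ∃! bs : (Fin p → ℝ) × (Fin p → ℝ),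
      IsAugmentedSolution X grp w lam y bs.1 bs.2)
    {A : Finset (Fin J)} {K : Finset (Fin p)} {s : Fin p → ℝ}
    (hs : s ∈ subgradientSpace X grp w A K) :
    A.card + (coSupport grp A K).card + Module.finrank ℝ (normalSpace X grp A K s) = n := by
  set g := X.mulVecLin ∘ₗ coefficientMap grp A K s with hg
  have hbij : Function.Bijective (g.coprod (normalSpace X grp A K s).subtype) := by
    constructor
    · rw [← LinearMap.ker_eq_bot, LinearMap.ker_eq_bot']
      rintro ⟨q, z⟩ h
      simp only [LinearMap.coprod_apply, Submodule.subtype_apply] at h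
      have hgz : g q = -(z : Fin n → ℝ) := eq_neg_of_add_eq_zero_left h
      have h0 : g q = 0 := eq_zero_of_mem_orthogonalSpace (L := LinearMap.range g) ⟨q, rfl⟩
        (by rw [hgz]; exact neg_mem z.2)
      have hq : q = 0 := eq_zero_of_mulVec_coefficient hn hw hlam huniq hs h0
      rw [h0] at hgz
      exact Prod.ext hq (Subtype.ext (neg_eq_zero.1 hgz.symm))
    · intro v
      obtain ⟨a, ⟨q, hq⟩, z, hz, rfl⟩ := exists_add_mem_orthogonalSpace (LinearMap.range g) v
      exact ⟨(q, ⟨z, hz⟩), by simp [hq]⟩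
  have := (LinearEquiv.ofBijective _ hbij).finrank_eq
  simpa using this

theorem dual_injective {n p J : ℕ} (hnp : n ≤ p) {X : Matrix (Fin n) (Fin p) ℝ}
    (hX : ColumnsIndependent X) (grp : Fin p → Fin J) {w : Fin J → ℝ} (hw : ∀ j, 0 < w j) :
    Function.Injective (dual X grp w) := by
  intro a b hab
  refine transpose_mulVec_injective hnp hX ?_
  rw [← weight_mulVec_dual X grp hw, ← weight_mulVec_dual X grp hw, hab]

/-- Some coordinates restrict to linear coordinates of a given subspace. -/
theorem exists_coordinates {p : ℕ} (V : Submodule ℝ (Fin p → ℝ)) :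
    ∃ F : Finset (Fin p), F.card = Module.finrank ℝ V ∧
      ∃ e : V ≃ₗ[ℝ] (F → ℝ), ∀ x k, e x k = (x : Fin p → ℝ) k := by
  classical
  set v : Fin p → Module.Dual ℝ V := fun k => LinearMap.proj k ∘ₗ V.subtype with hv
  -- The restricted coordinate functionals span the dual of `V`, so a basis of the dual can be
  -- chosen among them.
  have hspan : Submodule.span ℝ (Set.range v) = ⊤ := by
    rw [eq_top_iff]
    rintro f -
    obtain ⟨g, hg⟩ := f.exists_extend
    have : f = ∑ k, g (Pi.single k 1) • v k := by
      ext x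
      rw [← hg]
      simp only [LinearMap.comp_apply, Submodule.subtype_apply, LinearMap.coe_sum,
        Finset.sum_apply, LinearMap.smul_apply, hv, LinearMap.proj_apply, smul_eq_mul]
      conv_lhs => rw [LinearMap.pi_apply_eq_sum_univ g]
      refine Finset.sum_congr rfl fun k _ => ?_
      rw [smul_eq_mul, mul_comm]
      congr 2
      ext l
      simp [Pi.single_apply, eq_comm]
    rw [this]
    exact Submodule.sum_mem _ fun k _ => Submodule.smul_mem _ _ (Submodule.subset_span ⟨k, rfl⟩)
  obtain ⟨κ, a, ha, hsp, hli⟩ := exists_linearIndependent' ℝ v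
  have : Fintype κ := Fintype.ofInjective a ha
  have hcard : Fintype.card κ = Module.finrank ℝ V := by
    rw [← Subspace.dual_finrank_eq, ← finrank_span_eq_card hli, hsp, hspan, finrank_top]
  set F : Finset (Fin p) := Finset.univ.image a with hF
  have hFcard : F.card = Module.finrank ℝ V := by
    rw [hF, Finset.card_image_of_injective _ ha, Finset.card_univ, hcard]
  set res : V →ₗ[ℝ] (F → ℝ) := LinearMap.pi fun k => v k with hres
  have hinj : Function.Injective res := by
    rw [← LinearMap.ker_eq_bot, LinearMap.ker_eq_bot']
    intro x hx
    have hle : (⊤ : Submodule ℝ (Module.Dual ℝ V)) ≤ LinearMap.ker (Module.Dual.eval ℝ V x) := by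
      rw [← hspan, ← hsp, Submodule.span_le]
      rintro _ ⟨i, rfl⟩
      exact congrFun hx ⟨a i, by simp [hF]⟩
    ext k
    exact hle (Submodule.mem_top (x := v k))
  refine ⟨F, hFcard, LinearEquiv.ofInjectiveOfFinrankEq res hinj (by simp [hFcard]), ?_⟩
  intro x k
  rfl

theorem isTangentMatrix_toMatrix {n p J : ℕ} {X : Matrix (Fin n) (Fin p) ℝ} {grp : Fin p → Fin J}
    {w : Fin J → ℝ} {A : Finset (Fin J)} {K : Finset (Fin p)}
    {s : Fin p → ℝ} {V : Submodule ℝ (Fin p → ℝ)}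
    (hV : ∀ v, v ∈ tangentSpace X grp w A K s ↔ v ∈ V) {F : Finset (Fin p)}
    (e : V ≃ₗ[ℝ] (F → ℝ)) (he : ∀ x k, e x k = (x : Fin p → ℝ) k) :
    IsTangentMatrix X grp w A K s F (LinearMap.toMatrix'
      ((LinearMap.funLeft ℝ ℝ (fun k : freeIndices grp A K => (k : Fin p))) ∘ₗ V.subtype ∘ₗ
        e.symm.toLinearMap)) := by
  refine ⟨fun v hv => ?_, fun t => ⟨e.symm t, (hV _).2 (e.symm t).2, ?_⟩⟩
  · rw [LinearMap.toMatrix'_mulVec]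
    have h : (fun k : F => v k) = e ⟨v, (hV v).1 hv⟩ := by
      ext k
      rw [he]
    rw [h]
    simp only [LinearMap.comp_apply, LinearEquiv.coe_coe, LinearEquiv.symm_apply_apply,
      Submodule.subtype_apply]
    rfl
  · ext k
    rw [← he, LinearEquiv.apply_symm_apply]

theorem sum_abs_eq_sum_sign {p : ℕ} {T : Finset (Fin p)} {s x : Fin p → ℝ}
    (h : ∀ k ∈ T, Real.sign (x k) = Real.sign (s k)) :
    ∑ k ∈ T, |x k| = ∑ k ∈ T, Real.sign (s k) * x k :=
  Finset.sum_congr rfl fun k hk => by rw [← h k hk, sign_mul_self_eq_abs]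

/-- With the signs on `K` fixed, the `ℓ₁` equalities become affine, and differences of points solve
the homogeneous equations. -/
theorem sub_mem_tangentSpace {n p J : ℕ} {X : Matrix (Fin n) (Fin p) ℝ} {grp : Fin p → Fin J}
    {w : Fin J → ℝ} {A : Finset (Fin J)} {K : Finset (Fin p)} {s x : Fin p → ℝ}
    (hs : s ∈ subgradientSpace X grp w A K) (hx : x ∈ subgradientSpace X grp w A K)
    (hsign : ∀ k ∈ K, Real.sign (x k) = Real.sign (s k)) :
    x - s ∈ tangentSpace X grp w A K s := by
  refine ⟨sub_mem hx.1 hs.1, fun k hk => ?_, fun j hj => ?_⟩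
  · rw [Pi.sub_apply, hx.2.2.1 k hk, hs.2.2.1 k hk, sub_zero]
  · have h1 := hx.2.1 j hj
    have h2 := hs.2.1 j hj
    rw [sum_abs_eq_sum_sign (s := s) fun k hk => hsign k (Finset.mem_filter.1 hk).1] at h1
    rw [sum_abs_eq_sum_sign (s := s) fun k _ => rfl] at h2
    simp only [Pi.sub_apply, mul_sub, Finset.sum_sub_distrib]
    rw [h1, h2, sub_self]

theorem mem_subgradientSpace_of_sub {n p J : ℕ} {X : Matrix (Fin n) (Fin p) ℝ}
    {grp : Fin p → Fin J} {w : Fin J → ℝ} {A : Finset (Fin J)} {K : Finset (Fin p)}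
    {s x : Fin p → ℝ} (hs : s ∈ subgradientSpace X grp w A K)
    (hx : x - s ∈ tangentSpace X grp w A K s)
    (hsign : ∀ k ∈ K, Real.sign (x k) = Real.sign (s k)) (hle : ∀ j ∉ A, blockL1 grp x j ≤ 1) :
    x ∈ subgradientSpace X grp w A K := by
  refine ⟨by simpa using add_mem hx.1 hs.1, fun j hj => ?_, fun k hk => ?_, hle⟩
  · have h1 := hx.2.2 j hj
    have h2 := hs.2.1 j hj
    rw [sum_abs_eq_sum_sign (s := s) fun k hk => hsign k (Finset.mem_filter.1 hk).1]
    rw [sum_abs_eq_sum_sign (s := s) fun k _ => rfl] at h2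
    simp only [Pi.sub_apply, mul_sub, Finset.sum_sub_distrib] at h1
    linarith
  · have h1 := hx.2.1 k hk
    rw [Pi.sub_apply, hs.2.2.1 k hk, sub_zero] at h1
    exact h1

/-- Where the signs on `K` and the strict inequalities persist, `ℳ_{A,K}` agrees with the affine
space through `s` directed by the differentials, and `F` gives coordinates on that space. -/
theorem exists_local_parameterization {n p J : ℕ} (hn : 0 < n) (hnp : n ≤ p)
    {X : Matrix (Fin n) (Fin p) ℝ} (hX : ColumnsIndependent X)
    {grp : Fin p → Fin J} {w : Fin J → ℝ} (hw : ∀ j, 0 < w j) {lam : ℝ} (hlam : 0 < lam)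
    (huniq : ∀ᵐ y : Fin n → ℝ, ∃! bs : (Fin p → ℝ) × (Fin p → ℝ),
      IsAugmentedSolution X grp w lam y bs.1 bs.2)
    {A : Finset (Fin J)} {K : Finset (Fin p)} {s : Fin p → ℝ}
    (hs : s ∈ subgradientInterior X grp w A K) :
    ∃ (F : Finset (Fin p)) (T : Matrix (freeIndices grp A K) F ℝ),
      F.card = n - A.card - (coSupport grp A K).card ∧
      IsTangentMatrix X grp w A K s F T ∧
      ∃ (U : Set (Fin p → ℝ)) (Δ : Set (F → ℝ)), IsOpen U ∧ s ∈ U ∧ IsOpen Δ ∧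
        Set.BijOn (fun (x : Fin p → ℝ) (k : F) => x k) (subgradientSpace X grp w A K ∩ U) Δ ∧
        ∀ x ∈ subgradientSpace X grp w A K ∩ U,
          (fun k : freeIndices grp A K => x k - s k) = T.mulVec (fun k : F => x k - s k) := by
  obtain ⟨hsM, hs0, hs1⟩ := hs
  set V := (normalSpace X grp A K s).map (dual X grp w) with hVdef
  have hV : ∀ v, v ∈ tangentSpace X grp w A K s ↔ v ∈ V := fun v => mem_tangentSpace_iff hw
  obtain ⟨F, hF, e, he⟩ := exists_coordinates V
  have hVrank : Module.finrank ℝ V = Module.finrank ℝ (normalSpace X grp A K s) :=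
    (Submodule.equivMapOfInjective _ (dual_injective hnp hX grp hw) _).finrank_eq.symm
  have hrank := finrank_normalSpace hn hw hlam huniq hsM
  have hT := isTangentMatrix_toMatrix hV e he
  set U : Set (Fin p → ℝ) := {x | (∀ k ∈ K, 0 < s k * x k) ∧ ∀ j ∉ A, blockL1 grp x j < 1} with hU
  have hUopen : IsOpen U := by
    have : U = (⋂ k ∈ K, {x | 0 < s k * x k}) ∩ ⋂ j ∈ Aᶜ, {x | blockL1 grp x j < 1} := by
      ext x
      simp [hU]
    rw [this]
    exact (isOpen_biInter_finset fun k _ => isOpen_lt continuous_const (by fun_prop)).inter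
      (isOpen_biInter_finset fun j _ => isOpen_lt (continuous_blockL1 grp j) continuous_const)
  have hsign : ∀ x ∈ U, ∀ k ∈ K, Real.sign (x k) = Real.sign (s k) := by
    intro x hx k hk
    have := hx.1 k hk
    rcases lt_or_gt_of_ne (hs0 k hk) with h | h
    · rw [Real.sign_of_neg h, Real.sign_of_neg (by nlinarith)]
    · rw [Real.sign_of_pos h, Real.sign_of_pos (by nlinarith)]
  have hdiff : ∀ x ∈ subgradientSpace X grp w A K ∩ U, x - s ∈ tangentSpace X grp w A K s :=
    fun x hx => sub_mem_tangentSpace hsM hx.1 (hsign x hx.2)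
  have hsymm : ∀ x, (h : x - s ∈ V) → (e.symm (fun k : F => x k - s k) : Fin p → ℝ) = x - s := by
    intro x h
    have : (fun k : F => x k - s k) = e ⟨x - s, h⟩ := by
      ext k
      rw [he]
      rfl
    rw [this, LinearEquiv.symm_apply_apply]
  -- The inverse chart: the point of `s + V` with prescribed coordinates on `F`.
  set ext : (F → ℝ) → (Fin p → ℝ) := fun u => s + (e.symm (fun k : F => u k - s k) : Fin p → ℝ)
    with hext
  have hextF : ∀ u, (fun k : F => ext u k) = u := by
    intro u
    funext k
    rw [hext]
    simp only [Pi.add_apply]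
    rw [← he, LinearEquiv.apply_symm_apply]
    ring
  have hcont : Continuous ext := by
    have h1 : Continuous (V.subtype ∘ₗ e.symm.toLinearMap) :=
      LinearMap.continuous_of_finiteDimensional _
    exact continuous_const.add
      (h1.comp (by fun_prop : Continuous fun (u : F → ℝ) (k : F) => u k - s k))
  refine ⟨F, _, by omega, hT, U, ext ⁻¹' U, hUopen,
    ⟨fun k hk => mul_self_pos.2 (hs0 k hk), hs1⟩, hUopen.preimage hcont, ⟨?_, ?_, ?_⟩, ?_⟩
  · intro x hx
    change s + (e.symm (fun k : F => x k - s k) : Fin p → ℝ) ∈ U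
    rw [hsymm x ((hV _).1 (hdiff x hx)), add_sub_cancel]
    exact hx.2
  · intro x hx y hy hxy
    have h1 := hsymm x ((hV _).1 (hdiff x hx))
    have h2 := hsymm y ((hV _).1 (hdiff y hy))
    have h3 : (fun k : F => x k - s k) = fun k : F => y k - s k := by
      funext k
      rw [show x k = y k from congrFun hxy k]
    rw [h3, h2] at h1
    exact (sub_left_injective h1).symm
  · intro u hu
    refine ⟨ext u, ⟨mem_subgradientSpace_of_sub hsM ?_ (hsign _ hu) fun j hj => (hu.2 j hj).le,
      hu⟩, hextF u⟩
    rw [hV, hext]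
    simp
  · intro x hx
    exact hT.eq_mulVec _ (hdiff x hx)

/-! ### Polyhedral and conic structure of the pieces. -/

theorem isPolyhedron_iInter {p : ℕ} {ι : Type*} [Finite ι] {P : ι → Set (Fin p → ℝ)}
    (h : ∀ i, IsPolyhedron (P i)) : IsPolyhedron {x | ∀ i, x ∈ P i} := by
  classical
  have := Fintype.ofFinite ι
  choose t ht using h
  refine ⟨Finset.univ.biUnion t, ?_⟩
  ext x
  simp only [Set.mem_ofPred_eq, Finset.mem_biUnion, Finset.mem_univ, true_and, forall_exists_index]
  constructor
  · intro hx c i hc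
    have := hx i
    rw [ht] at this
    exact this c hc
  · intro hx i
    rw [ht]
    exact fun c hc => hx c i hc

theorem IsPolyhedron.inter {p : ℕ} {P Q : Set (Fin p → ℝ)} (hP : IsPolyhedron P)
    (hQ : IsPolyhedron Q) : IsPolyhedron (P ∩ Q) := by
  have := isPolyhedron_iInter (P := fun b : Bool => if b then P else Q) (by simp [hP, hQ])
  convert this using 1
  ext x
  simp [and_comm]

theorem isPolyhedron_le {p : ℕ} (f : (Fin p → ℝ) →ₗ[ℝ] ℝ) (a : ℝ) :
    IsPolyhedron {x | f x ≤ a} := by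
  classical
  refine ⟨{(fun k => f (Pi.single k 1), a)}, ?_⟩
  ext x
  have : f x = ∑ k, f (Pi.single k 1) * x k := by
    rw [LinearMap.pi_apply_eq_sum_univ f]
    refine Finset.sum_congr rfl fun k _ => ?_
    rw [smul_eq_mul, mul_comm]
    congr 2
    ext l
    simp [Pi.single_apply, eq_comm]
  simp [this]

theorem isPolyhedron_eq {p : ℕ} (f : (Fin p → ℝ) →ₗ[ℝ] ℝ) (a : ℝ) :
    IsPolyhedron {x | f x = a} := by
  convert (isPolyhedron_le f a).inter (isPolyhedron_le (-f) (-a)) using 1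
  ext x
  simp [le_antisymm_iff]

/-- By double orthogonality, `V` is cut out by finitely many generators of its orthogonal
complement. -/
theorem isPolyhedron_submodule {p : ℕ} (V : Submodule ℝ (Fin p → ℝ)) :
    IsPolyhedron (V : Set (Fin p → ℝ)) := by
  obtain ⟨t, ht⟩ := IsNoetherian.noetherian (orthogonalSpace V)
  have := isPolyhedron_iInter (P := fun c : t => {x | dotProductBilin ℝ ℝ (c : Fin p → ℝ) x = 0})
    fun c => isPolyhedron_eq _ 0
  convert this using 1
  ext x
  constructor
  · intro hx c
    have : (c : Fin p → ℝ) ∈ orthogonalSpace V := by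
      rw [← ht]
      exact Submodule.subset_span c.2
    change (c : Fin p → ℝ) ⬝ᵥ x = 0
    rw [dotProduct_comm]
    exact this x hx
  · intro hx
    refine orthogonalSpace_orthogonalSpace fun z hz => ?_
    rw [← ht] at hz
    have hle : Submodule.span ℝ (t : Set (Fin p → ℝ)) ≤ LinearMap.ker (dotProductBilin ℝ ℝ x) := by
      rw [Submodule.span_le]
      intro c hc
      have h1 : c ⬝ᵥ x = 0 := hx ⟨c, hc⟩
      rw [dotProduct_comm] at h1
      exact h1
    exact hle hz

/-- On each closed orthant the absolute values are linear and the constraints define a polyhedron;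
finitely many orthants cover the space. -/
theorem isPolyhedral_subgradientSpace {n p J : ℕ} (X : Matrix (Fin n) (Fin p) ℝ)
    (grp : Fin p → Fin J) (w : Fin J → ℝ) (A : Finset (Fin J)) (K : Finset (Fin p)) :
    IsPolyhedral (subgradientSpace X grp w A K) := by
  classical
  set c : Bool → ℝ := fun b => if b then 1 else -1 with hc
  set f : (Fin p → Bool) → Finset (Fin p) → (Fin p → ℝ) →ₗ[ℝ] ℝ :=
    fun σ t => ∑ k ∈ t, c (σ k) • LinearMap.proj k with hf
  have hfa : ∀ σ t x, f σ t x = ∑ k ∈ t, c (σ k) * x k := by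
    intro σ t x
    simp [hf]
  set Q : (Fin p → Bool) → Set (Fin p → ℝ) := fun σ =>
    (rowSpace X grp w : Set (Fin p → ℝ)) ∩ ({x | ∀ k, x ∈ {x | (-f σ {k}) x ≤ 0}} ∩
      ({x | ∀ j : A, x ∈ {x | f σ (K.filter fun k => grp k = j) x = 1}} ∩
      ({x | ∀ k : coSupport grp A K, x ∈ {x | LinearMap.proj (R := ℝ) (φ := fun _ => ℝ)
        (k : Fin p) x = (0 : ℝ)}} ∩
        {x | ∀ j : (Aᶜ : Finset (Fin J)),
          x ∈ {x | f σ (Finset.univ.filter fun k => grp k = j) x ≤ 1}}))) with hQ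
  have hQmem : ∀ σ x, x ∈ Q σ ↔ x ∈ rowSpace X grp w ∧ (∀ k, (-f σ {k}) x ≤ 0) ∧
      (∀ j : A, f σ (K.filter fun k => grp k = j) x = 1) ∧
      (∀ k : coSupport grp A K, x k = 0) ∧ ∀ j : (Aᶜ : Finset (Fin J)),
        f σ (Finset.univ.filter fun k => grp k = j) x ≤ 1 := fun _ _ => Iff.rfl
  have hQpoly : ∀ σ, IsPolyhedron (Q σ) := fun σ =>
    (isPolyhedron_submodule _).inter ((isPolyhedron_iInter fun k => isPolyhedron_le _ _).inter
      ((isPolyhedron_iInter fun j => isPolyhedron_eq _ _).inter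
        ((isPolyhedron_iInter fun k => isPolyhedron_eq _ _).inter
          (isPolyhedron_iInter fun j => isPolyhedron_le _ _))))
  clear_value Q
  have hneg : ∀ σ k x, (-f σ {k}) x ≤ 0 ↔ 0 ≤ c (σ k) * x k := by
    intro σ k x
    rw [LinearMap.neg_apply, hfa, Finset.sum_singleton, neg_nonpos]
  clear_value f
  have habs : ∀ σ x, (∀ k, 0 ≤ c (σ k) * x k) → ∀ t, f σ t x = ∑ k ∈ t, |x k| := by
    intro σ x h t
    rw [hfa]
    refine Finset.sum_congr rfl fun k _ => ?_
    rw [← abs_of_nonneg (h k), abs_mul]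
    cases σ k <;> simp [hc]
  simp only [hneg] at hQmem
  have hQmem' : ∀ σ x, x ∈ Q σ ↔ (∀ k, 0 ≤ c (σ k) * x k) ∧ x ∈ subgradientSpace X grp w A K := by
    intro σ x
    rw [hQmem]
    constructor
    · rintro ⟨h1, hnn, h2, h3, h4⟩
      refine ⟨hnn, h1, fun j hj => ?_, fun k hk => h3 ⟨k, hk⟩, fun j hj => ?_⟩
      · rw [← habs σ x hnn]
        exact h2 ⟨j, hj⟩
      · rw [blockL1, ← habs σ x hnn]
        exact h4 ⟨j, Finset.mem_compl.2 hj⟩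
    · rintro ⟨hnn, h1, h2, h3, h4⟩
      refine ⟨h1, hnn, fun j => ?_, fun k => h3 k k.2, fun j => ?_⟩
      · rw [habs σ x hnn]
        exact h2 j j.2
      · rw [habs σ x hnn]
        exact h4 j (Finset.mem_compl.1 j.2)
  refine ⟨Set.range Q, Set.finite_range Q, by rintro _ ⟨σ, rfl⟩; exact hQpoly σ, ?_⟩
  ext x
  rw [Set.sUnion_range, Set.mem_iUnion]
  constructor
  · intro hx
    refine ⟨fun k => decide (0 ≤ x k), (hQmem' _ _).2 ⟨fun k => ?_, hx⟩⟩
    by_cases hk : 0 ≤ x k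
    · simp [hc, hk]
    · simp only [hc, hk, decide_false, Bool.false_eq_true, if_false]
      linarith
  · rintro ⟨σ, hσ⟩
    exact ((hQmem' _ _).1 hσ).2

theorem exists_convexCone_eq_blockCone {p J : ℕ} (grp : Fin p → Fin J) (A : Finset (Fin J))
    (K : Finset (Fin p)) (j : Fin J) :
    ∃ C : ConvexCone ℝ (ℝ × ({k : coSupport grp A K // grp k = j} → ℝ)),
      (C : Set (ℝ × ({k : coSupport grp A K // grp k = j} → ℝ))) = blockCone grp A K j := by
  refine ⟨⟨blockCone grp A K j, fun c hc x hx => ⟨mul_pos hc hx.1, ?_⟩,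
    fun x hx y hy => ⟨add_pos hx.1 hy.1, ?_⟩⟩, rfl⟩
  · rw [Prod.smul_snd, Prod.smul_fst, norm_smul, Real.norm_of_nonneg hc.le]
    exact mul_le_mul_of_nonneg_left hx.2 hc.le
  · exact (norm_add_le _ _).trans (add_le_add hx.2 hy.2)

/-! ### Change of variables for affine maps. -/

theorem measurePreserving_sumElim {n : ℕ} {ι κ φ : Type*} [Fintype ι] [Fintype κ] [Fintype φ]
    (e : ι ⊕ (κ ⊕ φ) ≃ Fin n) :
    ∃ ψ : (Fin n → ℝ) ≃ᵐ ((ι → ℝ) × (κ → ℝ)) × (φ → ℝ), MeasurePreserving ψ volume volume ∧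
      ∀ θ, ψ.symm θ = fun i => Sum.elim θ.1.1 (Sum.elim θ.1.2 θ.2) (e.symm i) := by
  set a := (MeasurableEquiv.piCongrLeft (fun _ : Fin n => ℝ) e)
  set b := (MeasurableEquiv.sumPiEquivProdPi (fun _ : ι ⊕ (κ ⊕ φ) => ℝ))
  set c := (MeasurableEquiv.sumPiEquivProdPi (fun _ : κ ⊕ φ => ℝ))
  have ha : MeasurePreserving a volume volume :=
    volume_measurePreserving_piCongrLeft (fun _ : Fin n => ℝ) e
  have hb : MeasurePreserving b volume volume :=
    volume_measurePreserving_sumPiEquivProdPi (fun _ : ι ⊕ (κ ⊕ φ) => ℝ)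
  have hc : MeasurePreserving c volume volume :=
    volume_measurePreserving_sumPiEquivProdPi (fun _ : κ ⊕ φ => ℝ)
  set d := (MeasurableEquiv.prodAssoc (α := ι → ℝ) (β := κ → ℝ) (γ := φ → ℝ))
  have hd : MeasurePreserving d volume volume := volume_preserving_prodAssoc
  refine ⟨a.symm.trans (b.trans (((MeasurableEquiv.refl (ι → ℝ)).prodCongr c).trans d.symm)),
    (((hd.symm d).comp ((MeasurePreserving.id volume).prod hc)).comp hb).comp (ha.symm a), ?_⟩
  intro θ
  funext i
  obtain ⟨l, rfl⟩ := e.surjective i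
  rw [Equiv.symm_apply_apply]
  change a (b.symm (θ.1.1, c.symm (θ.1.2, θ.2))) (e l) = _
  rw [MeasurableEquiv.piCongrLeft_apply_apply]
  rcases l with l | l | l <;> rfl

/-- Change of variables for an affine map on a product of three coordinate spaces. -/
theorem lintegral_image_affine {n : ℕ} {ι κ φ : Type*} [Fintype ι] [Fintype κ] [Fintype φ]
    (e : ι ⊕ (κ ⊕ φ) ≃ Fin n) (M : Matrix (Fin n) (ι ⊕ (κ ⊕ φ)) ℝ) (c : Fin n → ℝ)
    {G : Set (((ι → ℝ) × (κ → ℝ)) × (φ → ℝ))} (hG : MeasurableSet G)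
    {h : ((ι → ℝ) × (κ → ℝ)) × (φ → ℝ) → Fin n → ℝ}
    (hh : ∀ θ ∈ G, h θ = M.mulVec (Sum.elim θ.1.1 (Sum.elim θ.1.2 θ.2)) + c)
    (g : (Fin n → ℝ) → ENNReal) :
    NullMeasurableSet (h '' G) volume ∧
      ∫⁻ v in h '' G, g v
        = ∫⁻ θ in G, g (h θ) * ENNReal.ofReal |(M.submatrix id e.symm).det| := by
  obtain ⟨ψ, hψ, hψs⟩ := measurePreserving_sumElim e
  set N := M.submatrix id e.symm with hN
  set f : (Fin n → ℝ) → Fin n → ℝ := fun x => N.mulVec x + c with hf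
  have hfh : ∀ θ ∈ G, f (ψ.symm θ) = h θ := by
    intro θ hθ
    rw [hh θ hθ, hf, hψs, hN]
    simp only
    congr 1
    ext i
    rw [Matrix.mulVec, Matrix.mulVec, dotProduct, dotProduct, ← e.symm.sum_comp]
    rfl
  have himage : h '' G = f '' (ψ ⁻¹' G) := by
    ext v
    constructor
    · rintro ⟨θ, hθ, rfl⟩
      exact ⟨ψ.symm θ, by simpa using hθ, hfh θ hθ⟩
    · rintro ⟨x, hx, rfl⟩
      exact ⟨ψ x, hx, by rw [← hfh _ hx, ψ.symm_apply_apply]⟩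
  have hGm : MeasurableSet (ψ ⁻¹' G) := ψ.measurable hG
  have hrhs : ∫⁻ θ in G, g (h θ) * ENNReal.ofReal |N.det|
      = ∫⁻ x in ψ ⁻¹' G, g (f x) * ENNReal.ofReal |N.det| := by
    rw [← hψ.setLIntegral_comp_preimage_emb ψ.measurableEmbedding]
    refine setLIntegral_congr_fun hGm fun x hx => ?_
    rw [← hfh _ hx, ψ.symm_apply_apply]
  rw [hrhs, himage]
  -- For a singular matrix the image is null and the integrand on the right vanishes, so
  -- nondegeneracy of the Jacobian need not be shown.
  by_cases hdet : N.det = 0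
  · have hnull : volume (f '' (ψ ⁻¹' G)) = 0 := by
      have : f '' (ψ ⁻¹' G) = (fun v => v + c) '' (Matrix.toLin' N '' (ψ ⁻¹' G)) := by
        rw [Set.image_image]
        rfl
      rw [this, Set.image_add_right, measure_preimage_add_right,
        Measure.addHaar_image_linearMap, LinearMap.det_toLin', hdet]
      simp
    refine ⟨NullMeasurableSet.of_null hnull, ?_⟩
    rw [setLIntegral_measure_zero _ _ hnull, hdet]
    simp
  · set L : (Fin n → ℝ) →L[ℝ] (Fin n → ℝ) := LinearMap.toContinuousLinearMap (Matrix.toLin' N)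
      with hL
    have hLdet : L.det = N.det := by
      rw [hL, LinearMap.det_toContinuousLinearMap, LinearMap.det_toLin']
    have hderiv : ∀ x ∈ ψ ⁻¹' G, HasFDerivWithinAt f L (ψ ⁻¹' G) x := fun x _ =>
      (L.hasFDerivAt.add_const c).hasFDerivWithinAt
    have hinj : Set.InjOn f (ψ ⁻¹' G) := by
      intro x _ y _ hxy
      exact Matrix.mulVec_injective_iff_isUnit.2
        ((Matrix.isUnit_iff_isUnit_det _).2 (isUnit_iff_ne_zero.2 hdet)) (add_right_cancel hxy)
    refine ⟨(measurable_image_of_fderivWithin hGm hderiv hinj).nullMeasurableSet, ?_⟩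
    rw [lintegral_image_eq_lintegral_abs_det_fderiv_mul volume hGm hderiv hinj]
    refine lintegral_congr fun x => ?_
    rw [hLdet, mul_comm]

/-! ### The KKT equation solved for the scaled noise. -/

/-- Since `λ W s = λ Xᵀ z`, the pseudo-inverse is applied to a vector in the range of `Xᵀ`, and it
returns the preimage. -/
theorem scaledMap_dual {n p J : ℕ} (hn : 0 < n) (hnp : n ≤ p) {X : Matrix (Fin n) (Fin p) ℝ}
    (hX : ColumnsIndependent X) (grp : Fin p → Fin J) {w : Fin J → ℝ} (hw : ∀ j, 0 < w j)
    (lam : ℝ) (β₀ b : Fin p → ℝ) (z : Fin n → ℝ) :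
    scaledMap X grp w lam β₀ b (dual X grp w z)
      = (Real.sqrt n)⁻¹ • (X.mulVec b + ((n : ℝ) * lam) • z - X.mulVec β₀) := by
  have hn' : (0 : ℝ) < n := by exact_mod_cast hn
  have h1 : (gram X).mulVec b + lam • (weight grp w).mulVec (dual X grp w z)
      - (gram X).mulVec β₀ = X.transpose.mulVec
        ((1 / (n : ℝ)) • (X.mulVec b + ((n : ℝ) * lam) • z - X.mulVec β₀)) := by
    have h2 : (1 / (n : ℝ)) * (n * lam) = lam := by field_simp
    rw [gram_mulVec, gram_mulVec, weight_mulVec_dual X grp hw, smul_sub, smul_add, smul_smul, h2,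
      Matrix.mulVec_sub, Matrix.mulVec_add, Matrix.mulVec_smul, Matrix.mulVec_smul,
      Matrix.mulVec_smul]
  rw [scaledMap, h1, Matrix.mulVec_mulVec, pinv_mul_self (transpose_mulVec_injective hnp hX),
    Matrix.one_mulVec, smul_smul]
  congr 1
  have hs : Real.sqrt n ≠ 0 := (Real.sqrt_pos.2 hn').ne'
  have hs2 : (n : ℝ) = Real.sqrt n * Real.sqrt n := (Real.mul_self_sqrt hn'.le).symm
  rw [one_div]
  conv_lhs => rw [hs2]
  rw [mul_inv, Real.sqrt_mul_self (Real.sqrt_nonneg _)]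
  field_simp

theorem eq_dual_iff_scaledMap {n p J : ℕ} (hn : 0 < n) (hnp : n ≤ p)
    {X : Matrix (Fin n) (Fin p) ℝ}
    (hX : ColumnsIndependent X) (grp : Fin p → Fin J) {w : Fin J → ℝ} (hw : ∀ j, 0 < w j)
    {lam : ℝ} (hlam : 0 < lam) (β₀ b : Fin p → ℝ) {s : Fin p → ℝ} (hs : s ∈ rowSpace X grp w)
    (v : Fin n → ℝ) :
    s = dual X grp w (((n : ℝ) * lam)⁻¹ • (X.mulVec β₀ + v - X.mulVec b)) ↔
      (Real.sqrt n)⁻¹ • v = scaledMap X grp w lam β₀ b s := by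
  have hn' : (0 : ℝ) < n := by exact_mod_cast hn
  have hc : (n : ℝ) * lam ≠ 0 := (mul_pos hn' hlam).ne'
  have hr : (Real.sqrt n)⁻¹ ≠ 0 := inv_ne_zero (Real.sqrt_pos.2 hn').ne'
  obtain ⟨z, rfl⟩ := (mem_rowSpace_iff hw).1 hs
  rw [scaledMap_dual hn hnp hX grp hw, (dual_injective hnp hX grp hw).eq_iff,
    (smul_right_injective _ hr).eq_iff, eq_inv_smul_iff₀ hc]
  constructor
  · intro h
    rw [h]; abel
  · intro h
    rw [h]; abel

/-- Converse side of the representation: alignment makes every point of a piece a candidate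
augmented solution, with only the KKT equation left to hold. -/
theorem isAligned_coefficient {n p J : ℕ} {X : Matrix (Fin n) (Fin p) ℝ} {grp : Fin p → Fin J}
    {w : Fin J → ℝ} {A : Finset (Fin J)} {K : Finset (Fin p)} {s : Fin p → ℝ}
    (hs : s ∈ subgradientSpace X grp w A K) {q : (A → ℝ) × (coSupport grp A K → ℝ)}
    (hq : q ∈ coneProduct grp A K) :
    IsAligned grp (fun j => if hj : j ∈ A then q.1 ⟨j, hj⟩ else 0) (coefficient grp A K q s) s := by
  refine ⟨fun j => ?_, fun k => ?_, fun k hk => ?_, fun j hj => ?_⟩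
  · by_cases hj : j ∈ A
    · simpa [hj] using (hq ⟨j, hj⟩).1.le
    · simp [hj]
  · rw [coefficient]
    split_ifs with h1 h2 h2
    · exact (norm_le_pi_norm (fun l : {l : coSupport grp A K // grp l = grp k} => q.2 l)
        ⟨⟨k, h1⟩, rfl⟩).trans (hq ⟨grp k, h2⟩).2
    · exact absurd (mem_coSupport.1 h1).1 h2
    · rw [abs_mul, abs_of_pos (hq ⟨grp k, h2⟩).1]
      exact mul_le_of_le_one_right (hq ⟨grp k, h2⟩).1.le (abs_sign_le_one _)
    · simp
  · have h1 : k ∉ coSupport grp A K := fun h => hk (hs.2.2.1 k h)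
    rw [coefficient, dif_neg h1]
    split_ifs <;> simp
  · exact dif_neg fun h => hj (blockL1_eq_one_of_mem hs h)

theorem activeBlocks_coefficient {n p J : ℕ} {X : Matrix (Fin n) (Fin p) ℝ} {grp : Fin p → Fin J}
    {w : Fin J → ℝ} {A : Finset (Fin J)} {K : Finset (Fin p)} {s : Fin p → ℝ}
    (hs : s ∈ subgradientSpace X grp w A K) {q : (A → ℝ) × (coSupport grp A K → ℝ)}
    (hq : q ∈ coneProduct grp A K) : activeBlocks grp (coefficient grp A K q s) = A := by
  ext j
  rw [mem_activeBlocks_iff, (isAligned_coefficient hs hq).blockSup_eq]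
  by_cases hj : j ∈ A
  · simpa [hj] using (hq ⟨j, hj⟩).1.ne'
  · simp [hj]

/-- Interiority is what makes every index of `K` active. -/
theorem activeSupport_coefficient {n p J : ℕ} {X : Matrix (Fin n) (Fin p) ℝ} {grp : Fin p → Fin J}
    {w : Fin J → ℝ} {A : Finset (Fin J)} {K : Finset (Fin p)} (hK : ∀ k ∈ K, grp k ∈ A)
    {s : Fin p → ℝ} (hs : s ∈ subgradientInterior X grp w A K)
    {q : (A → ℝ) × (coSupport grp A K → ℝ)} (hq : q ∈ coneProduct grp A K) :
    activeSupport grp (coefficient grp A K q s) s = K := by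
  ext k
  rw [mem_activeSupport, activeBlocks_coefficient hs.1 hq]
  constructor
  · rintro ⟨h1, h2⟩
    by_contra hc
    exact h2 (hs.1.2.2.1 k (mem_coSupport.2 ⟨h1, hc⟩))
  · exact fun h => ⟨hK k h, hs.2.1 k h⟩

theorem coordinates_coefficient {n p J : ℕ} {X : Matrix (Fin n) (Fin p) ℝ} {grp : Fin p → Fin J}
    {w : Fin J → ℝ} {A : Finset (Fin J)} {K : Finset (Fin p)} {s : Fin p → ℝ}
    (hs : s ∈ subgradientSpace X grp w A K) {q : (A → ℝ) × (coSupport grp A K → ℝ)}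
    (hq : q ∈ coneProduct grp A K) :
    coordinates grp A K (coefficient grp A K q s) = q := by
  refine Prod.ext (funext fun j => ?_) (funext fun k => ?_)
  · simp only [coordinates, (isAligned_coefficient hs hq).blockSup_eq, j.2, dif_pos]
  · simp [coordinates, coefficient]

/-! ### Affinity of `H̃` on a sign pattern. -/

/-- Extension of `T` by zero outside the free indices. -/
noncomputable def extendFree {p J : ℕ} {grp : Fin p → Fin J} {A : Finset (Fin J)}
    {K F : Finset (Fin p)} (T : Matrix (freeIndices grp A K) F ℝ) :
    (F → ℝ) →ₗ[ℝ] (Fin p → ℝ) where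
  toFun t := fun k => if h : k ∈ freeIndices grp A K then T.mulVec t ⟨k, h⟩ else 0
  map_add' a b := by
    ext k
    simp only [Matrix.mulVec_add, Pi.add_apply]
    split_ifs <;> ring
  map_smul' c a := by
    ext k
    simp only [Matrix.mulVec_smul, Pi.smul_apply, smul_eq_mul, RingHom.id_apply]
    split_ifs <;> ring

theorem extendFree_apply {p J : ℕ} {grp : Fin p → Fin J} {A : Finset (Fin J)}
    {K F : Finset (Fin p)} (T : Matrix (freeIndices grp A K) F ℝ) (t : F → ℝ) (k : Fin p) :
    extendFree T t k = if h : k ∈ freeIndices grp A K then T.mulVec t ⟨k, h⟩ else 0 := rfl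

theorem IsTangentMatrix.extendFree_eq {n p J : ℕ} {X : Matrix (Fin n) (Fin p) ℝ}
    {grp : Fin p → Fin J} {w : Fin J → ℝ} {A : Finset (Fin J)} {K : Finset (Fin p)} {s : Fin p → ℝ}
    {F : Finset (Fin p)} {T : Matrix (freeIndices grp A K) F ℝ}
    (hT : IsTangentMatrix X grp w A K s F T) {v : Fin p → ℝ}
    (hv : v ∈ tangentSpace X grp w A K s) : extendFree T (fun k : F => v k) = v := by
  ext k
  rw [extendFree_apply]
  split_ifs with h
  · rw [← hT.eq_mulVec v hv]
  · rw [mem_freeIndices, not_not] at h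
    exact (hv.2.1 k h).symm

theorem tangentSpace_congr {n p J : ℕ} {X : Matrix (Fin n) (Fin p) ℝ} {grp : Fin p → Fin J}
    {w : Fin J → ℝ} {A : Finset (Fin J)} {K : Finset (Fin p)} {s s' : Fin p → ℝ}
    (h : ∀ k, Real.sign (s k) = Real.sign (s' k)) :
    tangentSpace X grp w A K s = tangentSpace X grp w A K s' := by
  simp only [tangentSpace, h]

/-- As `ds_F` takes every value, `T` is forced by the space of differentials, which depends on `s`
only through its signs. -/
theorem IsTangentMatrix.unique {n p J : ℕ} {X : Matrix (Fin n) (Fin p) ℝ}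
    {grp : Fin p → Fin J} {w : Fin J → ℝ} {A : Finset (Fin J)} {K : Finset (Fin p)}
    {s s' : Fin p → ℝ} (h : ∀ k, Real.sign (s k) = Real.sign (s' k))
    {F : Finset (Fin p)} {T T' : Matrix (freeIndices grp A K) F ℝ}
    (hT : IsTangentMatrix X grp w A K s F T) (hT' : IsTangentMatrix X grp w A K s' F T') :
    T = T' := by
  refine Matrix.mulVec_injective (funext fun t => ?_)
  obtain ⟨v, hv, rfl⟩ := hT.free t
  rw [← hT.eq_mulVec v hv, ← hT'.eq_mulVec v (tangentSpace_congr h ▸ hv)]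

theorem sum_free_eq_mulVec {n p J : ℕ} {grp : Fin p → Fin J} {A : Finset (Fin J)}
    {K F : Finset (Fin p)} (T : Matrix (freeIndices grp A K) F ℝ) (N : Matrix (Fin n) (Fin p) ℝ)
    (t : F → ℝ) :
    (N.submatrix id (fun k : freeIndices grp A K => (k : Fin p)) * T).mulVec t
      = N.mulVec (extendFree T t) := by
  ext i
  rw [← Matrix.mulVec_mulVec, Matrix.mulVec, Matrix.mulVec, dotProduct, dotProduct,
    ← Finset.sum_subset (Finset.subset_univ (freeIndices grp A K)),
    ← Finset.sum_coe_sort (freeIndices grp A K)]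
  · refine Finset.sum_congr rfl fun k _ => ?_
    rw [extendFree_apply, dif_pos k.2]
    rfl
  · intro k _ hk
    rw [extendFree_apply, dif_neg hk, mul_zero]

theorem gram_mulVec_coefficient {n p J : ℕ} {X : Matrix (Fin n) (Fin p) ℝ} {grp : Fin p → Fin J}
    {w : Fin J → ℝ} {A : Finset (Fin J)} {K : Finset (Fin p)} {s : Fin p → ℝ}
    (hs : s ∈ subgradientSpace X grp w A K) (q : (A → ℝ) × (coSupport grp A K → ℝ)) :
    (gram X).mulVec (coefficient grp A K q s)
      = ((gramSign X grp s).submatrix id (fun j : A => (j : Fin J))).mulVec q.1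
        + ((gram X).submatrix id (fun k : coSupport grp A K => (k : Fin p))).mulVec q.2 := by
  ext i
  have h := sum_coefficient_mul (fun _ => (1 : ℝ)) s (fun k => gram X i k) q (grp := grp)
  simp only [one_mul] at h
  rw [Matrix.mulVec, dotProduct_comm, dotProduct, h, Pi.add_apply]
  congr 1
  · rw [Matrix.mulVec, dotProduct]
    refine Finset.sum_congr rfl fun j _ => ?_
    rw [mul_comm]
    congr 1
    rw [Matrix.submatrix_apply, gramSign, Matrix.of_apply]
    refine (Finset.sum_congr rfl fun k _ => mul_comm _ _).trans
      (Finset.sum_subset (Finset.filter_subset_filter _ (Finset.subset_univ K))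
        fun k hk hk' => ?_)
    have hkj : grp k = j := by simpa using hk
    rw [hs.2.2.1 k (mem_coSupport.2 ⟨hkj ▸ j.2, fun h => hk' (Finset.mem_filter.2 ⟨h, hkj⟩)⟩),
      Real.sign_zero, mul_zero]
  · rw [Matrix.mulVec, dotProduct]
    exact Finset.sum_congr rfl fun l _ => mul_comm _ _

theorem coefficient_congr {p J : ℕ} {grp : Fin p → Fin J} {A : Finset (Fin J)}
    {K : Finset (Fin p)} {s s' : Fin p → ℝ} (h : ∀ k, Real.sign (s k) = Real.sign (s' k))
    (q : (A → ℝ) × (coSupport grp A K → ℝ)) :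
    coefficient grp A K q s = coefficient grp A K q s' := by
  unfold coefficient
  simp only [h]

/-- On the subgradients with a fixed sign pattern, the scaled map is affine in
`(r_A, b_{Kᶜ}, s_F)`, with the matrix that defines the Jacobian. -/
theorem scaledMap_affine {n p J : ℕ} {X : Matrix (Fin n) (Fin p) ℝ} {grp : Fin p → Fin J}
    {w : Fin J → ℝ} (lam : ℝ) (β₀ : Fin p → ℝ) {A : Finset (Fin J)} {K F : Finset (Fin p)}
    {s₀ : Fin p → ℝ} (hs₀ : s₀ ∈ subgradientSpace X grp w A K)
    {T : Matrix (freeIndices grp A K) F ℝ} (hT : IsTangentMatrix X grp w A K s₀ F T) :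
    ∃ c : Fin n → ℝ, ∀ q s, s ∈ subgradientSpace X grp w A K →
      (∀ k, Real.sign (s k) = Real.sign (s₀ k)) →
      scaledMap X grp w lam β₀ (coefficient grp A K q s) s
        = (Real.sqrt n • (pinv X.transpose * tangentMap X grp w lam A K s₀ F T)).mulVec
          (Sum.elim q.1 (Sum.elim q.2 fun k : F => s k)) + c := by
  -- The constant collects `β₀` and the part of `s₀` that is not recovered linearly from its
  -- coordinates on `F`.
  refine ⟨Real.sqrt n • (pinv X.transpose).mulVec (lam • (weight grp w).mulVec
    (s₀ - extendFree T fun k : F => s₀ k) - (gram X).mulVec β₀), fun q s hs hsign => ?_⟩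
  have hdiff : s = extendFree T (fun k : F => s k) + (s₀ - extendFree T fun k : F => s₀ k) := by
    have h1 := hT.extendFree_eq (sub_mem_tangentSpace hs₀ hs fun k _ => hsign k)
    have h2 : (fun k : F => (s - s₀) k) = (fun k : F => s k) - fun k : F => s₀ k := rfl
    rw [h2, map_sub] at h1
    rw [← add_sub_assoc, add_sub_right_comm, h1, sub_add_cancel]
  have hW : (weight grp w).mulVec s
      = ((weight grp w).submatrix id (fun k : freeIndices grp A K => (k : Fin p)) * T).mulVec
          (fun k : F => s k)
        + (weight grp w).mulVec (s₀ - extendFree T fun k : F => s₀ k) := by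
    conv_lhs => rw [hdiff]
    rw [Matrix.mulVec_add, sum_free_eq_mulVec]
  rw [scaledMap, coefficient_congr hsign, gram_mulVec_coefficient hs₀, hW, Matrix.smul_mulVec,
    ← Matrix.mulVec_mulVec _ (pinv X.transpose), tangentMap, Matrix.fromCols_mulVec_sumElim,
    Matrix.fromCols_mulVec_sumElim, Matrix.smul_mulVec, ← smul_add, ← Matrix.mulVec_add]
  congr 2
  rw [smul_add]
  abel

/-! ### Negligibility of the non-interior parameters. -/

/-- Vanishing on the differentials puts the fit in the double orthogonal complement of the fits of
the piece, hence among them. Injectivity then turns equality of fits into equality of vectors. -/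
theorem exists_coefficient_of_orthogonal {n p J : ℕ} (hn : 0 < n) {X : Matrix (Fin n) (Fin p) ℝ}
    {grp : Fin p → Fin J} {w : Fin J → ℝ} (hw : ∀ j, 0 < w j) {lam : ℝ} (hlam : 0 < lam)
    (huniq : ∀ᵐ y : Fin n → ℝ, ∃! bs : (Fin p → ℝ) × (Fin p → ℝ),
      IsAugmentedSolution X grp w lam y bs.1 bs.2)
    {A : Finset (Fin J)} {K : Finset (Fin p)} {s : Fin p → ℝ}
    (hs : s ∈ subgradientSpace X grp w A K) (q₀ : (Fin J → ℝ) × (Fin p → ℝ))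
    (h : ∀ v ∈ tangentSpace X grp w A K s, ∑ k, w (grp k) * (expand grp s q₀ k * v k) = 0) :
    ∃ q, expand grp s q₀ = coefficient grp A K q s := by
  have hmem : X.mulVec (expand grp s q₀)
      ∈ LinearMap.range (X.mulVecLin ∘ₗ coefficientMap grp A K s) := by
    refine orthogonalSpace_orthogonalSpace fun z hz => ?_
    rw [mulVec_dotProduct_eq_dual hw]
    exact h _ ((mem_tangentSpace_iff hw).2 ⟨z, hz, rfl⟩)
  obtain ⟨q, hq⟩ := hmem
  refine ⟨q, ?_⟩
  have hq' : X.mulVec (coefficient grp A K q s) = X.mulVec (expand grp s q₀) := hq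
  rw [coefficient_eq_expand hs] at hq' ⊢
  refine sub_eq_zero.1 ?_
  rw [← map_sub]
  refine expand_eq_zero_of_mulVec_eq_zero hn hw hlam huniq hs.1 (blockL1_le_one_of_mem hs) _ ?_
  rw [map_sub, Matrix.mulVec_sub, hq', sub_self]

/-- Parameters with a fixed sign pattern on which a linear functional that is nontrivial on the
tangent space is constant form a null set. -/
theorem volume_eq_zero_of_functional {n p J : ℕ} {X : Matrix (Fin n) (Fin p) ℝ}
    {grp : Fin p → Fin J} {w : Fin J → ℝ} {A : Finset (Fin J)} {K F : Finset (Fin p)}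
    {B : Set (F → ℝ)} {Φ : (F → ℝ) → Fin p → ℝ} {u₀ : F → ℝ} (hu₀ : u₀ ∈ B)
    {T : Matrix (freeIndices grp A K) F ℝ} (hT : IsTangentMatrix X grp w A K (Φ u₀) F T)
    (hΦ : ∀ u ∈ B, Φ u ∈ subgradientSpace X grp w A K ∧ (fun k : F => Φ u k) = u)
    (hsign : ∀ u ∈ B, ∀ k, Real.sign (Φ u k) = Real.sign (Φ u₀ k))
    (φ : (Fin p → ℝ) →ₗ[ℝ] ℝ) (hφ : ∀ u ∈ B, φ (Φ u) = φ (Φ u₀)) {v : Fin p → ℝ}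
    (hv : v ∈ tangentSpace X grp w A K (Φ u₀)) (hφv : φ v ≠ 0) : volume B = 0 := by
  set V : Submodule ℝ (F → ℝ) := LinearMap.ker (φ ∘ₗ extendFree T) with hV
  have hVtop : V ≠ ⊤ := by
    intro h
    have h1 : (fun k : F => v k) ∈ V := h ▸ Submodule.mem_top
    rw [hV, LinearMap.mem_ker, LinearMap.comp_apply, hT.extendFree_eq hv] at h1
    exact hφv h1
  -- Points over `B` differ by differentials killed by `φ`, so `B` lies in a translate of a proper
  -- subspace.
  have hsub : B ⊆ (fun u => u + -u₀) ⁻¹' (V : Set (F → ℝ)) := by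
    intro u hu
    have h1 := hT.extendFree_eq (sub_mem_tangentSpace (hΦ u₀ hu₀).1 (hΦ u hu).1
      fun k _ => hsign u hu k)
    have h2 : (fun k : F => (Φ u - Φ u₀) k) = u - u₀ := by
      conv_rhs => rw [← (hΦ u hu).2, ← (hΦ u₀ hu₀).2]
      rfl
    rw [h2] at h1
    change φ (extendFree T (u + -u₀)) = 0
    rw [← sub_eq_add_neg, h1, map_sub, hφ u hu, sub_self]
  refine measure_mono_null hsub ?_
  rw [measure_preimage_add_right]
  exact Measure.addHaar_submodule volume V hVtop

theorem ker_functional_apply {p J : ℕ} (grp : Fin p → Fin J) (w : Fin J → ℝ) (f v : Fin p → ℝ) :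
    (∑ k, (w (grp k) * f k) • LinearMap.proj (R := ℝ) (φ := fun _ : Fin p => ℝ) k) v
      = ∑ k, w (grp k) * (f k * v k) := by
  simp [mul_assoc]

/-- The parameters of the points of the subgradient space that are not interior form a null set. -/
theorem volume_not_interior {n p J : ℕ} (hn : 0 < n) {X : Matrix (Fin n) (Fin p) ℝ}
    {grp : Fin p → Fin J} {w : Fin J → ℝ} (hw : ∀ j, 0 < w j) {lam : ℝ} (hlam : 0 < lam)
    (huniq : ∀ᵐ y : Fin n → ℝ, ∃! bs : (Fin p → ℝ) × (Fin p → ℝ),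
      IsAugmentedSolution X grp w lam y bs.1 bs.2)
    {A : Finset (Fin J)} {K F : Finset (Fin p)} (hK : ∀ k ∈ K, grp k ∈ A)
    {Δ : Set (F → ℝ)} {Φ : (F → ℝ) → Fin p → ℝ}
    {T : (F → ℝ) → Matrix (freeIndices grp A K) F ℝ}
    (hΦ : ∀ u ∈ Δ, Φ u ∈ subgradientSpace X grp w A K ∧ (fun k : F => Φ u k) = u ∧
      IsTangentMatrix X grp w A K (Φ u) F (T u)) :
    volume {u ∈ Δ | Φ u ∉ subgradientInterior X grp w A K} = 0 := by
  classical
  -- A non-interior point has a zero coordinate in `K` or a saturated block outside `A`. Splitting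
  -- by sign pattern makes the failing constraint a linear equation.
  set B₁ : (Fin p → SignType) → K → Set (F → ℝ) := fun τ k =>
    {u ∈ Δ | (∀ l, SignType.sign (Φ u l) = τ l) ∧ Φ u k = 0} with hB₁
  set B₂ : (Fin p → SignType) → (Aᶜ : Finset (Fin J)) → Set (F → ℝ) := fun τ j =>
    {u ∈ Δ | (∀ l, SignType.sign (Φ u l) = τ l) ∧ blockL1 grp (Φ u) j = 1} with hB₂
  have hsub : {u ∈ Δ | Φ u ∉ subgradientInterior X grp w A K}
      ⊆ (⋃ τ, ⋃ k, B₁ τ k) ∪ ⋃ τ, ⋃ j, B₂ τ j := by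
    rintro u ⟨hu, hnot⟩
    by_contra hc
    refine hnot ⟨(hΦ u hu).1, fun k hk h0 => hc (Or.inl ?_), fun j hj => ?_⟩
    · exact Set.mem_iUnion.2 ⟨fun l => SignType.sign (Φ u l),
        Set.mem_iUnion.2 ⟨⟨k, hk⟩, hu, fun _ => rfl, h0⟩⟩
    · refine lt_of_le_of_ne (blockL1_le_one_of_mem (hΦ u hu).1 j) fun h1 => hc (Or.inr ?_)
      exact Set.mem_iUnion.2 ⟨fun l => SignType.sign (Φ u l),
        Set.mem_iUnion.2 ⟨⟨j, Finset.mem_compl.2 hj⟩, hu, fun _ => rfl, h1⟩⟩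
  refine measure_mono_null hsub (measure_union_null
    (measure_iUnion_null fun τ => measure_iUnion_null fun k => ?_)
    (measure_iUnion_null fun τ => measure_iUnion_null fun j => ?_))
  · rcases (B₁ τ k).eq_empty_or_nonempty with he | ⟨u₀, hu₀⟩
    · rw [he, measure_empty]
    obtain ⟨hM, -, hT⟩ := hΦ u₀ hu₀.1
    set f := expand grp (Φ u₀) (0, Pi.single (k : Fin p) 1) with hf
    have hfv : ∀ v : Fin p → ℝ, ∑ l, w (grp l) * (f l * v l) = w (grp k) * v k := by
      intro v
      rw [Finset.sum_eq_single (k : Fin p)]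
      · rw [hf, expand_apply, if_pos (blockL1_eq_one_of_mem hM (hK k k.2)), if_pos hu₀.2.2]
        simp
      · intro l _ hl
        rw [hf, expand_apply]
        by_cases h0 : Φ u₀ l = 0 <;> simp [h0, hl]
      · simp
    obtain ⟨v, hv, hne⟩ : ∃ v ∈ tangentSpace X grp w A K (Φ u₀),
        ∑ l, w (grp l) * (f l * v l) ≠ 0 := by
      -- Otherwise the unit vector at `k` would be a coefficient vector of the piece, whose entry at
      -- `k ∈ K` is a multiple of `sgn 0 = 0`.
      by_contra! hc
      obtain ⟨q, hq⟩ := exists_coefficient_of_orthogonal hn hw hlam huniq hM _ hc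
      have h1 := congrFun hq k
      rw [expand_apply, if_pos (blockL1_eq_one_of_mem hM (hK k k.2)), if_pos hu₀.2.2,
        coefficient, dif_neg fun h => (mem_coSupport.1 h).2 k.2, dif_pos (hK k k.2),
        hu₀.2.2] at h1
      simp at h1
    refine volume_eq_zero_of_functional hu₀ hT (fun u hu => ⟨(hΦ u hu.1).1, (hΦ u hu.1).2.1⟩)
      (fun u hu l => sign_eq_of_signType_eq ((hu.2.1 l).trans (hu₀.2.1 l).symm))
      (∑ l, (w (grp l) * f l) • LinearMap.proj l) (fun u hu => ?_) hv
      (by rwa [ker_functional_apply])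
    rw [ker_functional_apply, ker_functional_apply, hfv, hfv, hu.2.2, hu₀.2.2]
  · rcases (B₂ τ j).eq_empty_or_nonempty with he | ⟨u₀, hu₀⟩
    · rw [he, measure_empty]
    obtain ⟨hM, -, hT⟩ := hΦ u₀ hu₀.1
    set f := expand grp (Φ u₀) (Pi.single (j : Fin J) 1, 0) with hf
    have hfv : ∀ v : Fin p → ℝ, ∑ l, w (grp l) * (f l * v l)
        = w j * ∑ l with grp l = j, Real.sign (Φ u₀ l) * v l := by
      intro v
      rw [Finset.mul_sum, Finset.sum_filter]
      refine Finset.sum_congr rfl fun l _ => ?_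
      rw [hf, expand_apply]
      by_cases hl : grp l = j
      · by_cases h0 : Φ u₀ l = 0 <;> simp [hl, hu₀.2.2, h0]
      · by_cases h0 : Φ u₀ l = 0 <;> simp [hl, h0]
    have hsign : ∀ u ∈ B₂ τ j, ∀ l, Real.sign (Φ u l) = Real.sign (Φ u₀ l) :=
      fun u hu l => sign_eq_of_signType_eq ((hu.2.1 l).trans (hu₀.2.1 l).symm)
    obtain ⟨v, hv, hne⟩ : ∃ v ∈ tangentSpace X grp w A K (Φ u₀),
        ∑ l, w (grp l) * (f l * v l) ≠ 0 := by
      -- Otherwise the sign vector of block `j` would be a coefficient vector of the piece, and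
      -- those vanish outside `𝒢_A`.
      by_contra! hc
      obtain ⟨q, hq⟩ := exists_coefficient_of_orthogonal hn hw hlam huniq hM _ hc
      obtain ⟨l, hl, hl0⟩ := exists_ne_zero_of_blockL1 hu₀.2.2
      have hlA : grp l ∉ A := hl ▸ Finset.mem_compl.1 j.2
      have h1 := congrFun hq l
      rw [expand_apply, hl, if_pos hu₀.2.2, if_neg hl0, coefficient,
        dif_neg fun h => hlA (mem_coSupport.1 h).1, dif_neg hlA] at h1
      simp only [Pi.single_eq_same, one_mul, Real.sign_eq_zero_iff] at h1
      exact hl0 h1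
    refine volume_eq_zero_of_functional hu₀ hT (fun u hu => ⟨(hΦ u hu.1).1, (hΦ u hu.1).2.1⟩)
      hsign (∑ l, (w (grp l) * f l) • LinearMap.proj l) (fun u hu => ?_) hv
      (by rwa [ker_functional_apply])
    rw [ker_functional_apply, ker_functional_apply, hfv, hfv,
      ← blockL1_eq_sum_sign fun k _ => hsign u hu k, ← blockL1_eq_sum_sign fun k _ => rfl,
      hu.2.2, hu₀.2.2]

/-! ### Measurability and the law of the noise. -/

theorem measurableSet_signType_eq (σ : SignType) :
    MeasurableSet {x : ℝ | SignType.sign x = σ} := by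
  cases σ
  · convert measurableSet_singleton (0 : ℝ) using 1
    ext x
    exact sign_eq_zero_iff
  · convert measurableSet_Iio (a := (0 : ℝ)) using 1
    ext x
    exact sign_eq_neg_one_iff
  · convert measurableSet_Ioi (a := (0 : ℝ)) using 1
    ext x
    exact sign_eq_one_iff

theorem measurableSet_inter_preimage_of_continuousOn {α β : Type*} [TopologicalSpace α]
    [MeasurableSpace α] [BorelSpace α] [TopologicalSpace β] [MeasurableSpace β] [BorelSpace β]
    {f : α → β} {Δ : Set α} (hΔ : MeasurableSet Δ) (hf : ContinuousOn f Δ) {C : Set β}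
    (hC : MeasurableSet C) : MeasurableSet {u ∈ Δ | f u ∈ C} := by
  have h := (MeasurableEmbedding.subtype_coe hΔ).measurableSet_image.2
    ((continuousOn_iff_continuous_domRestrict.1 hf).measurable hC)
  convert h using 1
  ext u
  constructor
  · rintro ⟨h1, h2⟩
    exact ⟨⟨u, h1⟩, h2, rfl⟩
  · rintro ⟨⟨v, hv⟩, h2, rfl⟩
    exact ⟨hv, h2⟩

theorem measurableSet_interior_pattern {n p J : ℕ} {X : Matrix (Fin n) (Fin p) ℝ}
    {grp : Fin p → Fin J} {w : Fin J → ℝ} {A : Finset (Fin J)} {K F : Finset (Fin p)}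
    {Δ : Set (F → ℝ)} {Φ : (F → ℝ) → Fin p → ℝ} (hΔ : MeasurableSet Δ) (hc : ContinuousOn Φ Δ)
    (hΦ : ∀ u ∈ Δ, Φ u ∈ subgradientSpace X grp w A K) (τ : Fin p → SignType) :
    MeasurableSet {u ∈ Δ | (∀ k, SignType.sign (Φ u k) = τ k) ∧
      Φ u ∈ subgradientInterior X grp w A K} := by
  have hC : MeasurableSet {x : Fin p → ℝ | (∀ k, SignType.sign (x k) = τ k) ∧
      (∀ k ∈ K, x k ≠ 0) ∧ ∀ j ∉ A, blockL1 grp x j < 1} := by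
    have e : {x : Fin p → ℝ | (∀ k, SignType.sign (x k) = τ k) ∧
        (∀ k ∈ K, x k ≠ 0) ∧ ∀ j ∉ A, blockL1 grp x j < 1}
        = (⋂ k, (fun x : Fin p → ℝ => x k) ⁻¹' {x | SignType.sign x = τ k}) ∩
          ((⋂ k ∈ K, {x | x k ≠ 0}) ∩ ⋂ j ∈ Aᶜ, {x | blockL1 grp x j < 1}) := by
      ext x
      simp
    rw [e]
    refine (MeasurableSet.iInter fun k => measurable_pi_apply k (measurableSet_signType_eq _)).inter
      ((Finset.measurableSet_biInter K fun k _ => ?_).inter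
        (Finset.measurableSet_biInter _ fun j _ => ?_))
    · exact (isOpen_ne_fun (continuous_apply k) continuous_const).measurableSet
    · exact (isOpen_lt (continuous_blockL1 grp j) continuous_const).measurableSet
  convert measurableSet_inter_preimage_of_continuousOn hΔ hc hC using 1
  ext u
  constructor
  · rintro ⟨h1, h2, h3⟩
    exact ⟨h1, h2, h3.2⟩
  · rintro ⟨h1, h2, h3⟩
    exact ⟨h1, h2, hΦ u h1, h3⟩

/-- The estimators are not assumed measurable. Null measurability of their events is inherited from
images of parameter sets, and it suffices for countable additivity. -/
theorem measure_preimage_of_density {Ω : Type*} [MeasurableSpace Ω] {P : Measure Ω} {n : ℕ}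
    {ξ : Ω → Fin n → ℝ} (hξ : AEMeasurable ξ P) {g : (Fin n → ℝ) → ENNReal}
    (hdens : P.map ξ = volume.withDensity g) {D : Set (Fin n → ℝ)}
    (hD : NullMeasurableSet D volume) :
    NullMeasurableSet (ξ ⁻¹' D) P ∧ P (ξ ⁻¹' D) = ∫⁻ v in D, g v := by
  have hac : P.map ξ ≪ volume := hdens ▸ withDensity_absolutelyContinuous _ _
  have hD' : NullMeasurableSet D (P.map ξ) := hD.mono_ac hac
  refine ⟨?_, ?_⟩
  · obtain ⟨t, -, ht, hte⟩ := hD'.exists_measurable_superset_ae_eq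
    have h1 : ξ ⁻¹' t =ᵐ[P] ξ ⁻¹' D := ae_of_ae_map hξ hte
    exact (hξ.nullMeasurable ht).congr h1
  · rw [← Measure.map_apply₀ hξ hD', hdens, withDensity_apply']

/-- Translations and dilations preserve null sets, so the law of the response is absolutely
continuous. -/
theorem ae_response {Ω : Type*} [MeasurableSpace Ω] {P : Measure Ω} {n : ℕ} (hn : 0 < n)
    {ε : Ω → Fin n → ℝ} (hε : AEMeasurable ε P) {g : (Fin n → ℝ) → ENNReal}
    (hdens : P.map (fun ω => (Real.sqrt n)⁻¹ • ε ω) = volume.withDensity g) (a : Fin n → ℝ)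
    {Q : (Fin n → ℝ) → Prop} (hQ : ∀ᵐ y, Q y) : ∀ᵐ ω ∂P, Q (a + ε ω) := by
  have hs : Real.sqrt n ≠ 0 := (Real.sqrt_pos.2 (by exact_mod_cast hn)).ne'
  have h1 : ∀ᵐ x : Fin n → ℝ, Q (a + x) :=
    (measurePreserving_add_left volume a).quasiMeasurePreserving.ae hQ
  have h2 : ∀ᵐ x : Fin n → ℝ, Q (a + Real.sqrt n • x) := by
    rw [ae_iff] at h1 ⊢
    have h3 := Measure.addHaar_preimage_smul volume hs {x : Fin n → ℝ | ¬Q (a + x)}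
    rw [h1, mul_zero] at h3
    exact h3
  have hac : P.map (fun ω => (Real.sqrt n)⁻¹ • ε ω) ≪ volume :=
    hdens ▸ withDensity_absolutelyContinuous _ _
  have h4 : ∀ᵐ ω ∂P, Q (a + Real.sqrt n • (Real.sqrt n)⁻¹ • ε ω) :=
    ae_of_ae_map (f := fun ω => (Real.sqrt n)⁻¹ • ε ω) (hε.const_smul (Real.sqrt n)⁻¹) (hac.ae_le h2)
  filter_upwards [h4] with ω hω
  rwa [smul_smul, mul_inv_cancel₀ hs, one_smul] at hω

theorem jacobian_congr {n p J : ℕ} {X : Matrix (Fin n) (Fin p) ℝ} {grp : Fin p → Fin J}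
    {w : Fin J → ℝ} {lam : ℝ} {A : Finset (Fin J)} {K F : Finset (Fin p)} {s s' : Fin p → ℝ}
    (h : ∀ k, Real.sign (s k) = Real.sign (s' k)) (T : Matrix (freeIndices grp A K) F ℝ)
    (e : A ⊕ (coSupport grp A K ⊕ F) ≃ Fin n) :
    jacobian X grp w lam A K s F T e = jacobian X grp w lam A K s' F T e := by
  have : gramSign X grp s = gramSign X grp s' := by
    unfold gramSign
    simp only [h]
  unfold jacobian tangentMap
  rw [this]

/-! ### The density formula. -/

/-- Almost surely, the estimator lies over a set of parameters exactly when the scaled noise lies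
in the image of this set. -/
theorem mem_event_iff {n p J : ℕ} (hn : 0 < n) (hnp : n ≤ p) {X : Matrix (Fin n) (Fin p) ℝ}
    (hX : ColumnsIndependent X) {grp : Fin p → Fin J} {w : Fin J → ℝ} (hw : ∀ j, 0 < w j)
    {lam : ℝ} (hlam : 0 < lam) (β₀ : Fin p → ℝ)
    (huniq : ∀ᵐ y : Fin n → ℝ, ∃! bs : (Fin p → ℝ) × (Fin p → ℝ),
      IsAugmentedSolution X grp w lam y bs.1 bs.2)
    {v : Fin n → ℝ} {β S : Fin p → ℝ}
    (haug : IsAugmentedSolution X grp w lam (X.mulVec β₀ + v) β S)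
    (hstrict : ∀ j, blockL1 grp S j = 1 → 0 < blockSup grp β j)
    (hu : ∃! bs : (Fin p → ℝ) × (Fin p → ℝ),
      IsAugmentedSolution X grp w lam (X.mulVec β₀ + v) bs.1 bs.2)
    {A : Finset (Fin J)} {K F : Finset (Fin p)} (hK : ∀ k ∈ K, grp k ∈ A)
    {Γ : Set ((A → ℝ) × (coSupport grp A K → ℝ))} (hΓ : Γ ⊆ coneProduct grp A K)
    {Δ : Set (F → ℝ)} {Φ : (F → ℝ) → Fin p → ℝ} (τ : Fin p → SignType) :
    ((coordinates grp A K β ∈ Γ ∧ S ∈ Φ '' Δ ∧ activeBlocks grp β = A ∧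
        activeSupport grp β S = K) ∧ ∀ k, SignType.sign (S k) = τ k) ↔
      (Real.sqrt n)⁻¹ • v ∈ (fun θ : ((A → ℝ) × (coSupport grp A K → ℝ)) × (F → ℝ) =>
        scaledMap X grp w lam β₀ (coefficient grp A K θ.1 (Φ θ.2)) (Φ θ.2)) ''
        (Γ ×ˢ {u ∈ Δ | (∀ k, SignType.sign (Φ u k) = τ k) ∧
          Φ u ∈ subgradientInterior X grp w A K}) := by
  constructor
  · rintro ⟨⟨h1, ⟨u, hu, rfl⟩, h3, h4⟩, h5⟩
    obtain ⟨-, -, hint, hβ⟩ := haug.representation hn hw hlam huniq hstrict h3 h4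
    refine ⟨(coordinates grp A K β, u), ⟨h1, hu, h5, hint⟩, ?_⟩
    simp only
    rw [← hβ]
    exact ((eq_dual_iff_scaledMap hn hnp hX grp hw hlam β₀ β
      (haug.mem_rowSpace hn hw hlam) v).1 (haug.eq_dual hn hw hlam)).symm
  · rintro ⟨⟨q, u⟩, ⟨hq, huΔ, hsign, hint⟩, heq⟩
    have hqc := hΓ hq
    -- The point with these parameters is itself an augmented solution, so uniqueness identifies it
    -- with the estimator.
    have hsol : IsAugmentedSolution X grp w lam (X.mulVec β₀ + v)
        (coefficient grp A K q (Φ u)) (Φ u) :=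
      isAugmentedSolution_of_dual hn hw hlam (fun j =>
        (isAligned_coefficient hint.1 hqc).isBlockSubgradient (blockL1_le_one_of_mem hint.1 j))
        ((eq_dual_iff_scaledMap hn hnp hX grp hw hlam β₀ _ hint.1.1 v).2 heq.symm)
    have h := hu.unique (y₁ := (β, S)) (y₂ := (_, _)) haug hsol
    have hβ : β = coefficient grp A K q (Φ u) := congrArg Prod.fst h
    have hS : S = Φ u := congrArg Prod.snd h
    rw [hβ, hS]
    refine ⟨⟨?_, ⟨u, huΔ, rfl⟩, activeBlocks_coefficient hint.1 hqc,
      activeSupport_coefficient hK hint hqc⟩, hsign⟩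
    rw [coordinates_coefficient hint.1 hqc]
    exact hq

/-- The change of variables on the part of the sample space with a fixed sign pattern. -/
theorem lintegral_image_scaledMap {n p J : ℕ} {X : Matrix (Fin n) (Fin p) ℝ}
    {grp : Fin p → Fin J} {w : Fin J → ℝ} (lam : ℝ) (β₀ : Fin p → ℝ)
    (g : (Fin n → ℝ) → ENNReal) {A : Finset (Fin J)} {K F : Finset (Fin p)}
    (e : A ⊕ (coSupport grp A K ⊕ F) ≃ Fin n)
    {Γ : Set ((A → ℝ) × (coSupport grp A K → ℝ))} (hΓ : MeasurableSet Γ)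
    {B : Set (F → ℝ)} (hB : MeasurableSet B) {Φ : (F → ℝ) → Fin p → ℝ}
    {T : (F → ℝ) → Matrix (freeIndices grp A K) F ℝ}
    (hΦ : ∀ u ∈ B, Φ u ∈ subgradientSpace X grp w A K ∧ (fun k : F => Φ u k) = u ∧
      IsTangentMatrix X grp w A K (Φ u) F (T u))
    (hsign : ∀ u ∈ B, ∀ u' ∈ B, ∀ k, Real.sign (Φ u k) = Real.sign (Φ u' k)) :
    NullMeasurableSet ((fun θ : ((A → ℝ) × (coSupport grp A K → ℝ)) × (F → ℝ) =>
        scaledMap X grp w lam β₀ (coefficient grp A K θ.1 (Φ θ.2)) (Φ θ.2)) '' (Γ ×ˢ B)) volume ∧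
      ∫⁻ v in (fun θ : ((A → ℝ) × (coSupport grp A K → ℝ)) × (F → ℝ) =>
        scaledMap X grp w lam β₀ (coefficient grp A K θ.1 (Φ θ.2)) (Φ θ.2)) '' (Γ ×ˢ B), g v
        = ∫⁻ θ in Γ ×ˢ B, density X grp w lam β₀ g A K F (T θ.2) e θ.1 (Φ θ.2) := by
  rcases B.eq_empty_or_nonempty with rfl | ⟨u₀, hu₀⟩
  · simp
  obtain ⟨hM₀, -, hT₀⟩ := hΦ u₀ hu₀
  obtain ⟨c, hc⟩ := scaledMap_affine lam β₀ hM₀ hT₀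
  -- The tangent matrix and the Jacobian depend only on signs, so those at `u₀` serve all of `B`.
  have h := lintegral_image_affine e
    (Real.sqrt n • (pinv X.transpose * tangentMap X grp w lam A K (Φ u₀) F (T u₀))) c
    (hΓ.prod hB) (h := fun θ => scaledMap X grp w lam β₀ (coefficient grp A K θ.1 (Φ θ.2)) (Φ θ.2))
    (fun θ hθ => by
      have := hc θ.1 (Φ θ.2) (hΦ _ hθ.2).1 (hsign _ hθ.2 _ hu₀)
      rwa [(hΦ _ hθ.2).2.1] at this) g
  refine ⟨h.1, h.2.trans (setLIntegral_congr_fun (hΓ.prod hB) fun θ hθ => ?_)⟩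
  rw [density, (hΦ _ hθ.2).2.2.unique (hsign _ hθ.2 _ hu₀) hT₀,
    jacobian_congr (hsign _ hθ.2 _ hu₀), jacobian]

/-- For each of the finitely many sign patterns, the event agrees almost surely with the preimage,
under the scaled noise, of an affine image. These events are disjoint, and the interior parameters
exhaust `Δ` up to a null set. -/
theorem measure_event_eq_lintegral {n p J : ℕ} (hn : 0 < n) (hnp : n ≤ p)
    {X : Matrix (Fin n) (Fin p) ℝ} (hX : ColumnsIndependent X) {grp : Fin p → Fin J}
    {w : Fin J → ℝ} (hw : ∀ j, 0 < w j) {lam : ℝ} (hlam : 0 < lam) (β₀ : Fin p → ℝ)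
    (huniq : ∀ᵐ y : Fin n → ℝ, ∃! bs : (Fin p → ℝ) × (Fin p → ℝ),
      IsAugmentedSolution X grp w lam y bs.1 bs.2)
    {Ω : Type*} [MeasurableSpace Ω] {P : Measure Ω} {ε : Ω → Fin n → ℝ} (hε : AEMeasurable ε P)
    {g : (Fin n → ℝ) → ENNReal}
    (hdens : P.map (fun ω => (Real.sqrt n)⁻¹ • ε ω) = volume.withDensity g)
    {βhat S : Ω → Fin p → ℝ}
    (haug : ∀ᵐ ω ∂P, IsAugmentedSolution X grp w lam (X.mulVec β₀ + ε ω) (βhat ω) (S ω))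
    {A : Finset (Fin J)} {K F : Finset (Fin p)} (hK : ∀ k ∈ K, grp k ∈ A)
    (e : A ⊕ (coSupport grp A K ⊕ F) ≃ Fin n)
    {Γ : Set ((A → ℝ) × (coSupport grp A K → ℝ))} (hΓ : MeasurableSet Γ)
    (hΓc : Γ ⊆ coneProduct grp A K) {Δ : Set (F → ℝ)} (hΔ : MeasurableSet Δ)
    {Φ : (F → ℝ) → Fin p → ℝ} (hcont : ContinuousOn Φ Δ)
    {T : (F → ℝ) → Matrix (freeIndices grp A K) F ℝ}
    (hΦ : ∀ u ∈ Δ, Φ u ∈ subgradientSpace X grp w A K ∧ (fun k : F => Φ u k) = u ∧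
      IsTangentMatrix X grp w A K (Φ u) F (T u)) :
    P {ω | coordinates grp A K (βhat ω) ∈ Γ ∧ S ω ∈ Φ '' Δ ∧
        activeBlocks grp (βhat ω) = A ∧ activeSupport grp (βhat ω) (S ω) = K} =
      ∫⁻ θ in Γ ×ˢ Δ, density X grp w lam β₀ g A K F (T θ.2) e θ.1 (Φ θ.2) := by
  set B : (Fin p → SignType) → Set (F → ℝ) := fun τ =>
    {u ∈ Δ | (∀ k, SignType.sign (Φ u k) = τ k) ∧ Φ u ∈ subgradientInterior X grp w A K} with hBdef
  set H : ((A → ℝ) × (coSupport grp A K → ℝ)) × (F → ℝ) → Fin n → ℝ := fun θ =>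
    scaledMap X grp w lam β₀ (coefficient grp A K θ.1 (Φ θ.2)) (Φ θ.2) with hH
  set E : (Fin p → SignType) → Set Ω := fun τ =>
    {ω | (coordinates grp A K (βhat ω) ∈ Γ ∧ S ω ∈ Φ '' Δ ∧
      activeBlocks grp (βhat ω) = A ∧ activeSupport grp (βhat ω) (S ω) = K) ∧
      ∀ k, SignType.sign (S ω k) = τ k} with hE
  have hBm : ∀ τ, MeasurableSet (B τ) :=
    measurableSet_interior_pattern hΔ hcont fun u hu => (hΦ u hu).1
  have hE_ae : ∀ τ, E τ =ᵐ[P] (fun ω => (Real.sqrt n)⁻¹ • ε ω) ⁻¹' (H '' (Γ ×ˢ B τ)) := by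
    intro τ
    filter_upwards [haug, ae_response hn hε hdens (X.mulVec β₀) huniq,
      ae_response hn hε hdens (X.mulVec β₀) (ae_strict_complementarity hn hw hlam huniq)]
      with ω h1 h2 h3
    exact propext (mem_event_iff hn hnp hX hw hlam β₀ huniq h1 (h3 _ _ h1) h2 hK hΓc τ)
  have hint : ∀ τ, NullMeasurableSet (H '' (Γ ×ˢ B τ)) volume ∧
      ∫⁻ v in H '' (Γ ×ˢ B τ), g v
        = ∫⁻ θ in Γ ×ˢ B τ, density X grp w lam β₀ g A K F (T θ.2) e θ.1 (Φ θ.2) := fun τ =>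
    lintegral_image_scaledMap lam β₀ g e hΓ (hBm τ) (fun u hu => hΦ u hu.1)
      fun u hu u' hu' k => sign_eq_of_signType_eq ((hu.2.1 k).trans (hu'.2.1 k).symm)
  have hpre := fun τ => measure_preimage_of_density (ξ := fun ω => (Real.sqrt n)⁻¹ • ε ω)
    (hε.const_smul (Real.sqrt n)⁻¹) hdens (hint τ).1
  have hEP : ∀ τ, P (E τ)
      = ∫⁻ θ in Γ ×ˢ B τ, density X grp w lam β₀ g A K F (T θ.2) e θ.1 (Φ θ.2) := fun τ => by
    rw [measure_congr (hE_ae τ), (hpre τ).2, (hint τ).2]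
  have hEunion : {ω | coordinates grp A K (βhat ω) ∈ Γ ∧ S ω ∈ Φ '' Δ ∧
      activeBlocks grp (βhat ω) = A ∧ activeSupport grp (βhat ω) (S ω) = K} = ⋃ τ, E τ := by
    ext ω
    rw [Set.mem_iUnion]
    exact ⟨fun h => ⟨fun k => SignType.sign (S ω k), h, fun _ => rfl⟩, fun ⟨_, h⟩ => h.1⟩
  have hEdisj : Pairwise (Function.onFun (AEDisjoint P) E) := by
    intro τ τ' hne
    refine Disjoint.aedisjoint (Set.disjoint_left.2 fun ω h h' => hne ?_)
    funext k
    rw [← h.2 k, h'.2 k]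
  have hBdisj : Pairwise (Function.onFun Disjoint fun τ => Γ ×ˢ B τ) := by
    intro τ τ' hne
    refine Set.disjoint_left.2 fun θ h h' => hne ?_
    funext k
    rw [← h.2.2.1 k, h'.2.2.1 k]
  have hae : (⋃ τ, Γ ×ˢ B τ : Set (((A → ℝ) × (coSupport grp A K → ℝ)) × (F → ℝ)))
      =ᵐ[volume] Γ ×ˢ Δ := by
    have hnull : volume ((Set.univ : Set ((A → ℝ) × (coSupport grp A K → ℝ))) ×ˢ
        {u ∈ Δ | Φ u ∉ subgradientInterior X grp w A K}) = 0 := by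
      rw [Measure.volume_eq_prod, Measure.prod_prod,
        volume_not_interior hn hw hlam huniq hK hΦ, mul_zero]
    filter_upwards [measure_eq_zero_iff_ae_notMem.1 hnull] with θ hθ
    refine propext ⟨fun h => ?_, fun h => ?_⟩
    · obtain ⟨τ, h⟩ := Set.mem_iUnion.1 h
      exact ⟨h.1, h.2.1⟩
    · refine Set.mem_iUnion.2 ⟨fun k => SignType.sign (Φ θ.2 k), h.1, h.2, fun _ => rfl, ?_⟩
      by_contra hc
      exact hθ ⟨trivial, h.2, hc⟩
  rw [hEunion, measure_iUnion₀ hEdisj fun τ => (hpre τ).1.congr (hE_ae τ).symm,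
    ← setLIntegral_congr hae, lintegral_iUnion (fun τ => hΓ.prod (hBm τ)) hBdisj]
  exact tsum_congr hEP

end BlockLasso

/-! ### The distribution of the augmented estimator. -/

theorem theorem3 {n p J : ℕ} (hn : 0 < n) (hnp : n ≤ p)
    (X : Matrix (Fin n) (Fin p) ℝ) (grp : Fin p → Fin J) (w : Fin J → ℝ) (hw : ∀ j, 0 < w j)
    (lam : ℝ) (hlam : 0 < lam) (β₀ : Fin p → ℝ)
    (hX : ColumnsIndependent X)
    (huniq : ∀ᵐ y : Fin n → ℝ, ∃! β : Fin p → ℝ, IsSolution X grp w lam y β)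
    {Ω : Type*} [MeasurableSpace Ω] (P : Measure Ω) [IsProbabilityMeasure P]
    (ε : Ω → Fin n → ℝ) (hε : AEMeasurable ε P)
    (g : (Fin n → ℝ) → ENNReal) (hg : Measurable g)
    (hdens : P.map (fun ω => (Real.sqrt n)⁻¹ • ε ω) = volume.withDensity g)
    (βhat S : Ω → Fin p → ℝ)
    (haug : ∀ᵐ ω ∂P, IsAugmentedSolution X grp w lam (X.mulVec β₀ + ε ω) (βhat ω) (S ω)) :
    -- the augmented solution exists and is unique for almost every response
    (∀ᵐ y : Fin n → ℝ, ∃! bs : (Fin p → ℝ) × (Fin p → ℝ),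
      IsAugmentedSolution X grp w lam y bs.1 bs.2) ∧
    -- almost surely the augmented estimator is represented by an element of the sample space
    (∀ᵐ ω ∂P, ∀ (A : Finset (Fin J)) (K : Finset (Fin p)),
      activeBlocks grp (βhat ω) = A → activeSupport grp (βhat ω) (S ω) = K →
        Admissible n grp A K ∧
        (coordinates grp A K (βhat ω), S ω) ∈ piece X grp w A K ∧
        S ω ∈ subgradientInterior X grp w A K ∧
        βhat ω = coefficient grp A K (coordinates grp A K (βhat ω)) (S ω)) ∧
    ∀ (A : Finset (Fin J)) (K : Finset (Fin p)), Admissible n grp A K →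
      -- the pieces are products of convex cones with polyhedral sets
      (∀ j ∈ A, ∃ C : ConvexCone ℝ (ℝ × ({k : coSupport grp A K // grp k = j} → ℝ)),
        (C : Set (ℝ × ({k : coSupport grp A K // grp k = j} → ℝ))) = blockCone grp A K j) ∧
      IsPolyhedral (subgradientSpace X grp w A K) ∧
      -- near every interior point the subgradient space is parameterized by some `s_F`
      (∀ s ∈ subgradientInterior X grp w A K, ∃ (F : Finset (Fin p))
        (T : Matrix (freeIndices grp A K) F ℝ),
        F.card = n - A.card - (coSupport grp A K).card ∧
        IsTangentMatrix X grp w A K s F T ∧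
        ∃ (U : Set (Fin p → ℝ)) (Δ : Set (F → ℝ)), IsOpen U ∧ s ∈ U ∧ IsOpen Δ ∧
          Set.BijOn (fun (x : Fin p → ℝ) (k : F) => x k) (subgradientSpace X grp w A K ∩ U) Δ ∧
          ∀ x ∈ subgradientSpace X grp w A K ∩ U,
            (fun k : freeIndices grp A K => x k - s k) = T.mulVec (fun k : F => x k - s k)) ∧
      -- the density in the coordinates `θ = (r_A, b_{Kᶜ}, s_F)`
      ∀ (F : Finset (Fin p)) (e : A ⊕ (coSupport grp A K ⊕ F) ≃ Fin n)
        (Γ : Set ((A → ℝ) × (coSupport grp A K → ℝ))) (Δ : Set (F → ℝ))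
        (Φ : (F → ℝ) → Fin p → ℝ) (T : (F → ℝ) → Matrix (freeIndices grp A K) F ℝ),
        MeasurableSet Γ → Γ ⊆ coneProduct grp A K →
        MeasurableSet Δ → ContinuousOn Φ Δ →
        (∀ u ∈ Δ, Φ u ∈ subgradientSpace X grp w A K ∧ (fun k : F => Φ u k) = u ∧
          IsTangentMatrix X grp w A K (Φ u) F (T u)) →
        P {ω | coordinates grp A K (βhat ω) ∈ Γ ∧ S ω ∈ Φ '' Δ ∧
            activeBlocks grp (βhat ω) = A ∧ activeSupport grp (βhat ω) (S ω) = K} =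
          ∫⁻ θ in Γ ×ˢ Δ, density X grp w lam β₀ g A K F (T θ.2) e θ.1 (Φ θ.2) := by
  have hu : ∀ᵐ y : Fin n → ℝ, ∃! bs : (Fin p → ℝ) × (Fin p → ℝ),
      IsAugmentedSolution X grp w lam y bs.1 bs.2 := by
    filter_upwards [huniq] with y hy
    exact existsUnique_isAugmentedSolution hn hw hlam hy
  refine ⟨hu, ?_, fun A K hAK => ⟨fun j _ => exists_convexCone_eq_blockCone grp A K j,
    isPolyhedral_subgradientSpace X grp w A K,
    fun s hs => exists_local_parameterization hn hnp hX hw hlam hu hs, ?_⟩⟩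
  · filter_upwards [haug, ae_response hn hε hdens (X.mulVec β₀)
      (ae_strict_complementarity hn hw hlam hu)] with ω h1 h2 A K hA hK
    exact h1.representation hn hw hlam hu (h2 _ _ h1) hA hK
  · intro F e Γ Δ Φ T hΓ hΓc hΔ hcont hΦ
    exact measure_event_eq_lintegral hn hnp hX hw hlam β₀ hu hε hdens haug hAK.subset e hΓ hΓc hΔ
      hcont hΦ
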